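/- Let $\mathcal P_2(\mathbb R^d)$ be the set of Borel probability measures on $\mathbb R^d$ with finite second moment, $W_2$ the quadratic Wasserstein distance on it, and $\mathcal P_2^a(\mathbb R^d)$ its subset of absolutely continuous measures. For $\mu\in\mathcal P_2(\mathbb R^d)$ let $H(\mu)=\int\log\frac{d\mu}{dx}\,d\mu\in(-\infty,+\infty]$, with $H(\mu)=+\infty$ if $\mu$ is not absolutely continuous. **Definitions.** A first variation of $G:\mathcal P_2(\mathbb R^d)\to\mathbb R$ at $\mu$ is a continuous function $V[\mu]:\mathbb R^d\to\mathbb R$, integrable for every element of $\mathcal P_2(\mathbb R^d)$, such that for all $\nu\in\mathcal P_2(\mathbb R^d)$ $$\lim_{\epsilon\downarrow0}\tfrac1\epsilon\big(G((1-\epsilon)\mu+\epsilon\nu)-G(\mu)\big)=\int V[\mu]\,d(\nu-\mu);$$ it is unique up to an additive constant. A measure $\nu\in\mathcal P_2^a(\mathbb R^d)$ with positive continuous density satisfies $\mathrm{LSI}(\rho)$, $\rho>0$, if for all $\mu\in\mathcal P_2^a(\mathbb R^d)$ with $\mu\ll\nu$ $$\int\log\frac{d\mu}{d\nu}\,d\mu\le\frac1{2\rho}\int\Big\|\nabla\log\frac{d\mu}{d\nu}\Big\|^2d\mu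 ,$$ where, with $f=\frac{d\mu}{d\nu}$, $\nabla\log f=\nabla f/f$ for the weak gradient $\nabla f$, and the right-hand side is $+\infty$ if $f\notin W^{1,1}_{\rm loc}(\mathbb R^d)$. **Setting.** Let $\mathcal D$ be a probability measure on $\mathbb R^n\times\mathbb R$ with $\mathbf E_{(z,y)\sim\mathcal D}[y^2]<\infty$. Let $\ell$ be the square loss $\ell(y,y')=\frac12|y-y'|^2$ or the logistic loss $\ell(y,y')=\log(1+e^{-yy'})$, and let $\ell'$ be its derivative in $y'$. Let $\Phi:\mathbb R^n\times\mathbb R^d\to\mathbb R$ be continuous with $|\Phi|\le K$ for some $K>0$, and assume that $\Phi$ is smooth in $x$ uniformly in $z$: there is a constant $C$ such that for every $z$ the function $\Phi(z,\cdot)$ is differentiable with $C$-Lipschitz gradient. Let $\lambda>0$ and, for $\mu\in\mathcal P_2(\mathbb R^d)$, $$G(\mu)=\mathbf E_{(z,y)\sim\mathcal D}\,\ell\Big(y,\int\Phi(z,x)\,d\mu(x)\Big)+\frac\lambda2\int\|x\|^2d\mu(x).$$ **Proposition.** 1. For every $\mu\in\mathcal P_2(\mathbb R^d)$ the expectations defining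 $G(\mu)$ and $V[\mu]$ below converge, and $G$ has a first variation at $\mu$, given by $$V[\mu](x)=\mathbf E_{(z,y)\sim\mathcal D}\Big[\ell'\Big(y,\int\Phi(z,x')\,d\mu(x')\Big)\Phi(z,x)\Big]+\frac\lambda2\|x\|^2 .$$ 2. (Smoothness.) The first variations of $G$ are $C^1$, and there is $L>0$ such that $\|\nabla V[\mu](x)-\nabla V[\nu](y)\|\le L(\|x-y\|+W_2(\mu,\nu))$ for all $\mu,\nu\in\mathcal P_2(\mathbb R^d)$ and $x,y\in\mathbb R^d$. 3. (Convexity and existence.) $G((1-\alpha)\mu+\alpha\nu)\le(1-\alpha)G(\mu)+\alpha G(\nu)$ for all $\mu,\nu\in\mathcal P_2(\mathbb R^d)$ and $\alpha\in[0,1]$, and for every $\tau>0$ the functional $F_\tau=G+\tau H$ has a minimizer over $\mathcal P_2(\mathbb R^d)$, which lies in $\mathcal P_2^a(\mathbb R^d)$. 4. (Uniform log-Sobolev inequality.) Let $\tau>0$. For every $\mu\in\mathcal P_2(\mathbb R^d)$ one has $e^{-V[\mu]/\tau}\in L^1(\mathbb R^d)$, and the probability measure proportional to $e^{-V[\mu]/\tau}$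 lies in $\mathcal P_2^a(\mathbb R^d)$ and satisfies $\mathrm{LSI}(\rho_\tau)$, in each of the following cases: - $\ell$ is the logistic loss and $|y|\le1$ $\mathcal D$-almost surely (for instance $y\in\{-1,1\}$), with $\rho_\tau=\frac\lambda\tau e^{-2K/\tau}$; - $\ell$ is the square loss and $|\mathbf E[y\mid z]|\le K'$ almost surely, with $\rho_\tau=\frac\lambda\tau e^{-2K(K+K')/\tau}$. In other words, the best such constant is at least $\rho_\tau$. -/

import Mathlib

open MeasureTheory Filter Topology
open scoped ENNReal NNReal ContDiff Gradient

noncomputable section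

namespace MeanFieldLangevin

/-- `E d` is `ℝ^d` with its Euclidean norm. -/
abbrev E (d : ℕ) : Type := EuclideanSpace ℝ (Fin d)

/-- Membership in `𝒫₂(ℝ^d)`: probability measures with finite second moment. -/
def IsP2 {d : ℕ} (μ : Measure (E d)) : Prop :=
  IsProbabilityMeasure μ ∧ ∫⁻ x, ‖x‖ₑ ^ 2 ∂μ < ⊤

/-- Membership in `𝒫₂ᵃ(ℝ^d)`: in addition absolutely continuous for Lebesgue measure. -/
def IsP2a {d : ℕ} (μ : Measure (E d)) : Prop :=
  IsP2 μ ∧ μ ≪ volume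

/-- The mixture `(1 - α) μ + α ν`, for `α ∈ [0, 1]`. -/
def mix {d : ℕ} (α : ℝ) (μ ν : Measure (E d)) : Measure (E d) :=
  ENNReal.ofReal (1 - α) • μ + ENNReal.ofReal α • ν

/-- Transport plans between `μ` and `ν`. -/
def plans {d : ℕ} (μ ν : Measure (E d)) : Set (Measure (E d × E d)) :=
  {γ | γ.map Prod.fst = μ ∧ γ.map Prod.snd = ν}

/-- The Wasserstein distance `W₂` (finite on `𝒫₂`). -/
def W2 {d : ℕ} (μ ν : Measure (E d)) : ℝ :=
  √(⨅ γ ∈ plans μ ν, ∫⁻ p, ‖p.2 - p.1‖ₑ ^ 2 ∂γ).toReal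

/-- `V` is a first variation at `μ` of the functional `G` on `𝒫₂(ℝ^d)`. Taking `ν = δ_x` shows
that it is unique up to an additive constant. -/
def IsFirstVariation {d : ℕ} (G : Measure (E d) → ℝ) (μ : Measure (E d)) (V : E d → ℝ) : Prop :=
  Continuous V ∧ Integrable V μ ∧
    ∀ ν : Measure (E d), IsP2 ν →
      Integrable V ν ∧
      Tendsto (fun ε : ℝ => (1 / ε) * (G (mix ε μ ν) - G μ)) (𝓝[>] 0)
        (𝓝 (∫ x, V x ∂ν - ∫ x, V x ∂μ))

/-- Smoothness of `G`: it has `C¹` first variations `V[μ]`, and `(μ, x) ↦ ∇V[μ](x)` is Lipschitz. -/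
def IsSmooth {d : ℕ} (G : Measure (E d) → ℝ) : Prop :=
  ∃ V : Measure (E d) → E d → ℝ,
    (∀ μ, IsP2 μ → IsFirstVariation G μ (V μ) ∧ ContDiff ℝ 1 (V μ)) ∧
    ∃ L : ℝ, 0 < L ∧ ∀ μ ν, IsP2 μ → IsP2 ν → ∀ x y : E d,
      ‖∇ (V μ) x - ∇ (V ν) y‖ ≤ L * (‖x - y‖ + W2 μ ν)

/-- Convexity of `G` for the linear structure on `𝒫₂(ℝ^d)`. -/
def IsConvex {d : ℕ} (G : Measure (E d) → ℝ) : Prop :=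
  ∀ μ ν, IsP2 μ → IsP2 ν → ∀ α : ℝ, 0 ≤ α → α ≤ 1 →
    G (mix α μ ν) ≤ (1 - α) * G μ + α * G ν

open scoped Classical in
/-- The entropy `H(μ) = ∫ log (dμ/dx) dμ`. For `μ ∈ 𝒫₂(ℝ^d)` the negative part of the integrand
is `μ`-integrable, so that `H(μ)` is `+∞` when the integrand is not integrable; it is also `+∞`
when `μ` has no density. -/
def entropy {d : ℕ} (μ : Measure (E d)) : EReal :=
  if μ ≪ volume ∧ Integrable (fun x => Real.log (μ.rnDeriv volume x).toReal) μ then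
    ((∫ x, Real.log (μ.rnDeriv volume x).toReal ∂μ : ℝ) : EReal)
  else ⊤

/-- The regularized functional `F_τ = G + τ H`, for `τ > 0`. -/
def freeEnergy {d : ℕ} (G : Measure (E d) → ℝ) (τ : ℝ) (μ : Measure (E d)) : EReal :=
  (G μ : EReal) + (τ : EReal) * entropy μ

/-- `F_τ` has a minimizer, which is absolutely continuous. -/
def HasMinimizer {d : ℕ} (G : Measure (E d) → ℝ) (τ : ℝ) : Prop :=
  ∃ μ₀, IsP2a μ₀ ∧ ∀ μ, IsP2 μ → freeEnergy G τ μ₀ ≤ freeEnergy G τ μ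

/-- `g` is the weak (distributional) gradient of `f` on `ℝ^d`, that is, `f ∈ W^{1,1}_loc` and
`∇ f = g`. -/
def HasWeakGradient {d : ℕ} (f : E d → ℝ) (g : E d → E d) : Prop :=
  LocallyIntegrable f volume ∧ LocallyIntegrable g volume ∧
    ∀ φ : E d → ℝ, ContDiff ℝ ∞ φ → HasCompactSupport φ → ∀ v : E d,
      ∫ x, f x * fderiv ℝ φ x v = - ∫ x, inner ℝ (g x) v * φ x

/-- The relative Fisher information `I(μ|ν) = ∫ ‖∇ log f‖² dμ`, `f = dμ/dν`, where
`∇ log f = ∇f / f` with `∇f` the weak gradient of `f`; it is `∞` when `f` is not weakly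
differentiable. As weak gradients are unique almost everywhere, the infimum runs over equal values.
It is meant for `μ ≪ ν` and `ν` with a positive continuous Lebesgue density. -/
def relFisher {d : ℕ} (μ ν : Measure (E d)) : ℝ≥0∞ :=
  ⨅ (g : E d → E d) (_ : HasWeakGradient (fun x => (μ.rnDeriv ν x).toReal) g),
    ∫⁻ x, ‖((μ.rnDeriv ν x).toReal)⁻¹ • g x‖ₑ ^ 2 ∂μ

/-- `ν ∈ 𝒫₂ᵃ(ℝ^d)` satisfies the logarithmic Sobolev inequality `LSI(ρ)`. -/
def SatisfiesLSI {d : ℕ} (ν : Measure (E d)) (ρ : ℝ) : Prop :=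
  IsP2a ν ∧ 0 < ρ ∧
    ∀ μ : Measure (E d), IsP2a μ → μ ≪ ν →
      InformationTheory.klDiv μ ν ≤ ENNReal.ofReal (1 / (2 * ρ)) * relFisher μ ν

/-- Uniform log-Sobolev property with constant `ρ`: for every `μ ∈ 𝒫₂(ℝ^d)`, the functional has a
first variation `V[μ]`, `e^{-V[μ]/τ}` is integrable, and the probability measure proportional to
`e^{-V[μ]/τ}` satisfies `LSI(ρ)`. (The normalized measure does not depend on the additive constant
in `V[μ]`.) -/
def UniformLSI {d : ℕ} (G : Measure (E d) → ℝ) (τ ρ : ℝ) : Prop :=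
  ∀ μ, IsP2 μ →
    (∃ V : E d → ℝ, IsFirstVariation G μ V) ∧
    ∀ V : E d → ℝ, IsFirstVariation G μ V →
      Integrable (fun x => Real.exp (-V x / τ)) volume ∧
      SatisfiesLSI (volume.tilted (fun x => -V x / τ)) ρ

/-- The square loss `ℓ(y, u) = |y - u|² / 2`. -/
def squareLoss (y u : ℝ) : ℝ := 1 / 2 * |y - u| ^ 2

/-- The logistic loss `ℓ(y, u) = log (1 + exp (-y u))`. -/
def logisticLoss (y u : ℝ) : ℝ := Real.log (1 + Real.exp (-(y * u)))

/-- The output `∫ Φ(z, x) dμ(x)` of the two-layer network with parameter distribution `μ`. -/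
def networkOutput {n d : ℕ} (Φ : E n → E d → ℝ) (μ : Measure (E d)) (z : E n) : ℝ :=
  ∫ x, Φ z x ∂μ

/-- The regularized risk `G(μ) = 𝔼 ℓ(y, ∫ Φ(z, x) dμ(x)) + (lam / 2) ∫ ‖x‖² dμ(x)`. -/
def risk {n d : ℕ} (ℓ : ℝ → ℝ → ℝ) (D : Measure (E n × ℝ)) (Φ : E n → E d → ℝ) (lam : ℝ)
    (μ : Measure (E d)) : ℝ :=
  ∫ p, ℓ p.2 (networkOutput Φ μ p.1) ∂D + lam / 2 * ∫ x, ‖x‖ ^ 2 ∂μ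

/-- The function `x ↦ 𝔼 ℓ'(y, ∫ Φ(z, x') dμ(x')) Φ(z, x) + (lam / 2) ‖x‖²`, where `ℓ'` is the
derivative of `ℓ` in its second variable. -/
def riskVariation {n d : ℕ} (ℓ : ℝ → ℝ → ℝ) (D : Measure (E n × ℝ)) (Φ : E n → E d → ℝ)
    (lam : ℝ) (μ : Measure (E d)) (x : E d) : ℝ :=
  ∫ p, deriv (ℓ p.2) (networkOutput Φ μ p.1) * Φ p.1 x ∂D + lam / 2 * ‖x‖ ^ 2

end MeanFieldLangevin

end

/-! Write γ_t for the centred Gaussian with covariance t·Id. The first variation of G at μ is a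
function of x bounded uniformly in μ, plus (λ/2)‖x‖². Hence e^{-V[μ]/τ} is a bounded perturbation of
the density of γ_{τ/λ}, and G + τH is, up to a constant, the expected loss plus τ times the relative
entropy to γ_{τ/λ}. The log-Sobolev inequality and the existence of a minimizer both rest on this.

Log-Sobolev inequality. The Gaussian case is proved by cutting up time. For bounded functions with a
Lipschitz gradient, bounded away from 0, a Taylor expansion at the origin gives LSI for γ_h with an
additive defect O(h^{3/2}) (`exists_niceLSI_gauss_small`). Under convolution, constants and defects
add (`NiceLSI.conv`), by conditioning of entropy and joint convexity of ‖v‖²/a. Since γ_t is a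
convolution of 2^k copies of γ_{t/2^k}, the total defect is O(t √(t/2^k)), which vanishes in the
limit (`niceLSI_gauss`). Mollification, cutoff and Fatou's lemma extend the inequality to all weakly
differentiable densities (`lintegral_bregman_le_gauss`). For this the entropy is written as the
integral of a nonnegative Bregman divergence, and the weak gradient is shown to be negligible on the
zero set of the function. The Holley–Stroock argument then transfers the inequality to the perturbed
measure at the cost of the exponential of the oscillation (`satisfiesLSI_gauss_tilted`). It remains
to bound the bounded part of V by K (logistic loss), or by K(K+K') (square loss, where y may be
replaced by its conditional mean given z).

Minimizer. No weak compactness is needed. The relative entropy is uniformly midpoint convex for the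
Hellinger distance, so a minimizing sequence of densities with respect to γ_{τ/λ} is Cauchy in L¹.
The loss is L¹-Lipschitz and the entropy is lower semicontinuous by Fatou, so the limit is a
minimizer (`exists_isDensity_minimizer`). Its finite entropy forces a finite second moment.

Convexity, first variation and smoothness. The network output is linear in μ, so convexity and a
quadratic Taylor bound for ℓ give the first two. For smoothness, a bounded function with Lipschitz
gradient has bounded gradient, so outputs are W₂-Lipschitz by Cauchy–Schwarz on transport plans. -/

noncomputable section

namespace MeanFieldLangevin

/-! ### Log-Sobolev inequalities with a defect, and their behaviour under convolution. -/

section NicePairs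

variable {d : ℕ}

/-- A positive bounded function `f` with a bounded Lipschitz gradient `g`; the constants are
chosen so that the class is stable under averages of translates. -/
structure NicePair (c C M : ℝ) (f : E d → ℝ) (g : E d → E d) : Prop where
  lower : ∀ x, c ≤ f x
  upper : ∀ x, f x ≤ C
  bound : ∀ x, ‖g x‖ ≤ M
  lip : ∀ x y, |f x - f y| ≤ M * ‖x - y‖
  lip_grad : ∀ x y, ‖g x - g y‖ ≤ M * ‖x - y‖
  taylor : ∀ x v, |f (x + v) - f x - inner ℝ (g x) v| ≤ M * ‖v‖ ^ 2

lemma continuous_of_norm_sub_le {F : Type*} [NormedAddCommGroup F] {f : E d → F} {M : ℝ}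
    (h : ∀ x y, ‖f x - f y‖ ≤ M * ‖x - y‖) : Continuous f := by
  have : LipschitzWith M.toNNReal f := LipschitzWith.of_dist_le_mul fun x y => by
    rw [dist_eq_norm, dist_eq_norm]
    exact (h x y).trans (by gcongr; exact Real.le_coe_toNNReal M)
  exact this.continuous

/-- The translates average `x ↦ ∫ f (x + w) dm(w)`. -/
def average {F : Type*} [NormedAddCommGroup F] [NormedSpace ℝ F] (m : Measure (E d))
    (f : E d → F) (x : E d) : F := ∫ w, f (x + w) ∂m

namespace NicePair

variable {c C M : ℝ} {f : E d → ℝ} {g : E d → E d}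

lemma continuous (h : NicePair c C M f g) : Continuous f :=
  continuous_of_norm_sub_le (by simpa [Real.norm_eq_abs] using h.lip)

lemma continuous_grad (h : NicePair c C M f g) : Continuous g :=
  continuous_of_norm_sub_le h.lip_grad

lemma pos (h : NicePair c C M f g) (hc : 0 < c) (x : E d) : 0 < f x := hc.trans_le (h.lower x)

lemma nonneg_bound (h : NicePair c C M f g) : 0 ≤ M := (norm_nonneg _).trans (h.bound 0)

lemma integrable (h : NicePair c C M f g) (hc : 0 < c) (m : Measure (E d)) [IsFiniteMeasure m]
    (x : E d) : Integrable (fun w => f (x + w)) m := by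
  have := h.continuous
  refine .of_bound (C := C) (by fun_prop) (.of_forall fun w => ?_)
  rw [Real.norm_of_nonneg (h.pos hc _).le]
  exact h.upper _

lemma integrable_grad (h : NicePair c C M f g) (m : Measure (E d)) [IsFiniteMeasure m]
    (x : E d) : Integrable (fun w => g (x + w)) m := by
  have := h.continuous_grad
  exact .of_bound (C := M) (by fun_prop) (.of_forall fun w => h.bound _)

/-- Each condition is a uniform bound on an expression linear in the pair, so it survives
integration with the same constants. The Taylor bound encodes that `g` is the gradient of `f`; in
this form no differentiation under the integral is needed. -/
lemma average (h : NicePair c C M f g) (hc : 0 < c) (m : Measure (E d)) [IsProbabilityMeasure m] :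
    NicePair c C M (average m f) (average m g) where
  lower x := by
    have := integral_mono (μ := m) (integrable_const c) (h.integrable hc m x) fun w => h.lower _
    simpa [MeanFieldLangevin.average] using this
  upper x := by
    have := integral_mono (μ := m) (h.integrable hc m x) (integrable_const C) fun w => h.upper _
    simpa [MeanFieldLangevin.average] using this
  bound x := by
    simpa [MeanFieldLangevin.average] using
      norm_integral_le_of_norm_le_const (μ := m) (f := fun w => g (x + w)) (C := M)
      (.of_forall fun w => h.bound _)
  lip x y := by
    rw [MeanFieldLangevin.average, MeanFieldLangevin.average,
      ← integral_sub (h.integrable hc m x) (h.integrable hc m y), ← Real.norm_eq_abs]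
    simpa using norm_integral_le_of_norm_le_const (μ := m)
      (f := fun w => f (x + w) - f (y + w)) (C := M * ‖x - y‖)
      (.of_forall fun w => by simpa using h.lip (x + w) (y + w))
  lip_grad x y := by
    rw [MeanFieldLangevin.average, MeanFieldLangevin.average,
      ← integral_sub (h.integrable_grad m x) (h.integrable_grad m y)]
    simpa using norm_integral_le_of_norm_le_const (μ := m)
      (f := fun w => g (x + w) - g (y + w)) (C := M * ‖x - y‖)
      (.of_forall fun w => by simpa using h.lip_grad (x + w) (y + w))
  taylor x v := by
    rw [MeanFieldLangevin.average, MeanFieldLangevin.average, MeanFieldLangevin.average,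
      ← integral_sub (h.integrable hc m _) (h.integrable hc m x), real_inner_comm,
      ← integral_inner (h.integrable_grad m x), ← integral_sub, ← Real.norm_eq_abs]
    · simpa using norm_integral_le_of_norm_le_const (μ := m)
        (f := fun w => f (x + v + w) - f (x + w) - inner ℝ v (g (x + w))) (C := M * ‖v‖ ^ 2)
        (.of_forall fun w => by
          have := h.taylor (x + w) v
          rwa [add_right_comm, real_inner_comm] at this)
    · exact (h.integrable hc m _).sub (h.integrable hc m x)
    · exact (h.integrable_grad m x).const_inner v

end NicePair

/-- Expand ‖v - a q‖² ≥ 0. With `fisher_tangent_eq`, this presents ‖v‖²/a as a supremum of functions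
linear in (v, a), attained at q = v/a. Every convexity property of the Fisher information below
comes from freezing q at its optimal value and integrating. -/
lemma fisher_tangent {a : ℝ} (ha : 0 < a) (v q : E d) :
    2 * inner ℝ v q - a * ‖q‖ ^ 2 ≤ ‖v‖ ^ 2 / a := by
  rw [le_div_iff₀ ha]
  have := norm_sub_sq_real v (a • q)
  rw [norm_smul, inner_smul_right, Real.norm_of_nonneg ha.le] at this
  nlinarith [sq_nonneg ‖v - a • q‖]

lemma fisher_tangent_eq {a : ℝ} (ha : 0 < a) (v : E d) :
    ‖v‖ ^ 2 / a = 2 * inner ℝ v (a⁻¹ • v) - a * ‖a⁻¹ • v‖ ^ 2 := by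
  rw [inner_smul_right, norm_smul, real_inner_self_eq_norm_sq, Real.norm_of_nonneg (by positivity)]
  field_simp
  ring

/-- Joint convexity of `(v, a) ↦ ‖v‖² / a`, in Jensen's form. -/
lemma norm_integral_sq_div_le {α : Type*} [MeasurableSpace α] {m : Measure α}
    {u : α → ℝ} {v : α → E d} (hu : Integrable u m) (hv : Integrable v m)
    (hpos : ∀ x, 0 < u x) (hI : 0 < ∫ x, u x ∂m)
    (hq : Integrable (fun x => ‖v x‖ ^ 2 / u x) m) :
    ‖∫ x, v x ∂m‖ ^ 2 / ∫ x, u x ∂m ≤ ∫ x, ‖v x‖ ^ 2 / u x ∂m := by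
  set q := (∫ x, u x ∂m)⁻¹ • ∫ x, v x ∂m
  rw [fisher_tangent_eq hI]
  calc 2 * inner ℝ (∫ x, v x ∂m) q - (∫ x, u x ∂m) * ‖q‖ ^ 2
      = ∫ x, (2 * inner ℝ (v x) q - u x * ‖q‖ ^ 2) ∂m := by
        rw [integral_sub ((hv.inner_const q).const_mul 2) (hu.mul_const _), integral_const_mul,
          integral_mul_const, real_inner_comm, ← integral_inner hv]
        simp_rw [real_inner_comm q]
    _ ≤ _ := integral_mono (((hv.inner_const q).const_mul 2).sub (hu.mul_const _)) hq
        fun x => fisher_tangent (hpos x) _ _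

/-- A logarithmic Sobolev inequality with constant `s` and defect `a`, restricted to nice pairs. -/
def NiceLSI (c C M : ℝ) (m : Measure (E d)) (s a : ℝ) : Prop :=
  ∀ f g, NicePair c C M f g →
    ∫ x, f x * Real.log (f x) ∂m ≤ (∫ x, f x ∂m) * Real.log (∫ x, f x ∂m)
      + s / 2 * ∫ x, ‖g x‖ ^ 2 / f x ∂m + a

namespace NicePair

variable {c C M : ℝ} {f : E d → ℝ} {g : E d → E d}

lemma translate (h : NicePair c C M f g) (y : E d) :
    NicePair c C M (fun x => f (y + x)) (fun x => g (y + x)) where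
  lower x := h.lower _
  upper x := h.upper _
  bound x := h.bound _
  lip x z := by simpa using h.lip (y + x) (y + z)
  lip_grad x z := by simpa using h.lip_grad (y + x) (y + z)
  taylor x v := by simpa [add_assoc] using h.taylor (y + x) v

lemma continuous_mul_log (h : NicePair c C M f g) : Continuous fun x => f x * Real.log (f x) :=
  Real.continuous_mul_log.comp h.continuous

lemma continuous_fisher (h : NicePair c C M f g) (hc : 0 < c) :
    Continuous fun x => ‖g x‖ ^ 2 / f x :=
  (h.continuous_grad.norm.pow 2).div h.continuous fun x => (h.pos hc x).ne'

lemma exists_bound_mul_log (c C : ℝ) : ∃ B, ∀ y, c ≤ y → y ≤ C → |y * Real.log y| ≤ B := by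
  obtain ⟨B, hB⟩ := (isCompact_Icc (a := c) (b := C)).exists_bound_of_continuousOn
    Real.continuous_mul_log.continuousOn
  exact ⟨B, fun y h1 h2 => by simpa using hB y ⟨h1, h2⟩⟩

lemma fisher_le (h : NicePair c C M f g) (hc : 0 < c) (x : E d) : ‖g x‖ ^ 2 / f x ≤ M ^ 2 / c := by
  have := h.bound x
  have := h.lower x
  gcongr

lemma integrable_mul_log (h : NicePair c C M f g) (m : Measure (E d)) [IsFiniteMeasure m] :
    Integrable (fun x => f x * Real.log (f x)) m := by
  obtain ⟨B, hB⟩ := exists_bound_mul_log c C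
  exact .of_bound (C := B) h.continuous_mul_log.aestronglyMeasurable
    (.of_forall fun x => hB _ (h.lower x) (h.upper x))

lemma integrable_fisher (h : NicePair c C M f g) (hc : 0 < c) (m : Measure (E d))
    [IsFiniteMeasure m] : Integrable (fun x => ‖g x‖ ^ 2 / f x) m := by
  refine .of_bound (C := M ^ 2 / c) (h.continuous_fisher hc).aestronglyMeasurable
    (.of_forall fun x => ?_)
  rw [Real.norm_of_nonneg (by have := h.pos hc x; positivity)]
  exact h.fisher_le hc x

end NicePair

/-- Entropy for the convolution splits by conditioning: `H'` controls the entropy of w ↦ f(x + w)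
for each x, and `H` that of the averaged function. By joint convexity, the Fisher information of the
average is at most the average of the Fisher information, so the two contributions add up with
constant `s + s'`. -/
lemma NiceLSI.conv {c C M s s' a a' : ℝ} {m m' : Measure (E d)} [IsProbabilityMeasure m]
    [IsProbabilityMeasure m'] (hc : 0 < c) (hs : 0 ≤ s) (H : NiceLSI c C M m s a)
    (H' : NiceLSI c C M m' s' a') : NiceLSI c C M (m.conv m') (s + s') (a + a') := by
  intro f g h
  have hav := h.average hc m'
  have conv_eq : ∀ u : E d → ℝ, Integrable u (m.conv m') →
      ∫ x, u x ∂(m.conv m') = ∫ x, ∫ w, u (x + w) ∂m' ∂m := fun u hu => integral_conv hu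
  have conv_int : ∀ u : E d → ℝ, Integrable u (m.conv m') →
      Integrable (fun x => ∫ w, u (x + w) ∂m') m := fun u hu => by
    have := (integrable_map_measure hu.1 (by fun_prop)).1 hu
    exact this.integral_prod_left
  have i1 := h.integrable_mul_log (m.conv m')
  have i2 := h.integrable_fisher hc (m.conv m')
  have i3 : Integrable f (m.conv m') := by simpa using h.integrable hc (m.conv m') 0
  rw [conv_eq _ i1, conv_eq _ i2, conv_eq _ i3]
  have e1 : ∫ x, ∫ w, f (x + w) * Real.log (f (x + w)) ∂m' ∂m ≤
      ∫ x, (average m' f x * Real.log (average m' f x)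
        + s' / 2 * (∫ w, ‖g (x + w)‖ ^ 2 / f (x + w) ∂m') + a') ∂m := by
    refine integral_mono (conv_int _ i1) (((hav.integrable_mul_log m).add
      ((conv_int _ i2).const_mul _)).add (integrable_const _)) fun x => ?_
    exact H' _ _ (h.translate x)
  have e2 := H _ _ hav
  have e3 : ∫ x, ‖average m' g x‖ ^ 2 / average m' f x ∂m ≤
      ∫ x, ∫ w, ‖g (x + w)‖ ^ 2 / f (x + w) ∂m' ∂m := by
    refine integral_mono (hav.integrable_fisher hc m) (conv_int _ i2) fun x => ?_
    exact norm_integral_sq_div_le (h.integrable hc m' x) (h.integrable_grad m' x)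
      (fun w => h.pos hc _) (hav.pos hc x) ((h.translate x).integrable_fisher hc m')
  have j1 : Integrable (fun x => s' / 2 * ∫ w, ‖g (x + w)‖ ^ 2 / f (x + w) ∂m') m :=
    (conv_int _ i2).const_mul _
  have j2 : Integrable (fun x => average m' f x * Real.log (average m' f x)
      + s' / 2 * ∫ w, ‖g (x + w)‖ ^ 2 / f (x + w) ∂m') m := (hav.integrable_mul_log m).add j1
  rw [integral_add j2 (integrable_const _), integral_add (hav.integrable_mul_log m) j1,
    integral_const_mul] at e1
  simp only [integral_const, probReal_univ, smul_eq_mul, one_mul] at e1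
  change _ ≤ (∫ x, average m' f x ∂m) * Real.log (∫ x, average m' f x ∂m) + _ + _
  nlinarith [mul_le_mul_of_nonneg_left e3 (by positivity : 0 ≤ s / 2)]

end NicePairs

/-! ### A third-order bound for the entropy integrand. -/

section SmallTime

/-- `b - a + a log (a / b)` is `(a - b)² / (2 b)` up to third order. -/
lemma mul_log_div_le {a b : ℝ} (ha : 0 < a) (hb : 0 < b) :
    a * Real.log (a / b) - a + b ≤ (a - b) ^ 2 / (2 * b) + |a - b| ^ 3 / (2 * b ^ 2) := by
  -- By homogeneity only the ratio r = a/b matters.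
  have key : ∀ r : ℝ, 0 < r → r * Real.log r - r + 1 ≤ (r - 1) ^ 2 / 2 + |r - 1| ^ 3 / 2 := by
    intro r hr
    rcases le_total 1 r with h1 | h1
    -- For r ≥ 1 the cubic term is not needed: the difference vanishes at 1 and has derivative r - 1
    -- - log r ≥ 0.
    · have hmono : MonotoneOn (fun r : ℝ => (r - 1) ^ 2 / 2 - (r * Real.log r - r + 1))
          (Set.Ici 1) := by
        refine monotoneOn_of_deriv_nonneg (convex_Ici 1) ?_ ?_ ?_
        · have := Real.continuous_mul_log
          exact Continuous.continuousOn (by fun_prop)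
        · intro x hx
          have hx0 : x ≠ 0 := by simp at hx; linarith
          exact DifferentiableAt.differentiableWithinAt (by fun_prop (disch := assumption))
        · intro x hx
          rw [interior_Ici] at hx
          have hx1 : (1 : ℝ) < x := hx
          have hx0 : x ≠ 0 := by linarith
          have hd : HasDerivAt (fun r : ℝ => (r - 1) ^ 2 / 2 - (r * Real.log r - r + 1))
              ((2 * (x - 1) ^ 1 * 1) / 2 - (Real.log x + 1 - 1)) x :=
            ((((hasDerivAt_id x).sub_const 1).pow 2).div_const 2).sub
              (((Real.hasDerivAt_mul_log hx0).sub (hasDerivAt_id x)).add_const 1)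
          rw [hd.deriv]
          have := Real.log_le_sub_one_of_pos (by linarith : 0 < x)
          ring_nf
          linarith
      have := hmono (Set.mem_Ici.2 le_rfl) (Set.mem_Ici.2 h1) h1
      simp at this
      have h3 : 0 ≤ |r - 1| ^ 3 / 2 := by positivity
      linarith
    · have hmono : MonotoneOn (fun r : ℝ => Real.log r - (r - 1) + (r - 1) ^ 2 / 2)
          (Set.Ioi 0) := by
        refine monotoneOn_of_deriv_nonneg (convex_Ioi 0) ?_ ?_ ?_
        · intro x hx
          have hx0 : x ≠ 0 := by simp at hx; linarith
          exact ContinuousAt.continuousWithinAt (by fun_prop (disch := assumption))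
        · intro x hx
          have hx0 : x ≠ 0 := by simp at hx; linarith
          exact DifferentiableAt.differentiableWithinAt (by fun_prop (disch := assumption))
        · intro x hx
          rw [interior_Ioi] at hx
          have hx1 : (0 : ℝ) < x := hx
          have hd : HasDerivAt (fun r : ℝ => Real.log r - (r - 1) + (r - 1) ^ 2 / 2)
              (x⁻¹ - 1 + (2 * (x - 1) ^ 1 * 1) / 2) x :=
            ((Real.hasDerivAt_log hx1.ne').sub ((hasDerivAt_id x).sub_const 1)).add
              ((((hasDerivAt_id x).sub_const 1).pow 2).div_const 2)
          rw [hd.deriv]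
          have : x⁻¹ - 1 + (2 * (x - 1) ^ 1 * 1) / 2 = (x - 1) ^ 2 / x := by
            field_simp
            ring
          rw [this]
          positivity
      have := hmono (Set.mem_Ioi.2 hr) (Set.mem_Ioi.2 one_pos) h1
      simp at this
      rw [abs_of_nonpos (by linarith)]
      -- Multiplied by r, this bound on log r gives exactly (r-1)²/2 + (1-r)³/2.
      have h4 : Real.log r ≤ (r - 1) - (r - 1) ^ 2 / 2 := by linarith
      nlinarith [mul_le_mul_of_nonneg_left h4 hr.le]
  have h := key (a / b) (by positivity)
  have e1 : a / b - 1 = (a - b) / b := by field_simp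
  rw [e1, abs_div, abs_of_pos hb] at h
  have := mul_le_mul_of_nonneg_left h hb.le
  have e2 : b * (a / b * Real.log (a / b) - a / b + 1) = a * Real.log (a / b) - a + b := by
    field_simp
  have e3 : b * (((a - b) / b) ^ 2 / 2 + (|a - b| / b) ^ 3 / 2) =
      (a - b) ^ 2 / (2 * b) + |a - b| ^ 3 / (2 * b ^ 2) := by
    field_simp
  rwa [e2, e3] at this

end SmallTime

/-! ### The Gaussian log-Sobolev inequality for nice pairs. -/

section Gaussian

open ProbabilityTheory

variable {d : ℕ}

/-- The centered Gaussian measure on `ℝ^d` with covariance `t • 1`. -/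
def gauss (d : ℕ) (t : ℝ) : Measure (E d) := (stdGaussian (E d)).map (√t • ·)

instance isProbabilityMeasure_gauss (t : ℝ) : IsProbabilityMeasure (gauss d t) :=
  Measure.isProbabilityMeasure_map (by fun_prop)

lemma charFun_gauss {t : ℝ} (ht : 0 ≤ t) (v : E d) :
    charFun (gauss d t) v = Complex.exp (-(t * ‖v‖ ^ 2 / 2 : ℝ)) := by
  rw [gauss, charFun_map_smul, charFun_stdGaussian, norm_smul, Real.norm_of_nonneg (by positivity),
    ← Complex.ofReal_pow, mul_pow, Real.sq_sqrt ht]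
  congr 1
  push_cast
  ring

lemma gauss_conv {s t : ℝ} (hs : 0 ≤ s) (ht : 0 ≤ t) :
    (gauss d s).conv (gauss d t) = gauss d (s + t) := by
  refine Measure.ext_of_charFun (funext fun v => ?_)
  rw [charFun_conv, charFun_gauss hs, charFun_gauss ht, charFun_gauss (add_nonneg hs ht),
    ← Complex.exp_add]
  congr 1
  push_cast
  ring

lemma integral_gauss (t : ℝ) {u : E d → ℝ} (hu : Continuous u) :
    ∫ x, u x ∂gauss d t = ∫ z, u (√t • z) ∂stdGaussian (E d) :=
  integral_map (by fun_prop) hu.aestronglyMeasurable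

lemma integrable_norm_pow_stdGaussian (k : ℕ) :
    Integrable (fun z : E d => ‖z‖ ^ k) (stdGaussian (E d)) := by
  rcases eq_or_ne k 0 with rfl | hk
  · simp
  · have := (IsGaussian.memLp_id (stdGaussian (E d)) k (by simp)).integrable_norm_pow hk
    simpa using this

lemma integral_inner_sq_stdGaussian (v : E d) :
    ∫ z, (inner ℝ v z) ^ 2 ∂stdGaussian (E d) = ‖v‖ ^ 2 := by
  have h := variance_dual_stdGaussian (E := E d) (innerSL ℝ v)
  rw [variance_eq_integral (by fun_prop), integral_strongDual_stdGaussian] at h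
  simpa using h

lemma integrable_inner_sq_stdGaussian (v : E d) :
    Integrable (fun z => (inner ℝ v z) ^ 2) (stdGaussian (E d)) := by
  refine ((integrable_norm_pow_stdGaussian 2).const_mul (‖v‖ ^ 2)).mono'
    (by fun_prop) (.of_forall fun z => ?_)
  rw [Real.norm_of_nonneg (sq_nonneg _), ← mul_pow, sq_le_sq, abs_of_nonneg (by positivity :
    0 ≤ ‖v‖ * ‖z‖)]
  exact abs_real_inner_le_norm v z

/-- The leading term is kept exact, since its Gaussian mean r²‖g(0)‖² must match the Fisher
information; the rest is O(r³), with r ≤ 1 absorbing the r⁴ term. -/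
lemma NicePair.sq_sub_le {c C M : ℝ} {f : E d → ℝ} {g : E d → E d} (h : NicePair c C M f g)
    {r : ℝ} (hr : 0 ≤ r) (hr1 : r ≤ 1) (z : E d) :
    (f (r • z) - f 0) ^ 2 ≤
      r ^ 2 * (inner ℝ (g 0) z) ^ 2 + r ^ 3 * (2 * M ^ 2 * ‖z‖ ^ 3 + M ^ 2 * ‖z‖ ^ 4) := by
  have hM := h.nonneg_bound
  have h1 := h.taylor 0 (r • z)
  rw [zero_add, inner_smul_right, norm_smul, Real.norm_of_nonneg hr] at h1
  have h2 : |inner ℝ (g 0) z| ≤ M * ‖z‖ :=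
    (abs_real_inner_le_norm _ _).trans (by gcongr; exact h.bound 0)
  set A := inner ℝ (g 0) z
  have h3 : |f (r • z) - f 0| ≤ r * |A| + M * (r * ‖z‖) ^ 2 := by
    calc |f (r • z) - f 0| = |r * A + (f (r • z) - f 0 - r * A)| := by ring_nf
      _ ≤ |r * A| + |f (r • z) - f 0 - r * A| := abs_add_le _ _
      _ ≤ _ := by rw [abs_mul, abs_of_nonneg hr]; gcongr
  rw [← sq_abs (f (r • z) - f 0), ← sq_abs A]
  calc |f (r • z) - f 0| ^ 2 ≤ (r * |A| + M * (r * ‖z‖) ^ 2) ^ 2 := by gcongr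
    _ = r ^ 2 * |A| ^ 2 + r ^ 3 * (2 * M * ‖z‖ ^ 2 * |A| + r * (M ^ 2 * ‖z‖ ^ 4)) := by ring
    _ ≤ r ^ 2 * |A| ^ 2 + r ^ 3 * (2 * M * ‖z‖ ^ 2 * (M * ‖z‖) + 1 * (M ^ 2 * ‖z‖ ^ 4)) := by
        gcongr
    _ = _ := by ring

/-- Only a lower bound is needed. The tangent at q = g(0)/f(0) makes it linear in `f` and `g`, so
their Lipschitz bounds suffice. -/
lemma NicePair.fisher_sub_le {c C M : ℝ} {f : E d → ℝ} {g : E d → E d} (hc : 0 < c)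
    (h : NicePair c C M f g) (w : E d) :
    ‖g 0‖ ^ 2 / f 0 - (2 * M ^ 2 / c + M ^ 3 / c ^ 2) * ‖w‖ ≤ ‖g w‖ ^ 2 / f w := by
  have hM := h.nonneg_bound
  have hb := h.pos hc 0
  set q := (f 0)⁻¹ • g 0
  have hq : ‖q‖ ≤ M / c := by
    rw [norm_smul, norm_inv, Real.norm_of_nonneg hb.le, inv_mul_eq_div]
    have := h.bound 0
    have := h.lower 0
    gcongr
  refine le_trans ?_ (fisher_tangent (h.pos hc w) (g w) q)
  rw [fisher_tangent_eq hb]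
  have h1 : inner ℝ (g 0) q - inner ℝ (g w) q ≤ M * ‖w‖ * (M / c) := by
    rw [← inner_sub_left]
    refine (real_inner_le_norm _ _).trans ?_
    have := h.lip_grad 0 w
    rw [zero_sub, norm_neg] at this
    gcongr
  have h2 : (f w - f 0) * ‖q‖ ^ 2 ≤ M * ‖w‖ * (M / c) ^ 2 := by
    have := (le_abs_self _).trans (h.lip w 0)
    rw [sub_zero] at this
    gcongr
  calc 2 * inner ℝ (g 0) q - f 0 * ‖q‖ ^ 2 - (2 * M ^ 2 / c + M ^ 3 / c ^ 2) * ‖w‖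
      = 2 * inner ℝ (g 0) q - f 0 * ‖q‖ ^ 2 - 2 * (M * ‖w‖ * (M / c)) - M * ‖w‖ * (M / c) ^ 2 := by
        ring
    _ ≤ _ := by linarith

/-- With b = f(0), the entropy is at most h‖g(0)‖²/(2b) + O(h^{3/2}), while the Fisher information
is at least ‖g(0)‖²/b - O(√h). The defect is uniform over the class of nice pairs, so the same `K`
serves at every scale of the subdivision. -/
lemma exists_niceLSI_gauss_small {c : ℝ} (C M : ℝ) (hc : 0 < c) :
    ∃ K : ℝ, ∀ h : ℝ, 0 ≤ h → h ≤ 1 → NiceLSI c C M (gauss d h) h (K * h * √h) := by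
  set κ : ℕ → ℝ := fun k => ∫ z : E d, ‖z‖ ^ k ∂stdGaussian (E d)
  have hκ : ∀ k, 0 ≤ κ k := fun k => integral_nonneg fun z => by positivity
  refine ⟨(2 * M ^ 2 * κ 3 + M ^ 2 * κ 4) / (2 * c) + M ^ 3 * κ 3 / (2 * c ^ 2)
    + (2 * M ^ 2 / c + M ^ 3 / c ^ 2) * κ 1 / 2, fun h h0 h1 f g hfg => ?_⟩
  have hM := hfg.nonneg_bound
  have hb := hfg.pos hc 0
  have hcb := hfg.lower 0
  have hr0 : 0 ≤ √h := Real.sqrt_nonneg h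
  have hr1 : √h ≤ 1 := Real.sqrt_le_one.2 h1
  have hr2 : √h ^ 2 = h := Real.sq_sqrt h0
  rw [integral_gauss h hfg.continuous_mul_log, integral_gauss h (hfg.continuous_fisher hc),
    integral_gauss h hfg.continuous]
  have hfc := hfg.continuous
  have hgc := hfg.continuous_grad
  set r := √h
  set b := f 0
  have I0 : Integrable (fun z => f (r • z)) (stdGaussian (E d)) :=
    .of_bound (C := C) (by fun_prop) (.of_forall fun z => by
      rw [Real.norm_of_nonneg (hfg.pos hc _).le]; exact hfg.upper _)
  have I1 : Integrable (fun z => f (r • z) * Real.log (f (r • z))) (stdGaussian (E d)) := by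
    obtain ⟨B, hB⟩ := NicePair.exists_bound_mul_log c C
    exact .of_bound (C := B) (hfg.continuous_mul_log.comp (by fun_prop)).aestronglyMeasurable
      (.of_forall fun x => hB _ (hfg.lower _) (hfg.upper _))
  have I2 : Integrable (fun z => ‖g (r • z)‖ ^ 2 / f (r • z)) (stdGaussian (E d)) := by
    refine .of_bound (C := M ^ 2 / c) ((hfg.continuous_fisher hc).comp
      (by fun_prop)).aestronglyMeasurable (.of_forall fun x => ?_)
    rw [Real.norm_of_nonneg (by have := hfg.pos hc (r • x); positivity)]
    exact hfg.fisher_le hc _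
  have J3 := integrable_norm_pow_stdGaussian (d := d) 3
  have J4 := integrable_norm_pow_stdGaussian (d := d) 4
  have J1 := integrable_norm_pow_stdGaussian (d := d) 1
  have JA := integrable_inner_sq_stdGaussian (g 0)
  have upper : ∫ z, f (r • z) * Real.log (f (r • z)) ∂stdGaussian (E d) ≤
      (∫ z, f (r • z) ∂stdGaussian (E d)) * (Real.log b + 1) - b + h * (‖g 0‖ ^ 2 / b / 2)
      + r ^ 3 * ((2 * M ^ 2 * κ 3 + M ^ 2 * κ 4) / (2 * c) + M ^ 3 * κ 3 / (2 * c ^ 2)) := by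
    have pt : ∀ z, f (r • z) * Real.log (f (r • z)) ≤
        f (r • z) * (Real.log b + 1) - b + (r ^ 2 / (2 * b)) * (inner ℝ (g 0) z) ^ 2
        + ((r ^ 3 * (2 * M ^ 2 / (2 * c) + M ^ 3 / (2 * c ^ 2))) * ‖z‖ ^ 3
        + (r ^ 3 * (M ^ 2 / (2 * c))) * ‖z‖ ^ 4) := fun z => by
      have e1 := mul_log_div_le (hfg.pos hc (r • z)) hb
      rw [Real.log_div (hfg.pos hc _).ne' hb.ne'] at e1
      have e2 := hfg.sq_sub_le hr0 hr1 z
      have e3 : |f (r • z) - b| ≤ M * (r * ‖z‖) := by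
        simpa [norm_smul, abs_of_nonneg hr0] using hfg.lip (r • z) 0
      have e4 : (f (r • z) - b) ^ 2 / (2 * b) ≤ (r ^ 2 / (2 * b)) * (inner ℝ (g 0) z) ^ 2
          + r ^ 3 * (2 * M ^ 2 * ‖z‖ ^ 3 + M ^ 2 * ‖z‖ ^ 4) / (2 * c) := by
        calc (f (r • z) - b) ^ 2 / (2 * b) ≤ (r ^ 2 * (inner ℝ (g 0) z) ^ 2
              + r ^ 3 * (2 * M ^ 2 * ‖z‖ ^ 3 + M ^ 2 * ‖z‖ ^ 4)) / (2 * b) := by gcongr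
          _ = (r ^ 2 / (2 * b)) * (inner ℝ (g 0) z) ^ 2
              + r ^ 3 * (2 * M ^ 2 * ‖z‖ ^ 3 + M ^ 2 * ‖z‖ ^ 4) / (2 * b) := by ring
          _ ≤ _ := by gcongr
      have e5 : |f (r • z) - b| ^ 3 / (2 * b ^ 2) ≤ (M * (r * ‖z‖)) ^ 3 / (2 * c ^ 2) := by
        gcongr
      have e6 : (r ^ 3 * (2 * M ^ 2 / (2 * c) + M ^ 3 / (2 * c ^ 2))) * ‖z‖ ^ 3
          + (r ^ 3 * (M ^ 2 / (2 * c))) * ‖z‖ ^ 4 =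
          r ^ 3 * (2 * M ^ 2 * ‖z‖ ^ 3 + M ^ 2 * ‖z‖ ^ 4) / (2 * c)
          + (M * (r * ‖z‖)) ^ 3 / (2 * c ^ 2) := by ring
      rw [e6]
      linarith
    have K1 : Integrable (fun z => f (r • z) * (Real.log b + 1) - b) (stdGaussian (E d)) :=
      (I0.mul_const _).sub (integrable_const _)
    have K2 := JA.const_mul (r ^ 2 / (2 * b))
    have K3 := J3.const_mul (r ^ 3 * (2 * M ^ 2 / (2 * c) + M ^ 3 / (2 * c ^ 2)))
    have K4 := J4.const_mul (r ^ 3 * (M ^ 2 / (2 * c)))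
    refine (integral_mono I1 ((K1.add K2).add (K3.add K4)) pt).trans (le_of_eq ?_)
    simp only [Pi.add_apply]
    rw [integral_add (by exact K1.add K2) (by exact K3.add K4), integral_add K1 K2,
      integral_add K3 K4, integral_sub (I0.mul_const _) (integrable_const _), integral_mul_const,
      integral_const_mul, integral_const_mul, integral_const_mul, integral_inner_sq_stdGaussian,
      hr2]
    simp only [integral_const, probReal_univ, smul_eq_mul, one_mul]
    change _ + (_ * κ 3 + _ * κ 4) = _
    field_simp
    ring
  have lower : ‖g 0‖ ^ 2 / b - (2 * M ^ 2 / c + M ^ 3 / c ^ 2) * r * κ 1 ≤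
      ∫ z, ‖g (r • z)‖ ^ 2 / f (r • z) ∂stdGaussian (E d) := by
    have K1 := (J1.const_mul ((2 * M ^ 2 / c + M ^ 3 / c ^ 2) * r))
    have := integral_mono ((integrable_const (‖g 0‖ ^ 2 / b)).sub K1) I2 fun z => by
      have := hfg.fisher_sub_le hc (r • z)
      rw [norm_smul, Real.norm_of_nonneg hr0] at this
      simpa [mul_assoc] using this
    refine le_trans (le_of_eq ?_) this
    simp only [Pi.sub_apply]
    rw [integral_sub (integrable_const _) K1, integral_const_mul]
    simp [κ]
  set F := ∫ z, f (r • z) ∂stdGaussian (E d)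
  have hF : 0 < F := by
    have := integral_mono (integrable_const c) I0 fun z => hfg.lower _
    exact hc.trans_le (by simpa using this)
  -- The expansion was made relative to b = f(0). Passing to the mean F loses nothing, because the
  -- mean is the optimal reference constant.
  have entropy_le : F * (Real.log b + 1) - b ≤ F * Real.log F := by
    have := Real.log_le_sub_one_of_pos (div_pos hb hF)
    rw [Real.log_div hb.ne' hF.ne'] at this
    have := mul_le_mul_of_nonneg_left this hF.le
    have e : F * (b / F - 1) = b - F := by field_simp
    linarith
  have hr3 : r ^ 3 = h * r := by rw [← hr2]; ring
  rw [hr3] at upper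
  nlinarith [mul_le_mul_of_nonneg_left lower h0]

/-- The Gaussian logarithmic Sobolev inequality for nice pairs, by subdividing the time interval. -/
lemma niceLSI_gauss {c C M t : ℝ} (hc : 0 < c) (ht : 0 ≤ t) : NiceLSI c C M (gauss d t) t 0 := by
  obtain ⟨K, hK⟩ := exists_niceLSI_gauss_small (d := d) C M hc
  have doubling : ∀ (k : ℕ) (h a : ℝ), 0 ≤ h → NiceLSI c C M (gauss d h) h a →
      NiceLSI c C M (gauss d (2 ^ k * h)) (2 ^ k * h) (2 ^ k * a) := by
    intro k h a h0 H
    induction k with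
    | zero => simpa using H
    | succ k ih =>
      have := ih.conv hc (by positivity) ih
      rw [gauss_conv (by positivity) (by positivity)] at this
      convert this using 1 <;> ring_nf
  have hlim : Tendsto (fun k : ℕ => t / 2 ^ k) atTop (𝓝 0) :=
    tendsto_const_nhds.div_atTop (tendsto_pow_atTop_atTop_of_one_lt one_lt_two)
  intro f g hfg
  have hlim2 : Tendsto (fun k : ℕ => (∫ x, f x ∂gauss d t) * Real.log (∫ x, f x ∂gauss d t)
      + t / 2 * ∫ x, ‖g x‖ ^ 2 / f x ∂gauss d t + K * t * √(t / 2 ^ k)) atTop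
      (𝓝 ((∫ x, f x ∂gauss d t) * Real.log (∫ x, f x ∂gauss d t)
      + t / 2 * ∫ x, ‖g x‖ ^ 2 / f x ∂gauss d t + 0)) := by
    refine Tendsto.const_add _ ?_
    simpa using (hlim.sqrt).const_mul (K * t)
  refine ge_of_tendsto hlim2 ?_
  filter_upwards [hlim.eventually (ge_mem_nhds one_pos)] with k hk
  have := doubling k (t / 2 ^ k) _ (by positivity) (hK _ (by positivity) hk)
  rw [mul_div_cancel₀ _ (by positivity)] at this
  have h2 := this f g hfg
  -- The 2^k pieces of length h = t/2^k have total defect 2^k K h^{3/2} = K t √h, which tends to 0.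
  have e : 2 ^ k * (K * (t / 2 ^ k) * √(t / 2 ^ k)) = K * t * √(t / 2 ^ k) := by
    field_simp
  rwa [e] at h2

end Gaussian

/-! ### The Lebesgue density of the Gaussian. -/

section GaussianDensity

open ProbabilityTheory

variable {d : ℕ}

lemma integrable_exp_neg_mul_sq_norm {b : ℝ} (hb : 0 < b) :
    Integrable (fun x : E d => Real.exp (-(b * ‖x‖ ^ 2))) volume := by
  have h := (GaussianFourier.integrable_cexp_neg_mul_sq_norm_add (V := E d) (b := (b : ℂ))
    (by simpa using hb) 0 0).re
  refine h.congr (.of_forall fun x => ?_)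
  have : (-(b : ℂ) * (‖x‖ : ℂ) ^ 2 + 0 * (inner ℝ (0 : E d) x : ℝ)) = ((-(b * ‖x‖ ^ 2) : ℝ) : ℂ) := by
    push_cast; ring
  simp only [this]
  rw [← Complex.ofReal_exp]
  rfl

/-- The two measures have the same characteristic function, by the Gaussian Fourier integral. The
pushforward form suits convolution and moments; the density form is needed for absolute continuity
and for tilting. -/
lemma gauss_eq_tilted {t : ℝ} (ht : 0 < t) :
    gauss d t = volume.tilted (fun x : E d => -((1 / (2 * t)) * ‖x‖ ^ 2)) := by
  have hb : 0 < 1 / (2 * t) := by positivity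
  have hint := integrable_exp_neg_mul_sq_norm (d := d) hb
  have := isProbabilityMeasure_tilted hint
  refine Measure.ext_of_charFun (funext fun v => ?_)
  rw [charFun_gauss ht.le, charFun_apply, integral_tilted]
  set b := 1 / (2 * t)
  have e : ∀ x : E d, (Real.exp (-(b * ‖x‖ ^ 2)) / ∫ x : E d, Real.exp (-(b * ‖x‖ ^ 2))) •
      Complex.exp ((inner ℝ x v : ℝ) * Complex.I) =
      ((∫ x : E d, Real.exp (-(b * ‖x‖ ^ 2)) : ℝ) : ℂ)⁻¹ *
        Complex.exp (-(b : ℂ) * (‖x‖ : ℂ) ^ 2 + Complex.I * (inner ℝ v x : ℝ)) := fun x => by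
    rw [Complex.real_smul, Complex.exp_add, real_inner_comm]
    push_cast
    ring_nf
  simp_rw [e]
  rw [integral_const_mul, GaussianFourier.integral_cexp_neg_mul_sq_norm_add (by simpa using hb)]
  have e2 : ∫ x : E d, Real.exp (-(b * ‖x‖ ^ 2)) = ∫ x : E d, Real.exp (-b * ‖x‖ ^ 2) := by
    simp_rw [neg_mul]
  have e3 : ((∫ x : E d, Real.exp (-(b * ‖x‖ ^ 2)) : ℝ) : ℂ) =
      (Real.pi / (b : ℂ)) ^ (Module.finrank ℝ (E d) / 2 : ℂ) := by
    rw [← GaussianFourier.integral_cexp_neg_mul_sq_norm (V := E d) (by simpa using hb),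
      ← integral_complex_ofReal]
    congr 1 with x
    push_cast
    ring_nf
  have hpos : (∫ x : E d, Real.exp (-(b * ‖x‖ ^ 2))) ≠ 0 := (integral_exp_pos hint).ne'
  rw [← e3, inv_mul_cancel_left₀ (by exact_mod_cast hpos)]
  congr 1
  rw [Complex.I_sq]
  simp only [b]
  push_cast
  field_simp
  ring

end GaussianDensity

/-! ### Mollification and weak derivatives. -/

section WeakGradient

variable {d : ℕ}

/-- Convolution with the normalized bump function. -/
def mollify {F : Type*} [NormedAddCommGroup F] [NormedSpace ℝ F] (φ : ContDiffBump (0 : E d))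
    (f : E d → F) : E d → F :=
  convolution (φ.normed volume) f (ContinuousLinearMap.lsmul ℝ ℝ) volume

lemma mollify_eq {F : Type*} [NormedAddCommGroup F] [NormedSpace ℝ F] (φ : ContDiffBump (0 : E d))
    (f : E d → F) (x : E d) : mollify φ f x = ∫ y, φ.normed volume (x - y) • f y :=
  convolution_lsmul_swap

lemma mollify_nonneg (φ : ContDiffBump (0 : E d)) {f : E d → ℝ} (hf : ∀ x, 0 ≤ f x) (x : E d) :
    0 ≤ mollify φ f x := by
  rw [mollify_eq]
  exact integral_nonneg fun y => mul_nonneg (φ.nonneg_normed _) (hf y)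

lemma integrable_mollify {F : Type*} [NormedAddCommGroup F] [NormedSpace ℝ F]
    (φ : ContDiffBump (0 : E d)) {f : E d → F} (hf : Integrable f volume) :
    Integrable (mollify φ f) volume :=
  φ.integrable_normed.integrable_convolution _ hf

lemma integrable_mollify_integrand {F : Type*} [NormedAddCommGroup F] [NormedSpace ℝ F]
    (φ : ContDiffBump (0 : E d)) {f : E d → F} (hf : Integrable f volume) (x : E d) :
    Integrable (fun y => φ.normed volume (x - y) • f y) volume := by
  obtain ⟨B, hB⟩ := φ.hasCompactSupport_normed.exists_bound_of_continuous
    (φ.continuous_normed (μ := volume))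
  have := φ.continuous_normed (μ := (volume : Measure (E d)))
  exact hf.bdd_smul B (by fun_prop : Continuous fun y => φ.normed volume (x - y)).aestronglyMeasurable
    (.of_forall fun y => hB _)

lemma integral_mollify (φ : ContDiffBump (0 : E d)) {f : E d → ℝ} (hf : Integrable f volume) :
    ∫ x, mollify φ f x = ∫ x, f x := by
  rw [mollify, integral_convolution _ φ.integrable_normed hf, φ.integral_normed]
  simp

/-- A sequence of bump functions with supports shrinking to the origin. -/
def bumpSeq (d : ℕ) (k : ℕ) : ContDiffBump (0 : E d) where
  rIn := 1 / ((k : ℝ) + 1)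
  rOut := 2 * (1 / ((k : ℝ) + 1))
  rIn_pos := by positivity
  rIn_lt_rOut := by linarith [show 0 < 1 / ((k : ℝ) + 1) by positivity]

lemma bumpSeq_rOut_tendsto : Tendsto (fun k => (bumpSeq d k).rOut) atTop (𝓝 0) := by
  simpa [bumpSeq] using (tendsto_one_div_add_atTop_nhds_zero_nat (𝕜 := ℝ)).const_mul 2

lemma ae_tendsto_mollify {F : Type*} [NormedAddCommGroup F] [NormedSpace ℝ F] [CompleteSpace F]
    {f : E d → F} (hf : Integrable f volume) :
    ∀ᵐ x, Tendsto (fun k => mollify (bumpSeq d k) f x) atTop (𝓝 (f x)) :=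
  ContDiffBump.ae_convolution_tendsto_right_of_locallyIntegrable (K := 2) bumpSeq_rOut_tendsto
    (.of_forall fun _ => le_rfl) hf.locallyIntegrable

/-- Scheffé's argument: mollification preserves the integral, so the L¹ distance is twice the
integral of the positive part of f - f_k, which is dominated by f and tends to 0 almost everywhere.
-/
lemma tendsto_integral_mollify_sub_of_nonneg {f : E d → ℝ} (hf : Integrable f volume)
    (h0 : ∀ x, 0 ≤ f x) :
    Tendsto (fun k => ∫ x, |mollify (bumpSeq d k) f x - f x|) atTop (𝓝 0) := by
  have h1 : Tendsto (fun k => ∫ x, max (f x - mollify (bumpSeq d k) f x) 0) atTop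
      (𝓝 (∫ _ : E d, (0 : ℝ))) := by
    refine tendsto_integral_of_dominated_convergence f (fun k => ?_) hf (fun k => ?_) ?_
    · exact ((hf.sub (integrable_mollify _ hf)).pos_part).aestronglyMeasurable
    · refine .of_forall fun x => ?_
      rw [Real.norm_of_nonneg (le_max_right _ _)]
      exact max_le (by linarith [mollify_nonneg (bumpSeq d k) h0 x]) (h0 x)
    · filter_upwards [ae_tendsto_mollify hf] with x hx
      simpa using (hx.const_sub (f x)).max (tendsto_const_nhds (x := (0 : ℝ)))
  have h2 : ∀ k, ∫ x, |mollify (bumpSeq d k) f x - f x| =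
      2 * ∫ x, max (f x - mollify (bumpSeq d k) f x) 0 := fun k => by
    have hm := integrable_mollify (bumpSeq d k) hf
    have e : ∀ x, |mollify (bumpSeq d k) f x - f x| =
        2 * max (f x - mollify (bumpSeq d k) f x) 0 + (mollify (bumpSeq d k) f x - f x) := by
      intro x
      rcases le_total (f x) (mollify (bumpSeq d k) f x) with h | h
      · rw [abs_of_nonneg (by linarith), max_eq_right (by linarith)]; ring
      · rw [abs_of_nonpos (by linarith), max_eq_left (by linarith)]; ring
    simp_rw [e]
    rw [integral_add (by exact (hf.sub hm).pos_part.const_mul 2) (by exact hm.sub hf),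
      integral_const_mul,
      integral_sub hm hf, integral_mollify _ hf]
    simp
  simp_rw [h2]
  simpa using h1.const_mul 2

lemma tendsto_integral_mollify_sub {f : E d → ℝ} (hf : Integrable f volume) :
    Tendsto (fun k => ∫ x, |mollify (bumpSeq d k) f x - f x|) atTop (𝓝 0) := by
  have hp := tendsto_integral_mollify_sub_of_nonneg hf.pos_part fun x => le_max_right _ _
  have hn := tendsto_integral_mollify_sub_of_nonneg hf.neg_part fun x => le_max_right _ _
  refine squeeze_zero (fun k => integral_nonneg fun x => abs_nonneg _) (fun k => ?_)
    (by simpa using hp.add hn)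
  have ip := integrable_mollify (bumpSeq d k) hf.pos_part
  have i_n := integrable_mollify (bumpSeq d k) hf.neg_part
  rw [← integral_add (by exact (ip.sub hf.pos_part).abs) (by exact (i_n.sub hf.neg_part).abs)]
  refine integral_mono ((integrable_mollify _ hf).sub hf).abs
    ((ip.sub hf.pos_part).abs.add (i_n.sub hf.neg_part).abs) fun x => ?_
  have e1 : f x = max (f x) 0 - max (-f x) 0 := by
    rcases le_total 0 (f x) with h | h <;> simp [h]
  have e2 : mollify (bumpSeq d k) f x = mollify (bumpSeq d k) (fun x => max (f x) 0) x
      - mollify (bumpSeq d k) (fun x => max (-f x) 0) x := by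
    simp only [mollify_eq]
    rw [← integral_sub (integrable_mollify_integrand _ hf.pos_part x)
      (integrable_mollify_integrand _ hf.neg_part x)]
    refine integral_congr_ae (.of_forall fun y => ?_)
    simp only [smul_eq_mul]
    rw [← mul_sub]
    congr 1
    rcases le_total 0 (f y) with h | h <;> simp [h]
  rw [e2]
  conv_lhs => rw [e1]
  calc _ = |(mollify (bumpSeq d k) (fun x => max (f x) 0) x - max (f x) 0)
      - (mollify (bumpSeq d k) (fun x => max (-f x) 0) x - max (-f x) 0)| := by ring_nf
    _ ≤ _ := abs_sub _ _

/-- `h` is the weak derivative of `f` in the direction `v`, both being integrable. -/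
structure HasWeakDeriv (f h : E d → ℝ) (v : E d) : Prop where
  left : Integrable f volume
  right : Integrable h volume
  eq : ∀ φ : E d → ℝ, ContDiff ℝ ∞ φ → HasCompactSupport φ →
    ∫ x, f x * fderiv ℝ φ x v = - ∫ x, h x * φ x

lemma contDiff_mollify (φ : ContDiffBump (0 : E d)) {f : E d → ℝ} (hf : Integrable f volume) :
    ContDiff ℝ 1 (mollify φ f) :=
  φ.hasCompactSupport_normed.contDiff_convolution_left _ (φ.contDiff_normed (n := 1))
    hf.locallyIntegrable

lemma HasWeakDeriv.fderiv_mollify {f h : E d → ℝ} {v : E d} (H : HasWeakDeriv f h v)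
    (φ : ContDiffBump (0 : E d)) (x : E d) : fderiv ℝ (mollify φ f) x v = mollify φ h x := by
  have hsm : ContDiff ℝ ∞ (φ.normed (volume : Measure (E d))) := φ.contDiff_normed
  have hd := φ.hasCompactSupport_normed.hasFDerivAt_convolution_left
    (ContinuousLinearMap.lsmul ℝ ℝ) (φ.contDiff_normed (n := 1) (μ := volume))
    H.left.locallyIntegrable x
  have := hd.fderiv
  change fderiv ℝ (mollify φ f) x = _ at this
  rw [this]
  -- The reflected and translated kernel is an admissible test function in the definition of the
  -- weak derivative.
  have hψ : ContDiff ℝ ∞ (fun y => φ.normed volume (x - y)) := by fun_prop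
  have hψc : HasCompactSupport (fun y => φ.normed volume (x - y)) :=
    φ.hasCompactSupport_normed.comp_homeomorph (Homeomorph.subLeft x)
  have hw := H.eq _ hψ hψc
  have hfd : ∀ y, fderiv ℝ (fun y => φ.normed volume (x - y)) y v =
      - fderiv ℝ (φ.normed volume) (x - y) v := fun y => by
    have h1 : HasFDerivAt (φ.normed volume) (fderiv ℝ (φ.normed volume) (x - y)) (x - y) :=
      ((hsm.differentiable (by simp)) _).hasFDerivAt
    have h2 : HasFDerivAt (fun y : E d => x - y) (-ContinuousLinearMap.id ℝ (E d)) y :=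
      (hasFDerivAt_id y).const_sub x
    have := (h1.comp y h2).fderiv
    simp only [Function.comp_def] at this
    rw [this]
    simp
  simp_rw [hfd, mul_neg] at hw
  rw [integral_neg, neg_inj] at hw
  have hex : ConvolutionExistsAt (fderiv ℝ (φ.normed volume)) f x
      ((ContinuousLinearMap.lsmul ℝ ℝ).precompL (E d)) volume :=
    (φ.hasCompactSupport_normed.fderiv ℝ).convolutionExists_left _
      (hsm.continuous_fderiv (by simp)) H.left.locallyIntegrable x
  rw [convolution_def, ContinuousLinearMap.integral_apply hex]
  simp only [ContinuousLinearMap.precompL_apply, ContinuousLinearMap.lsmul_apply, smul_eq_mul]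
  rw [mollify_eq]
  simp only [smul_eq_mul]
  rw [← integral_sub_left_eq_self _ volume x]
  simp only [sub_sub_cancel]
  simp_rw [mul_comm _ (f _), hw, mul_comm]

end WeakGradient

/-! ### The chain rule for weak derivatives, and their vanishing on zero sets. -/

section ChainRule

variable {d : ℕ}

lemma bounded_fderiv_apply {ψ : E d → ℝ} (hψ : ContDiff ℝ ∞ ψ) (hc : HasCompactSupport ψ)
    (v : E d) : ∃ B, ∀ x, |fderiv ℝ ψ x v| ≤ B :=
  (hc.fderiv_apply (𝕜 := ℝ) v).exists_bound_of_continuous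
    ((hψ.continuous_fderiv (by simp)).clm_apply continuous_const)

/-- The chain rule for weak derivatives, tested against smooth functions. -/
lemma HasWeakDeriv.chain_rule {f h : E d → ℝ} {v : E d} (H : HasWeakDeriv f h v) {β β' : ℝ → ℝ}
    (hβ : ∀ s, HasDerivAt β (β' s) s) (hβ' : Continuous β') (hb : ∀ s, |β' s| ≤ 1)
    (hβ0 : β 0 = 0) {ψ : E d → ℝ} (hψ : ContDiff ℝ ∞ ψ) (hc : HasCompactSupport ψ) :
    ∫ x, β (f x) * fderiv ℝ ψ x v = - ∫ x, β' (f x) * h x * ψ x := by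
  have hβc : Continuous β := continuous_iff_continuousAt.2 fun s => (hβ s).continuousAt
  have hlip : ∀ s t, |β s - β t| ≤ |s - t| := fun s t => by
    have := Convex.norm_image_sub_le_of_norm_hasDerivWithin_le (f := β) (f' := β') (s := Set.univ)
      (C := 1) (fun x _ => (hβ x).hasDerivWithinAt) (fun x _ => hb x) convex_univ
      (Set.mem_univ t) (Set.mem_univ s)
    simpa using this
  have hle : ∀ s, |β s| ≤ |s| := fun s => by simpa [hβ0] using hlip s 0
  obtain ⟨B1, hB1⟩ := bounded_fderiv_apply hψ hc v
  obtain ⟨B2, hB2⟩ := hc.exists_bound_of_continuous hψ.continuous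
  have cdψ : Continuous fun x => fderiv ℝ ψ x v :=
    (hψ.continuous_fderiv (by simp)).clm_apply continuous_const
  have cψ := hψ.continuous
  set fk := fun k => mollify (bumpSeq d k) f
  set hk := fun k => mollify (bumpSeq d k) h
  have cfk : ∀ k, Continuous (fk k) := fun k => (contDiff_mollify _ H.left).continuous
  have chk : ∀ k, Continuous (hk k) := fun k => (contDiff_mollify _ H.right).continuous
  -- For the mollified function the classical chain rule and integration by parts apply; the
  -- identity is then passed to the limit.
  have smooth : ∀ k, ∫ x, β (fk k x) * fderiv ℝ ψ x v = - ∫ x, β' (fk k x) * hk k x * ψ x := by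
    intro k
    have hfd : ∀ x, fderiv ℝ (fun x => β (fk k x)) x v = β' (fk k x) * hk k x := fun x => by
      have h1 : HasFDerivAt (fk k) (fderiv ℝ (fk k) x) x :=
        ((contDiff_mollify _ H.left).differentiable one_ne_zero x).hasFDerivAt
      have := ((hβ (fk k x)).comp_hasFDerivAt x h1).fderiv
      simp only [Function.comp_def] at this
      rw [this]
      simp [hk, fk, H.fderiv_mollify]
    have := integral_mul_fderiv_eq_neg_fderiv_mul_of_integrable (μ := (volume : Measure (E d)))
      (f := fun x => β (fk k x)) (g := ψ) (v := v) ?_ ?_ ?_ ?_ ?_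
    · simpa only [hfd] using this
    · simp_rw [hfd]
      exact (((hβ'.comp (cfk k)).mul (chk k)).mul cψ).integrable_of_hasCompactSupport hc.mul_left
    · exact ((hβc.comp (cfk k)).mul cdψ).integrable_of_hasCompactSupport
        (hc.fderiv_apply (𝕜 := ℝ) v).mul_left
    · exact ((hβc.comp (cfk k)).mul cψ).integrable_of_hasCompactSupport hc.mul_left
    · exact fun x _ => (hβ _).differentiableAt.comp x
        ((contDiff_mollify _ H.left).differentiable one_ne_zero x)
    · exact fun x _ => hψ.differentiable (by simp) x
  have aeβ : AEStronglyMeasurable (fun x => β (f x)) (volume : Measure (E d)) :=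
    hβc.comp_aestronglyMeasurable H.left.1
  have aeβ' : AEStronglyMeasurable (fun x => β' (f x)) (volume : Measure (E d)) :=
    hβ'.comp_aestronglyMeasurable H.left.1
  have iβ : Integrable (fun x => β (f x)) (volume : Measure (E d)) :=
    H.left.abs.mono' aeβ (.of_forall fun x => hle _)
  have i1 : Integrable (fun x => β (f x) * fderiv ℝ ψ x v) (volume : Measure (E d)) :=
    iβ.mul_bdd (c := B1) cdψ.aestronglyMeasurable (.of_forall hB1)
  have iβk : ∀ k, Integrable (fun x => β (fk k x)) (volume : Measure (E d)) := fun k =>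
    (integrable_mollify _ H.left).abs.mono' (hβc.comp (cfk k)).aestronglyMeasurable
      (.of_forall fun x => hle _)
  have i1k : ∀ k, Integrable (fun x => β (fk k x) * fderiv ℝ ψ x v) (volume : Measure (E d)) :=
    fun k => (iβk k).mul_bdd (c := B1) cdψ.aestronglyMeasurable (.of_forall hB1)
  have lim1 : Tendsto (fun k => ∫ x, β (fk k x) * fderiv ℝ ψ x v) atTop
      (𝓝 (∫ x, β (f x) * fderiv ℝ ψ x v)) := by
    rw [tendsto_iff_norm_sub_tendsto_zero]
    refine squeeze_zero (fun k => norm_nonneg _) (fun k => ?_)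
      (by simpa using (tendsto_integral_mollify_sub H.left).mul_const B1)
    rw [← integral_sub (i1k k) i1, ← integral_mul_const]
    refine norm_integral_le_of_norm_le
      (((integrable_mollify _ H.left).sub H.left).abs.mul_const B1) (.of_forall fun x => ?_)
    rw [← sub_mul, norm_mul]
    exact mul_le_mul (hlip _ _) (hB1 x) (norm_nonneg _) (abs_nonneg _)
  have ihψ : Integrable (fun x => h x * ψ x) (volume : Measure (E d)) :=
    H.right.mul_bdd (c := B2) cψ.aestronglyMeasurable (.of_forall hB2)
  have lim2 : Tendsto (fun k => ∫ x, β' (fk k x) * (h x * ψ x)) atTop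
      (𝓝 (∫ x, β' (f x) * (h x * ψ x))) := by
    refine tendsto_integral_of_dominated_convergence (fun x => |h x * ψ x|) (fun k => ?_) ihψ.abs
      (fun k => .of_forall fun x => ?_) ?_
    · exact (hβ'.comp (cfk k)).aestronglyMeasurable.mul ihψ.1
    · rw [norm_mul]
      exact mul_le_of_le_one_left (norm_nonneg _) (hb _)
    · filter_upwards [ae_tendsto_mollify H.left] with x hx
      exact ((hβ'.tendsto _).comp hx).mul_const _
  have lim3 : Tendsto (fun k => ∫ x, β' (fk k x) * ((hk k x - h x) * ψ x)) atTop (𝓝 0) := by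
    rw [tendsto_zero_iff_norm_tendsto_zero]
    refine squeeze_zero (fun k => norm_nonneg _) (fun k => ?_)
      (by simpa using (tendsto_integral_mollify_sub H.right).mul_const B2)
    rw [← integral_mul_const]
    refine norm_integral_le_of_norm_le
      (((integrable_mollify _ H.right).sub H.right).abs.mul_const B2) (.of_forall fun x => ?_)
    rw [norm_mul, norm_mul]
    calc ‖β' (fk k x)‖ * (‖hk k x - h x‖ * ‖ψ x‖) ≤ 1 * (‖hk k x - h x‖ * B2) := by
          gcongr
          · exact hb _
          · exact hB2 x
      _ = _ := by rw [one_mul]; rfl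
  -- The product β'(f_k) h_k has two varying factors. With h fixed, dominated convergence handles
  -- β'(f_k); the remainder is controlled by the L¹ norm of h_k - h, as |β'| ≤ 1.
  have split : ∀ k, ∫ x, β' (fk k x) * hk k x * ψ x = (∫ x, β' (fk k x) * (h x * ψ x))
      + ∫ x, β' (fk k x) * ((hk k x - h x) * ψ x) := fun k => by
    have mβ : AEStronglyMeasurable (fun x => β' (fk k x)) (volume : Measure (E d)) :=
      (hβ'.comp (cfk k)).aestronglyMeasurable
    have j1 : Integrable (fun x => β' (fk k x) * (h x * ψ x)) (volume : Measure (E d)) :=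
      ihψ.bdd_mul (c := 1) mβ (.of_forall fun x => hb _)
    have j2 : Integrable (fun x => β' (fk k x) * ((hk k x - h x) * ψ x))
        (volume : Measure (E d)) :=
      (((integrable_mollify _ H.right).sub H.right).mul_bdd (c := B2) cψ.aestronglyMeasurable
        (.of_forall hB2)).bdd_mul (c := 1) mβ (.of_forall fun x => hb _)
    rw [← integral_add j1 j2]
    congr 1 with x
    ring
  have lim4 := (lim2.add lim3).neg
  simp_rw [← split, ← smooth] at lim4
  rw [tendsto_nhds_unique lim1 lim4, add_zero]
  simp_rw [mul_assoc]

lemma sqrt_add_sq_pos {δ : ℝ} (hδ : 0 < δ) (s : ℝ) : 0 < √(s ^ 2 + δ ^ 2) :=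
  Real.sqrt_pos.2 (by positivity)

lemma abs_le_sqrt_add_sq (δ s : ℝ) : |s| ≤ √(s ^ 2 + δ ^ 2) :=
  Real.abs_le_sqrt (by nlinarith [sq_nonneg δ])

/-- The weak derivative of a nonnegative function vanishes on its zero set. -/
lemma HasWeakDeriv.indicator {f h : E d → ℝ} {v : E d} (H : HasWeakDeriv f h v)
    (h0 : ∀ x, 0 ≤ f x) {ψ : E d → ℝ} (hψ : ContDiff ℝ ∞ ψ) (hc : HasCompactSupport ψ) :
    ∫ x, f x * fderiv ℝ ψ x v = - ∫ x, (if f x = 0 then 0 else h x) * ψ x := by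
  set δ : ℕ → ℝ := fun k => 1 / ((k : ℝ) + 1)
  have hδ : ∀ k, 0 < δ k := fun k => by positivity
  have hδ0 : Tendsto δ atTop (𝓝 0) := tendsto_one_div_add_atTop_nhds_zero_nat
  -- β(s) = √(s² + δ²) - δ smooths |s|. As δ → 0, β(f) tends to f, while β'(f) = f/√(f² + δ²) tends
  -- to 1 where f > 0 and is 0 where f = 0.
  have key : ∀ k, ∫ x, (√(f x ^ 2 + δ k ^ 2) - δ k) * fderiv ℝ ψ x v =
      - ∫ x, f x / √(f x ^ 2 + δ k ^ 2) * h x * ψ x := fun k => by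
    refine H.chain_rule (β := fun s => √(s ^ 2 + δ k ^ 2) - δ k)
      (β' := fun s => s / √(s ^ 2 + δ k ^ 2)) (fun s => ?_) ?_ (fun s => ?_) ?_ hψ hc
    · have h1 : HasDerivAt (fun s : ℝ => s ^ 2 + δ k ^ 2) (2 * s) s := by
        simpa using (hasDerivAt_pow 2 s).add_const (δ k ^ 2)
      have := (h1.sqrt (by have := hδ k; positivity)).sub_const (δ k)
      rw [mul_div_mul_left _ _ two_ne_zero] at this
      exact this
    · exact continuous_id.div (by fun_prop) fun s => (sqrt_add_sq_pos (hδ k) s).ne'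
    · rw [abs_div, abs_of_pos (sqrt_add_sq_pos (hδ k) s)]
      exact div_le_one_of_le₀ (abs_le_sqrt_add_sq _ _) (Real.sqrt_nonneg _)
    · simp [Real.sqrt_sq (hδ k).le]
  obtain ⟨B1, hB1⟩ := bounded_fderiv_apply hψ hc v
  obtain ⟨B2, hB2⟩ := hc.exists_bound_of_continuous hψ.continuous
  have cdψ : Continuous fun x => fderiv ℝ ψ x v :=
    (hψ.continuous_fderiv (by simp)).clm_apply continuous_const
  have i1 : Integrable (fun x => f x * fderiv ℝ ψ x v) (volume : Measure (E d)) :=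
    H.left.mul_bdd (c := B1) cdψ.aestronglyMeasurable (.of_forall hB1)
  have i2 : Integrable (fun x => h x * ψ x) (volume : Measure (E d)) :=
    H.right.mul_bdd (c := B2) hψ.continuous.aestronglyMeasurable (.of_forall hB2)
  have mf : AEStronglyMeasurable f (volume : Measure (E d)) := H.left.1
  have lim1 : Tendsto (fun k => ∫ x, (√(f x ^ 2 + δ k ^ 2) - δ k) * fderiv ℝ ψ x v) atTop
      (𝓝 (∫ x, f x * fderiv ℝ ψ x v)) := by
    refine tendsto_integral_of_dominated_convergence (fun x => |f x * fderiv ℝ ψ x v|)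
      (fun k => ?_) i1.abs (fun k => .of_forall fun x => ?_) (.of_forall fun x => ?_)
    · have hcont : Continuous fun s : ℝ => √(s ^ 2 + δ k ^ 2) - δ k := by fun_prop
      exact (hcont.comp_aestronglyMeasurable mf).mul cdψ.aestronglyMeasurable
    · rw [norm_mul, abs_mul]
      refine mul_le_mul_of_nonneg_right ?_ (abs_nonneg _)
      have h1 := abs_le_sqrt_add_sq (f x) (δ k)
      rw [add_comm, abs_of_pos (hδ k)] at h1
      rw [Real.norm_of_nonneg (by linarith), abs_of_nonneg (h0 x), sub_le_iff_le_add,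
        Real.sqrt_le_left (by have := h0 x; have := hδ k; positivity)]
      nlinarith [mul_nonneg (h0 x) (hδ k).le]
    · have hcont : Continuous fun s : ℝ => (√(f x ^ 2 + s ^ 2) - s) * fderiv ℝ ψ x v := by fun_prop
      have := (hcont.tendsto 0).comp hδ0
      simpa [Function.comp_def, Real.sqrt_sq (h0 x)] using this
  have lim2 : Tendsto (fun k => ∫ x, f x / √(f x ^ 2 + δ k ^ 2) * h x * ψ x) atTop
      (𝓝 (∫ x, (if f x = 0 then 0 else h x) * ψ x)) := by
    refine tendsto_integral_of_dominated_convergence (fun x => |h x * ψ x|)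
      (fun k => ?_) i2.abs (fun k => .of_forall fun x => ?_) (.of_forall fun x => ?_)
    · have hcont : Continuous fun s : ℝ => s / √(s ^ 2 + δ k ^ 2) :=
        continuous_id.div (by fun_prop) fun s => (sqrt_add_sq_pos (hδ k) s).ne'
      exact ((hcont.comp_aestronglyMeasurable mf).mul H.right.1).mul
        hψ.continuous.aestronglyMeasurable
    · rw [mul_assoc, norm_mul]
      refine mul_le_of_le_one_left (norm_nonneg _) ?_
      rw [norm_div, Real.norm_of_nonneg (Real.sqrt_nonneg _)]
      exact div_le_one_of_le₀ (abs_le_sqrt_add_sq _ _) (Real.sqrt_nonneg _)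
    · rcases eq_or_ne (f x) 0 with hx | hx
      · simp [hx]
      · have hpos : 0 < f x := lt_of_le_of_ne (h0 x) hx.symm
        have hcont : ContinuousAt (fun s : ℝ => f x / √(f x ^ 2 + s ^ 2) * h x * ψ x) 0 := by
          refine ((ContinuousAt.div (by fun_prop) (by fun_prop) ?_).mul_const _).mul_const _
          simpa [Real.sqrt_sq (h0 x)] using hx
        have := hcont.tendsto.comp hδ0
        simpa [Function.comp_def, Real.sqrt_sq (h0 x), hx] using this
  simp_rw [key] at lim1
  exact tendsto_nhds_unique lim1 lim2.neg

end ChainRule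

/-! ### Localizing weak gradients. -/

section Cutoff

variable {d : ℕ}

/-- Product rule for a weak gradient and a smooth compactly supported factor. -/
lemma HasWeakGradient.hasWeakDeriv_mul {f : E d → ℝ} {g : E d → E d} (H : HasWeakGradient f g)
    {η : E d → ℝ} (hη : ContDiff ℝ ∞ η) (hc : HasCompactSupport η) (v : E d) :
    HasWeakDeriv (fun x => η x * f x) (fun x => inner ℝ (η x • g x + f x • ∇ η x) v) v := by
  have hηd : ∀ x, DifferentiableAt ℝ η x := fun x => hη.differentiable (by simp) x
  have cdη : Continuous (fderiv ℝ η) := hη.continuous_fderiv (by simp)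
  have hgrad : ∀ x w, inner ℝ (∇ η x) w = fderiv ℝ η x w := fun x w => by
    rw [gradient, InnerProductSpace.toDual_symm_apply]
  have cgrad : Continuous (∇ η) := (LinearIsometryEquiv.continuous _).comp cdη
  have cgradc : HasCompactSupport (∇ η) :=
    (hc.fderiv (𝕜 := ℝ)).comp_left (g := (InnerProductSpace.toDual ℝ (E d)).symm) (map_zero _)
  have I1 : Integrable (fun x => η x * f x) (volume : Measure (E d)) :=
    H.1.integrable_smul_left_of_hasCompactSupport hη.continuous hc
  have I2 : Integrable (fun x => η x • g x) (volume : Measure (E d)) :=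
    H.2.1.integrable_smul_left_of_hasCompactSupport hη.continuous hc
  have I3 : Integrable (fun x => f x • ∇ η x) (volume : Measure (E d)) :=
    H.1.integrable_smul_right_of_hasCompactSupport cgrad cgradc
  refine ⟨I1, (I2.add I3).inner_const v, fun φ hφ hφc => ?_⟩
  have hw := H.2.2 (fun x => η x * φ x) (hη.mul hφ) hc.mul_right v
  have hfd : ∀ x, fderiv ℝ (fun x => η x * φ x) x v =
      η x * fderiv ℝ φ x v + φ x * fderiv ℝ η x v := fun x => by
    rw [fderiv_fun_mul (hηd x) (hφ.differentiable (by simp) x)]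
    simp
  simp_rw [hfd] at hw
  obtain ⟨B1, hB1⟩ := bounded_fderiv_apply hφ hφc v
  obtain ⟨B2, hB2⟩ := hφc.exists_bound_of_continuous hφ.continuous
  have cdφ : Continuous fun x => fderiv ℝ φ x v :=
    (hφ.continuous_fderiv (by simp)).clm_apply continuous_const
  have J1 : Integrable (fun x => η x * f x * fderiv ℝ φ x v) (volume : Measure (E d)) :=
    I1.mul_bdd (c := B1) cdφ.aestronglyMeasurable (.of_forall hB1)
  have J2 : Integrable (fun x => inner ℝ (f x • ∇ η x) v * φ x) (volume : Measure (E d)) :=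
    (I3.inner_const v).mul_bdd (c := B2) hφ.continuous.aestronglyMeasurable (.of_forall hB2)
  have J3 : Integrable (fun x => inner ℝ (η x • g x) v * φ x) (volume : Measure (E d)) :=
    (I2.inner_const v).mul_bdd (c := B2) hφ.continuous.aestronglyMeasurable (.of_forall hB2)
  have e1 : ∫ x, f x * (η x * fderiv ℝ φ x v + φ x * fderiv ℝ η x v) =
      (∫ x, η x * f x * fderiv ℝ φ x v) + ∫ x, inner ℝ (f x • ∇ η x) v * φ x := by
    rw [← integral_add J1 J2]
    congr 1 with x
    rw [real_inner_smul_left, hgrad]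
    ring
  have e2 : ∫ x, inner ℝ (g x) v * (η x * φ x) = ∫ x, inner ℝ (η x • g x) v * φ x := by
    congr 1 with x
    rw [real_inner_smul_left]
    ring
  have e3 : ∫ x, inner ℝ (η x • g x + f x • ∇ η x) v * φ x =
      (∫ x, inner ℝ (η x • g x) v * φ x) + ∫ x, inner ℝ (f x • ∇ η x) v * φ x := by
    rw [← integral_add J3 J2]
    congr 1 with x
    rw [inner_add_left, add_mul]
  rw [e1, e2] at hw
  rw [e3]
  linarith

/-- A weak gradient of a nonnegative function may be set to `0` on the zero set. -/
lemma HasWeakGradient.indicator {f : E d → ℝ} {g : E d → E d} (H : HasWeakGradient f g)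
    (hm : Measurable f) (h0 : ∀ x, 0 ≤ f x) :
    HasWeakGradient f (fun x => if f x = 0 then 0 else g x) := by
  have hg : (fun x => if f x = 0 then 0 else g x) = ({x | f x = 0}ᶜ).indicator g := by
    ext1 x
    by_cases h : f x = 0 <;> simp [Set.indicator, h]
  refine ⟨H.1, ?_, fun φ hφ hφc v => ?_⟩
  · rw [hg]
    exact H.2.1.indicator (hm (measurableSet_singleton 0)).compl
  -- `HasWeakDeriv` asks for global integrability, so f is multiplied by a bump equal to 1 near the
  -- support of the test function; radius |R| + 1 makes the closed ball of radius R interior.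
  · obtain ⟨R, hR⟩ := hφc.isBounded.subset_closedBall 0
    let χ : ContDiffBump (0 : E d) := ⟨|R| + 1, |R| + 2, by positivity, by linarith⟩
    have hχ1 : ∀ x, φ x ≠ 0 ∨ fderiv ℝ φ x v ≠ 0 → χ =ᶠ[𝓝 x] 1 := fun x hx => by
      have hxs : x ∈ tsupport φ := by
        rcases hx with hx | hx
        · exact subset_tsupport _ hx
        · by_contra hcon
          rw [fderiv_of_notMem_tsupport (𝕜 := ℝ) hcon] at hx
          simp at hx
      refine χ.eventuallyEq_one_of_mem_ball ?_
      have := hR hxs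
      rw [mem_closedBall_zero_iff] at this
      rw [mem_ball_zero_iff]
      exact this.trans_lt (by have := le_abs_self R; change R < |R| + 1; linarith)
    have hw := (H.hasWeakDeriv_mul χ.contDiff χ.hasCompactSupport v).indicator
      (fun x => mul_nonneg χ.nonneg (h0 x)) hφ hφc
    have e1 : ∀ x, χ x * f x * fderiv ℝ φ x v = f x * fderiv ℝ φ x v := fun x => by
      by_cases hx : fderiv ℝ φ x v = 0
      · simp [hx]
      · rw [(hχ1 x (.inr hx)).eq_of_nhds]; simp
    have e2 : ∀ x, (if χ x * f x = 0 then 0 else inner ℝ (χ x • g x + f x • ∇ χ x) v) * φ x =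
        inner ℝ (if f x = 0 then 0 else g x) v * φ x := fun x => by
      by_cases hx : φ x = 0
      · simp [hx]
      · have h1 := hχ1 x (.inl hx)
        have h2 : ∇ χ x = 0 := by
          rw [gradient, h1.fderiv_eq]
          simp [Pi.one_def]
        rw [h1.eq_of_nhds, h2]
        by_cases hf : f x = 0 <;> simp [hf]
    simp_rw [e1, e2] at hw
    exact hw

end Cutoff

/-! ### Bregman form of the entropy, and Fatou's lemma. -/

section Entropy

/-- The Bregman divergence of `s ↦ s log s`, whose integral against a measure is the entropy of a
function when `c` is its mean. -/
def bregman (c s : ℝ) : ℝ := s * Real.log s - s * Real.log c - s + c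

lemma bregman_nonneg {c s : ℝ} (hc : 0 < c) (hs : 0 ≤ s) : 0 ≤ bregman c s := by
  rcases hs.eq_or_lt with rfl | hs
  · simpa [bregman] using hc.le
  · have := Real.log_le_sub_one_of_pos (div_pos hc hs)
    rw [Real.log_div hc.ne' hs.ne'] at this
    have h2 := mul_le_mul_of_nonneg_left this hs.le
    have e : s * (c / s - 1) = c - s := by field_simp
    rw [bregman]
    linarith

/-- The limit s₀ may be 0, since s log s is continuous there; only the reference constant has to
stay away from 0. -/
lemma tendsto_bregman {α : Type*} {l : Filter α} {c s : α → ℝ} {c₀ s₀ : ℝ} (hc₀ : c₀ ≠ 0)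
    (hc : Tendsto c l (𝓝 c₀)) (hs : Tendsto s l (𝓝 s₀)) :
    Tendsto (fun k => bregman (c k) (s k)) l (𝓝 (bregman c₀ s₀)) :=
  ((((Real.continuous_mul_log.tendsto s₀).comp hs).sub (hs.mul (hc.log hc₀))).sub hs).add hc

lemma continuous_bregman (c : ℝ) : Continuous (bregman c) :=
  ((Real.continuous_mul_log.sub (continuous_id.mul continuous_const)).sub continuous_id).add
    continuous_const

/-- Fatou's lemma, for a sequence of functions with bounded integrals. -/
lemma lintegral_le_of_tendsto_ae {α : Type*} [MeasurableSpace α] {m : Measure α}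
    {u : ℕ → α → ℝ≥0∞} {u₀ : α → ℝ≥0∞} (hu : ∀ k, AEMeasurable (u k) m)
    (hlim : ∀ᵐ x ∂m, Tendsto (fun k => u k x) atTop (𝓝 (u₀ x))) {b : ℕ → ℝ≥0∞} {b₀ : ℝ≥0∞}
    (hb : Tendsto b atTop (𝓝 b₀)) (hle : ∀ k, ∫⁻ x, u k x ∂m ≤ b k) : ∫⁻ x, u₀ x ∂m ≤ b₀ := by
  calc ∫⁻ x, u₀ x ∂m = ∫⁻ x, liminf (fun k => u k x) atTop ∂m := by
        refine lintegral_congr_ae ?_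
        filter_upwards [hlim] with x hx using hx.liminf_eq.symm
    _ ≤ liminf (fun k => ∫⁻ x, u k x ∂m) atTop := lintegral_liminf_le' hu
    _ ≤ liminf b atTop := liminf_le_liminf (.of_forall hle)
    _ = b₀ := hb.liminf_eq

end Entropy

/-! ### Mollified functions form nice pairs. -/

section NiceMollify

variable {d : ℕ}

lemma abs_taylor_le_of_lipschitz_fderiv {f : E d → ℝ} (hf : Differentiable ℝ f) {L : ℝ}
    (hL0 : 0 ≤ L) (hL : ∀ x y, ‖fderiv ℝ f x - fderiv ℝ f y‖ ≤ L * ‖x - y‖) (x v : E d) :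
    |f (x + v) - f x - fderiv ℝ f x v| ≤ L * ‖v‖ ^ 2 := by
  have := (convex_closedBall x ‖v‖).norm_image_sub_le_of_norm_hasFDerivWithin_le' (f := f)
    (f' := fderiv ℝ f) (φ := fderiv ℝ f x) (C := L * ‖v‖) (x := x) (y := x + v)
    (fun z _ => (hf z).hasFDerivAt.hasFDerivWithinAt)
    (fun z hz => (hL z x).trans (by rw [mem_closedBall_iff_norm] at hz; gcongr)) (by simp)
    (by simp)
  simpa [pow_two, mul_assoc] using this

lemma inner_mollify (φ : ContDiffBump (0 : E d)) {G : E d → E d} (hG : Integrable G volume)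
    (x v : E d) : inner ℝ (mollify φ G x) v = mollify φ (fun y => inner ℝ (G y) v) x := by
  rw [mollify_eq, mollify_eq, real_inner_comm,
    ← integral_inner (integrable_mollify_integrand φ hG x)]
  congr 1 with y
  rw [inner_smul_right, real_inner_comm, smul_eq_mul]

lemma exists_norm_mollify_le (φ : ContDiffBump (0 : E d)) : ∃ B : ℝ, 0 ≤ B ∧
    (∀ {F : Type} [NormedAddCommGroup F] [NormedSpace ℝ F] {f : E d → F}, Integrable f volume →
      (∀ x, ‖mollify φ f x‖ ≤ B * ∫ y, ‖f y‖) ∧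
      ∀ x y, ‖mollify φ f x - mollify φ f y‖ ≤ B * (∫ y, ‖f y‖) * ‖x - y‖) := by
  have hsm : ContDiff ℝ 1 (φ.normed (volume : Measure (E d))) := φ.contDiff_normed (n := 1)
  obtain ⟨B, hB⟩ := φ.hasCompactSupport_normed.exists_bound_of_continuous
    (φ.continuous_normed (μ := volume))
  obtain ⟨L, hL⟩ := hsm.lipschitzWith_of_hasCompactSupport φ.hasCompactSupport_normed one_ne_zero
  refine ⟨max B L, le_max_of_le_right L.2, fun {F} _ _ {f} hf => ⟨fun x => ?_, fun x y => ?_⟩⟩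
  · rw [mollify_eq, ← integral_const_mul]
    refine norm_integral_le_of_norm_le (hf.norm.const_mul _) (.of_forall fun y => ?_)
    rw [norm_smul]
    gcongr
    exact (hB _).trans (le_max_left _ _)
  · rw [mollify_eq, mollify_eq, ← integral_sub (integrable_mollify_integrand φ hf x)
      (integrable_mollify_integrand φ hf y), mul_right_comm, ← integral_const_mul]
    refine norm_integral_le_of_norm_le (hf.norm.const_mul _) (.of_forall fun z => ?_)
    rw [← sub_smul, norm_smul]
    gcongr
    have := hL.dist_le_mul (x - z) (y - z)
    rw [dist_eq_norm, dist_eq_norm, sub_sub_sub_cancel_right] at this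
    exact this.trans (by gcongr; exact le_max_right _ _)

/-- The shift by `δ` supplies the lower bound, and the kernel, being bounded and Lipschitz, supplies
the others from the L¹ norms. `C` and `M` may blow up as the bump shrinks, harmlessly: the constant
in `niceLSI_gauss` depends on neither. -/
lemma nicePair_mollify (φ : ContDiffBump (0 : E d)) {F : E d → ℝ} {G : E d → E d}
    (hF : Integrable F volume) (hG : Integrable G volume) (h0 : ∀ x, 0 ≤ F x)
    (hw : ∀ v, HasWeakDeriv F (fun x => inner ℝ (G x) v) v) (δ : ℝ) :
    ∃ C M, NicePair δ C M (fun x => mollify φ F x + δ) (mollify φ G) := by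
  obtain ⟨B, hB0, hB⟩ := exists_norm_mollify_le φ
  obtain ⟨hF1, hF2⟩ := hB hF
  obtain ⟨hG1, hG2⟩ := hB hG
  have IF : 0 ≤ ∫ y, ‖F y‖ := integral_nonneg fun y => norm_nonneg _
  have IG : 0 ≤ ∫ y, ‖G y‖ := integral_nonneg fun y => norm_nonneg _
  have hfd : ∀ x v, fderiv ℝ (mollify φ F) x v = inner ℝ (mollify φ G x) v := fun x v => by
    rw [(hw v).fderiv_mollify, inner_mollify φ hG]
  refine ⟨B * (∫ y, ‖F y‖) + δ, B * (∫ y, ‖F y‖) + B * ∫ y, ‖G y‖, ⟨fun x => ?_, fun x => ?_,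
    fun x => ?_, fun x y => ?_, fun x y => ?_, fun x v => ?_⟩⟩
  · linarith [mollify_nonneg φ h0 x]
  · linarith [(le_abs_self _).trans (hF1 x)]
  · linarith [hG1 x, mul_nonneg hB0 IF]
  · rw [add_sub_add_right_eq_sub, add_mul]
    have := hF2 x y
    rw [Real.norm_eq_abs] at this
    nlinarith [mul_nonneg (mul_nonneg hB0 IG) (norm_nonneg (x - y))]
  · rw [add_mul]
    nlinarith [hG2 x y, mul_nonneg (mul_nonneg hB0 IF) (norm_nonneg (x - y))]
  · rw [add_sub_add_right_eq_sub, ← hfd, add_mul]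
    have := abs_taylor_le_of_lipschitz_fderiv (f := mollify φ F)
      ((contDiff_mollify φ hF).differentiable one_ne_zero) (mul_nonneg hB0 IG)
      (fun x y => ?_) x v
    · nlinarith [mul_nonneg (mul_nonneg hB0 IF) (sq_nonneg ‖v‖)]
    · refine ContinuousLinearMap.opNorm_le_bound _ (by positivity) fun v => ?_
      rw [sub_apply, hfd, hfd, ← inner_sub_left]
      exact (norm_inner_le_norm _ _).trans (by gcongr; exact hG2 x y)

end NiceMollify

/-! ### The Gaussian inequality for compactly supported weakly differentiable functions. -/

section CompactlySupported

variable {d : ℕ}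

/-- The density of `gauss d t`. -/
def gaussDensity (t : ℝ) (x : E d) : ℝ :=
  Real.exp (-((1 / (2 * t)) * ‖x‖ ^ 2)) / ∫ y : E d, Real.exp (-((1 / (2 * t)) * ‖y‖ ^ 2))

lemma integral_gauss_eq {t : ℝ} (ht : 0 < t) (u : E d → ℝ) :
    ∫ x, u x ∂gauss d t = ∫ x, gaussDensity t x * u x := by
  rw [gauss_eq_tilted ht, integral_tilted]
  rfl

lemma integrable_gauss_iff {t : ℝ} (ht : 0 < t) {F : Type*} [NormedAddCommGroup F]
    [NormedSpace ℝ F] (u : E d → F) : Integrable u (gauss d t) ↔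
      Integrable (fun x => Real.exp (-((1 / (2 * t)) * ‖x‖ ^ 2)) • u x) volume := by
  rw [gauss_eq_tilted ht]
  exact integrable_tilted_iff (integrable_exp_neg_mul_sq_norm (by positivity)) u

lemma gauss_absolutelyContinuous {t : ℝ} (ht : 0 < t) : gauss d t ≪ volume := by
  rw [gauss_eq_tilted ht]
  exact tilted_absolutelyContinuous _ _

lemma gaussDensity_pos {t : ℝ} (ht : 0 < t) (x : E d) : 0 < gaussDensity t x :=
  div_pos (Real.exp_pos _) (integral_exp_pos (integrable_exp_neg_mul_sq_norm (by positivity)))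

lemma gaussDensity_le {t : ℝ} (ht : 0 < t) (x : E d) : gaussDensity t x ≤ gaussDensity t (0 : E d) := by
  have := integral_exp_pos (integrable_exp_neg_mul_sq_norm (d := d) (b := 1 / (2 * t))
    (by positivity))
  rw [gaussDensity, gaussDensity]
  gcongr
  simp

lemma continuous_gaussDensity (t : ℝ) : Continuous (gaussDensity (d := d) t) := by
  unfold gaussDensity
  fun_prop

/-- The triangle inequality gives ‖x‖² ≥ ‖y‖² - 2Rε. Thus, on bounded sets, the Gaussian weight
changes by a factor close to 1 under small displacements, and can be moved past a mollifier. -/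
lemma gaussDensity_le_exp_mul {t R ε : ℝ} (ht : 0 < t) {x y : E d} (hy : ‖y‖ ≤ R)
    (hxy : ‖x - y‖ ≤ ε) : gaussDensity t x ≤ Real.exp (R * ε / t) * gaussDensity t y := by
  have := integral_exp_pos (integrable_exp_neg_mul_sq_norm (d := d) (b := 1 / (2 * t))
    (by positivity))
  rw [gaussDensity, gaussDensity, mul_div_assoc', ← Real.exp_add]
  gcongr
  have h1 : ‖y‖ - ‖x - y‖ ≤ ‖x‖ := by
    have := norm_sub_norm_le y x
    rw [norm_sub_rev] at this
    linarith
  have h2 : ‖y‖ ^ 2 - 2 * (R * ε) ≤ ‖x‖ ^ 2 := by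
    have h3 : ‖y‖ * ‖x - y‖ ≤ R * ε := mul_le_mul hy hxy (norm_nonneg _) ((norm_nonneg _).trans hy)
    rcases le_total ‖y‖ ‖x - y‖ with h | h
    · nlinarith [norm_nonneg y, norm_nonneg (x - y), sq_nonneg ‖x‖]
    · nlinarith [norm_nonneg y, norm_nonneg (x - y), sq_nonneg ‖x - y‖]
  rw [← sub_nonneg]
  have e : R * ε / t + -(1 / (2 * t) * ‖y‖ ^ 2) - -(1 / (2 * t) * ‖x‖ ^ 2) =
      (‖x‖ ^ 2 - (‖y‖ ^ 2 - 2 * (R * ε))) / (2 * t) := by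
    field_simp
    ring
  rw [e]
  have : 0 ≤ ‖x‖ ^ 2 - (‖y‖ ^ 2 - 2 * (R * ε)) := by linarith
  positivity

lemma _root_.MeasureTheory.Integrable.gauss {t : ℝ} (ht : 0 < t) {F : Type*} [NormedAddCommGroup F]
    [NormedSpace ℝ F] {u : E d → F} (hu : Integrable u volume) : Integrable u (gauss d t) := by
  rw [integrable_gauss_iff ht]
  refine hu.bdd_smul 1 (by fun_prop : Continuous fun x : E d =>
    Real.exp (-((1 / (2 * t)) * ‖x‖ ^ 2))).aestronglyMeasurable (.of_forall fun x => ?_)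
  rw [Real.norm_of_nonneg (Real.exp_pos _).le, Real.exp_le_one_iff]
  have : 0 ≤ 1 / (2 * t) * ‖x‖ ^ 2 := by positivity
  linarith

/-- Taken at the mean, the Bregman integral is ∫ f log f - F log F, so this is `niceLSI_gauss` with
a nonnegative integrand, ready for Fatou's lemma. -/
lemma NicePair.lintegral_bregman_le {c C M t : ℝ} {f : E d → ℝ} {g : E d → E d} (hc : 0 < c)
    (h : NicePair c C M f g) (ht : 0 ≤ t) :
    ∫⁻ x, ENNReal.ofReal (bregman (∫ y, f y ∂gauss d t) (f x)) ∂gauss d t ≤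
      ENNReal.ofReal (t / 2 * ∫ x, ‖g x‖ ^ 2 / f x ∂gauss d t) := by
  have H := niceLSI_gauss hc ht f g h
  have I0 : Integrable f (gauss d t) := by simpa using h.integrable hc (gauss d t) 0
  have I1 := h.integrable_mul_log (gauss d t)
  set F := ∫ y, f y ∂gauss d t with hF
  have hFpos : 0 < F := by
    have := integral_mono (integrable_const c) I0 fun z => h.lower _
    exact hc.trans_le (by simpa using this)
  have J : Integrable (fun x => bregman F (f x)) (gauss d t) :=
    ((I1.sub (I0.mul_const _)).sub I0).add (integrable_const _)
  rw [← ofReal_integral_eq_lintegral_ofReal J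
    (.of_forall fun x => bregman_nonneg hFpos (h.pos hc x).le)]
  refine ENNReal.ofReal_le_ofReal ?_
  simp only [bregman]
  rw [integral_add (by exact (I1.sub (I0.mul_const _)).sub I0) (integrable_const _),
    integral_sub (by exact I1.sub (I0.mul_const _)) I0, integral_sub I1 (I0.mul_const _),
    integral_mul_const, ← hF]
  simp only [integral_const, probReal_univ, smul_eq_mul, one_mul]
  linarith

/-- Jensen for (v, a) ↦ ‖v‖²/a: freeze q at its optimal value for the mollified pair and integrate
the tangent bound. The shift δ only helps. Where F vanishes the quotient is 0 by convention, and
`hz` keeps the tangent bound valid there. -/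
lemma fisher_mollify_le (φ : ContDiffBump (0 : E d)) {F : E d → ℝ} {G : E d → E d}
    (hF : Integrable F volume) (hG : Integrable G volume) (h0 : ∀ x, 0 ≤ F x)
    (hz : ∀ x, F x = 0 → G x = 0) (hQ : Integrable (fun x => ‖G x‖ ^ 2 / F x) volume)
    {δ : ℝ} (hδ : 0 < δ) (x : E d) :
    ‖mollify φ G x‖ ^ 2 / (mollify φ F x + δ) ≤ mollify φ (fun y => ‖G y‖ ^ 2 / F y) x := by
  have hpos : 0 < mollify φ F x + δ := by linarith [mollify_nonneg φ h0 x]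
  rw [fisher_tangent_eq hpos]
  set q := (mollify φ F x + δ)⁻¹ • mollify φ G x
  have J1 := integrable_mollify_integrand φ (hG.inner_const (𝕜 := ℝ) q) x
  have J2 := integrable_mollify_integrand φ hF x
  calc 2 * inner ℝ (mollify φ G x) q - (mollify φ F x + δ) * ‖q‖ ^ 2
      ≤ 2 * inner ℝ (mollify φ G x) q - mollify φ F x * ‖q‖ ^ 2 := by
        nlinarith [mul_nonneg hδ.le (sq_nonneg ‖q‖)]
    _ = ∫ y, (2 * (φ.normed volume (x - y) • inner ℝ (G y) q)
          - φ.normed volume (x - y) • F y * ‖q‖ ^ 2) := by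
        rw [integral_sub (J1.const_mul 2) (J2.mul_const _), integral_const_mul,
          integral_mul_const, inner_mollify φ hG, mollify_eq, mollify_eq]
    _ ≤ _ := by
        rw [mollify_eq]
        refine integral_mono ((J1.const_mul 2).sub (J2.mul_const _))
          (integrable_mollify_integrand φ hQ x) fun y => ?_
        have hy : 2 * inner ℝ (G y) q - F y * ‖q‖ ^ 2 ≤ ‖G y‖ ^ 2 / F y := by
          rcases (h0 y).eq_or_lt with h | h
          · simp [hz y h.symm, ← h]
          · exact fisher_tangent h _ _
        have := mul_le_mul_of_nonneg_left hy (φ.nonneg_normed (μ := volume) (x - y))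
        simp only [smul_eq_mul]
        linarith

lemma integral_gauss_mollify_le (φ : ContDiffBump (0 : E d)) {t R : ℝ} (ht : 0 < t)
    {Q : E d → ℝ} (hQ : Integrable Q volume) (h0 : ∀ x, 0 ≤ Q x)
    (hR : ∀ x, Q x ≠ 0 → ‖x‖ ≤ R) :
    ∫ x, mollify φ Q x ∂gauss d t ≤ Real.exp (R * φ.rOut / t) * ∫ x, Q x ∂gauss d t := by
  have hρQ : Integrable (fun x => gaussDensity t x * Q x) volume :=
    hQ.bdd_mul (c := gaussDensity (d := d) t 0) (continuous_gaussDensity t).aestronglyMeasurable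
      (.of_forall fun x => by
        rw [Real.norm_of_nonneg (gaussDensity_pos ht x).le]; exact gaussDensity_le ht x)
  rw [integral_gauss_eq ht, integral_gauss_eq ht, ← integral_mollify φ hρQ, ← integral_const_mul]
  refine integral_mono ?_ ((integrable_mollify φ hρQ).const_mul _) fun x => ?_
  · exact (integrable_mollify φ hQ).bdd_mul (c := gaussDensity (d := d) t 0)
      (continuous_gaussDensity t).aestronglyMeasurable (.of_forall fun x => by
        rw [Real.norm_of_nonneg (gaussDensity_pos ht x).le]; exact gaussDensity_le ht x)
  · simp only [mollify_eq]
    rw [← integral_const_mul, ← integral_const_mul]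
    refine integral_mono ((integrable_mollify_integrand φ hQ x).const_mul _)
      ((integrable_mollify_integrand φ hρQ x).const_mul _) fun y => ?_
    simp only [smul_eq_mul]
    by_cases hy : Q y = 0
    · simp [hy]
    by_cases hxy : φ.normed volume (x - y) = 0
    · simp [hxy]
    have hmem : x - y ∈ Function.support (φ.normed (volume : Measure (E d))) := hxy
    rw [φ.support_normed_eq, mem_ball_zero_iff] at hmem
    have := gaussDensity_le_exp_mul ht (hR y hy) hmem.le
    have h2 : 0 ≤ φ.normed volume (x - y) * Q y := mul_nonneg (φ.nonneg_normed _) (h0 y)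
    nlinarith [mul_le_mul_of_nonneg_right this h2]

/-- The inequality holds for mollified pairs. On the left Fatou's lemma applies; on the right the
mollified Fisher information exceeds the original by a factor exp(R r/t) at most, with r the bump
radius, and this tends to 1. -/
lemma lintegral_bregman_le_of_hasCompactSupport {t R δ : ℝ} (ht : 0 < t) (hδ : 0 < δ)
    {F : E d → ℝ} {G : E d → E d}
    (hF : Integrable F volume) (hG : Integrable G volume) (h0 : ∀ x, 0 ≤ F x)
    (hw : ∀ v, HasWeakDeriv F (fun x => inner ℝ (G x) v) v)
    (hz : ∀ x, F x = 0 → G x = 0) (hR : ∀ x, F x ≠ 0 → ‖x‖ ≤ R) :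
    ∫⁻ x, ENNReal.ofReal (bregman (∫ y, (F y + δ) ∂gauss d t) (F x + δ)) ∂gauss d t ≤
      ENNReal.ofReal (t / 2) * ∫⁻ x, ENNReal.ofReal (‖G x‖ ^ 2 / F x) ∂gauss d t := by
  set Q := fun x => ‖G x‖ ^ 2 / F x
  have hQ0 : ∀ x, 0 ≤ Q x := fun x => div_nonneg (sq_nonneg _) (h0 x)
  have mQ : AEStronglyMeasurable Q volume :=
    ((hG.1.norm.aemeasurable.pow_const 2).div hF.1.aemeasurable).aestronglyMeasurable
  by_cases hJ : ∫⁻ x, ENNReal.ofReal (Q x) ∂gauss d t = ⊤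
  · rw [hJ, ENNReal.mul_top (by simpa using ht)]
    exact le_top
  have hQR : ∀ x, Q x ≠ 0 → ‖x‖ ≤ R := fun x hx => hR x fun h => hx (by simp [Q, h])
  have hQγ : Integrable Q (gauss d t) :=
    (lintegral_ofReal_ne_top_iff_integrable (mQ.mono_ac (gauss_absolutelyContinuous ht))
      (.of_forall hQ0)).1 hJ
  -- On the ball of radius R, which carries Q, the Gaussian density is bounded below.
  have hQv : Integrable Q volume := by
    rw [integrable_gauss_iff ht] at hQγ
    refine (hQγ.norm.const_mul (Real.exp ((1 / (2 * t)) * R ^ 2))).mono' mQ (.of_forall fun x => ?_)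
    by_cases hx : Q x = 0
    · simp [hx]
    rw [norm_smul, Real.norm_of_nonneg (Real.exp_pos _).le, ← mul_assoc, ← Real.exp_add]
    refine le_mul_of_one_le_left (norm_nonneg _) (Real.one_le_exp ?_)
    have h1 : ‖x‖ ^ 2 ≤ R ^ 2 := by have := hQR x hx; gcongr
    have h2 : 0 ≤ 1 / (2 * t) := by positivity
    nlinarith [mul_le_mul_of_nonneg_left h1 h2]
  set Fk := fun k => mollify (bumpSeq d k) F
  have iFk : ∀ k, Integrable (Fk k) volume := fun k => integrable_mollify _ hF
  have hb : Tendsto (fun k => ENNReal.ofReal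
      (t / 2 * (Real.exp (R * (bumpSeq d k).rOut / t) * ∫ x, Q x ∂gauss d t))) atTop
      (𝓝 (ENNReal.ofReal (t / 2) * ∫⁻ x, ENNReal.ofReal (Q x) ∂gauss d t)) := by
    rw [← ofReal_integral_eq_lintegral_ofReal hQγ (.of_forall hQ0),
      ← ENNReal.ofReal_mul (by positivity)]
    refine ENNReal.tendsto_ofReal (Tendsto.const_mul _ ?_)
    have h1 : Continuous fun s : ℝ => Real.exp (R * s / t) * ∫ x, Q x ∂gauss d t := by fun_prop
    have := (h1.tendsto 0).comp (bumpSeq_rOut_tendsto (d := d))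
    simpa [Function.comp_def] using this
  have hmean : Tendsto (fun k => ∫ y, (Fk k y + δ) ∂gauss d t) atTop
      (𝓝 (∫ y, (F y + δ) ∂gauss d t)) := by
    have e : ∀ k, ∫ y, (Fk k y + δ) ∂gauss d t = (∫ y, Fk k y ∂gauss d t) + δ := fun k => by
      rw [integral_add ((iFk k).gauss ht) (integrable_const _)]; simp
    have e0 : ∫ y, (F y + δ) ∂gauss d t = (∫ y, F y ∂gauss d t) + δ := by
      rw [integral_add (hF.gauss ht) (integrable_const _)]; simp
    simp_rw [e, e0]
    refine Tendsto.add_const _ ?_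
    rw [tendsto_iff_norm_sub_tendsto_zero]
    refine squeeze_zero (fun k => norm_nonneg _) (fun k => ?_)
      (by simpa using (tendsto_integral_mollify_sub hF).const_mul (gaussDensity t (0 : E d)))
    rw [← integral_sub ((iFk k).gauss ht) (hF.gauss ht), integral_gauss_eq ht,
      ← integral_const_mul]
    refine norm_integral_le_of_norm_le (((iFk k).sub hF).abs.const_mul _) (.of_forall fun x => ?_)
    rw [norm_mul, Real.norm_of_nonneg (gaussDensity_pos ht x).le]
    exact mul_le_mul_of_nonneg_right (gaussDensity_le ht x) (norm_nonneg _)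
  have hmean_pos : (∫ y, (F y + δ) ∂gauss d t) ≠ 0 := by
    rw [integral_add (hF.gauss ht) (integrable_const _)]
    have : 0 ≤ ∫ y, F y ∂gauss d t := integral_nonneg h0
    simp only [integral_const, probReal_univ, smul_eq_mul, one_mul]
    positivity
  refine lintegral_le_of_tendsto_ae (fun k => ?_) ?_ hb (fun k => ?_)
    (u := fun k x => ENNReal.ofReal (bregman (∫ y, (Fk k y + δ) ∂gauss d t) (Fk k x + δ)))
  · exact ((continuous_bregman _).comp
      ((contDiff_mollify _ hF).continuous.add continuous_const)).measurable.ennreal_ofReal.aemeasurable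
  · filter_upwards [(gauss_absolutelyContinuous ht).ae_le (ae_tendsto_mollify hF)] with x hx
    exact ENNReal.tendsto_ofReal (tendsto_bregman hmean_pos hmean (hx.add_const δ))
  · obtain ⟨C, M, hn⟩ := nicePair_mollify (bumpSeq d k) hF hG h0 hw δ
    refine (hn.lintegral_bregman_le hδ ht.le).trans (ENNReal.ofReal_le_ofReal ?_)
    gcongr
    refine le_trans ?_ (integral_gauss_mollify_le (bumpSeq d k) ht hQv hQ0 hQR)
    exact integral_mono (hn.integrable_fisher hδ _) ((integrable_mollify _ hQv).gauss ht)
      fun x => fisher_mollify_le _ hF hG h0 hz hQv hδ x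

end CompactlySupported

/-! ### The Gaussian log-Sobolev inequality in full. -/

section GaussianLSI

variable {d : ℕ}

/-- Smooth cutoff functions. -/
lemma exists_cutoff (d : ℕ) : ∃ χ : ℕ → E d → ℝ, (∀ n, ContDiff ℝ ∞ (χ n)) ∧
    (∀ n, HasCompactSupport (χ n)) ∧ (∀ n x, 0 ≤ χ n x) ∧ (∀ n x, χ n x ≤ 1) ∧
    (∀ x, Tendsto (fun n => χ n x) atTop (𝓝 1)) ∧
    ∃ B : ℝ, 0 ≤ B ∧ ∀ n x, ‖∇ (χ n) x‖ ≤ B * (1 / ((n : ℝ) + 1)) := by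
  let ψ : ContDiffBump (0 : E d) := ⟨1, 2, one_pos, one_lt_two⟩
  have hψ : ContDiff ℝ ∞ ψ := ψ.contDiff
  obtain ⟨B, hB⟩ := (ψ.hasCompactSupport.fderiv (𝕜 := ℝ)).exists_bound_of_continuous
    (hψ.continuous_fderiv (by simp))
  have hlim : Tendsto (fun n : ℕ => 1 / ((n : ℝ) + 1)) atTop (𝓝 0) :=
    tendsto_one_div_add_atTop_nhds_zero_nat
  refine ⟨fun n x => ψ ((1 / ((n : ℝ) + 1)) • x), fun n => by fun_prop, fun n => ?_,
    fun n x => ψ.nonneg, fun n x => ψ.le_one, fun x => ?_, B, (norm_nonneg _).trans (hB 0),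
    fun n x => ?_⟩
  · exact ψ.hasCompactSupport.comp_homeomorph (Homeomorph.smulOfNeZero (1 / ((n : ℝ) + 1))
      (by positivity))
  · have h1 : Tendsto (fun n : ℕ => (1 / ((n : ℝ) + 1)) • x) atTop (𝓝 0) := by
      simpa using hlim.smul_const x
    have h2 : ψ (0 : E d) = 1 := ψ.one_of_mem_closedBall (by simp [ψ])
    simpa [h2, Function.comp_def] using (ψ.continuous.tendsto 0).comp h1
  · have h1 : HasFDerivAt (fun x : E d => (1 / ((n : ℝ) + 1)) • x)
        ((1 / ((n : ℝ) + 1)) • ContinuousLinearMap.id ℝ (E d)) x :=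
      (hasFDerivAt_id x).fun_const_smul _
    have h2 := ((hψ.differentiable (by simp) _).hasFDerivAt.comp x h1).fderiv
    simp only [Function.comp_def] at h2
    rw [gradient, LinearIsometryEquiv.norm_map, h2, ContinuousLinearMap.comp_smul,
      ContinuousLinearMap.comp_id, norm_smul, Real.norm_of_nonneg (by positivity), mul_comm]
    gcongr
    exact hB _

lemma norm_add_sq_le_weighted (θ : ℝ) (hθ : 0 < θ) (v w : E d) :
    ‖v + w‖ ^ 2 ≤ (1 + θ) * ‖v‖ ^ 2 + (1 + 1 / θ) * ‖w‖ ^ 2 := by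
  have h1 : ‖v + w‖ ^ 2 ≤ (‖v‖ + ‖w‖) ^ 2 := by gcongr; exact norm_add_le _ _
  have h2 : (1 + θ) * ‖v‖ ^ 2 + (1 + 1 / θ) * ‖w‖ ^ 2 - (‖v‖ + ‖w‖) ^ 2 =
      (θ * ‖v‖ - ‖w‖) ^ 2 / θ := by
    field_simp
    ring
  have : 0 ≤ (θ * ‖v‖ - ‖w‖) ^ 2 / θ := by positivity
  linarith

/-- The Gaussian logarithmic Sobolev inequality for weakly differentiable functions. -/
theorem lintegral_bregman_le_gauss {t : ℝ} (ht : 0 < t) {f : E d → ℝ} {g : E d → E d}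
    (hf : Measurable f) (h0 : ∀ x, 0 ≤ f x) (hint : Integrable f (gauss d t))
    (hmass : 0 < ∫ x, f x ∂gauss d t) (hw : HasWeakGradient f g) :
    ∫⁻ x, ENNReal.ofReal (bregman (∫ y, f y ∂gauss d t) (f x)) ∂gauss d t ≤
      ENNReal.ofReal (t / 2) * ∫⁻ x, ENNReal.ofReal (‖g x‖ ^ 2 / f x) ∂gauss d t := by
  -- The quotient ‖g‖²/f is 0 where f = 0, whatever g is, so the claimed bound is legitimate only
  -- because g may be replaced there by 0 and remain a weak gradient.
  wlog hz : ∀ x, f x = 0 → g x = 0 generalizing g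
  · refine (this (hw.indicator hf h0) fun x hx => by simp [hx]).trans (le_of_eq ?_)
    congr 1
    refine lintegral_congr fun x => ?_
    by_cases hx : f x = 0 <;> simp [hx]
  obtain ⟨χ, hχs, hχc, hχ0, hχ1, hχlim, B, hB0, hB⟩ := exists_cutoff d
  -- θ n has three roles: size of the cutoff gradient, weight in the Young inequality, and positive
  -- shift δ. The error (1 + 1/θ)·4(Bθ)² = 4B²(θ² + θ) tends to 0.
  set θ : ℕ → ℝ := fun n => 1 / ((n : ℝ) + 1)
  have hθ : ∀ n, 0 < θ n := fun n => by positivity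
  have hθlim : Tendsto θ atTop (𝓝 0) := tendsto_one_div_add_atTop_nhds_zero_nat
  -- Squaring the cutoff gives ∇η = 2χ∇χ, so ‖∇η‖²/η = 4‖∇χ‖² stays bounded where η is small.
  set η : ℕ → E d → ℝ := fun n x => χ n x * χ n x
  have hηs : ∀ n, ContDiff ℝ ∞ (η n) := fun n => (hχs n).mul (hχs n)
  have hηc : ∀ n, HasCompactSupport (η n) := fun n => (hχc n).mul_left
  have hη0 : ∀ n x, 0 ≤ η n x := fun n x => mul_self_nonneg _
  have hη1 : ∀ n x, η n x ≤ 1 := fun n x => mul_le_one₀ (hχ1 n x) (hχ0 n x) (hχ1 n x)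
  have hηlim : ∀ x, Tendsto (fun n => η n x) atTop (𝓝 1) := fun x => by
    simpa using (hχlim x).mul (hχlim x)
  have hgradη : ∀ n x, ∇ (η n) x = (2 * χ n x) • ∇ (χ n) x := fun n x => by
    have hd := (hχs n).differentiable (by simp) x
    rw [gradient, gradient, fderiv_fun_mul hd hd, ← two_smul ℝ, smul_smul, map_smul]
  set J := ∫⁻ x, ENNReal.ofReal (‖g x‖ ^ 2 / f x) ∂gauss d t
  set I := ∫ x, f x ∂gauss d t
  have hFint : ∀ n, Integrable (fun x => η n x * f x) (volume : Measure (E d)) := fun n =>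
    hw.1.integrable_smul_left_of_hasCompactSupport (hηs n).continuous (hηc n)
  have cgrad : ∀ n, Continuous (∇ (η n)) := fun n =>
    (LinearIsometryEquiv.continuous _).comp ((hηs n).continuous_fderiv (by simp))
  have cgradc : ∀ n, HasCompactSupport (∇ (η n)) := fun n =>
    ((hηc n).fderiv (𝕜 := ℝ)).comp_left (g := (InnerProductSpace.toDual ℝ (E d)).symm) (map_zero _)
  have hGint : ∀ n, Integrable (fun x => η n x • g x + f x • ∇ (η n) x)
      (volume : Measure (E d)) := fun n =>
    (hw.2.1.integrable_smul_left_of_hasCompactSupport (hηs n).continuous (hηc n)).add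
      (hw.1.integrable_smul_right_of_hasCompactSupport (cgrad n) (cgradc n))
  have fisher : ∀ n, ∫⁻ x, ENNReal.ofReal
      (‖η n x • g x + f x • ∇ (η n) x‖ ^ 2 / (η n x * f x)) ∂gauss d t ≤
      ENNReal.ofReal (1 + θ n) * J
        + ENNReal.ofReal ((1 + 1 / θ n) * (4 * (B * θ n) ^ 2) * I) := fun n => by
    have pt : ∀ x, ‖η n x • g x + f x • ∇ (η n) x‖ ^ 2 / (η n x * f x) ≤
        (1 + θ n) * (‖g x‖ ^ 2 / f x) + (1 + 1 / θ n) * (4 * (B * θ n) ^ 2) * f x := fun x => by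
      have hr0 : 0 ≤ (1 + θ n) * (‖g x‖ ^ 2 / f x)
          + (1 + 1 / θ n) * (4 * (B * θ n) ^ 2) * f x := by
        have := h0 x; have := hθ n; positivity
      rcases (hχ0 n x).eq_or_lt with hc | hc
      · simpa [η, ← hc] using hr0
      rcases (h0 x).eq_or_lt with hx | hx
      · simp [← hx]
      rw [hgradη]
      have e : η n x • g x + f x • (2 * χ n x) • ∇ (χ n) x =
          χ n x • (χ n x • g x + (2 * f x) • ∇ (χ n) x) := by
        simp only [η, smul_add, smul_smul]
        ring_nf
      rw [e, norm_smul, Real.norm_of_nonneg hc.le, mul_pow]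
      have e2 : χ n x ^ 2 * ‖χ n x • g x + (2 * f x) • ∇ (χ n) x‖ ^ 2 / (η n x * f x) =
          ‖χ n x • g x + (2 * f x) • ∇ (χ n) x‖ ^ 2 / f x := by
        simp only [η]
        field_simp
      rw [e2, div_le_iff₀ hx]
      have h3 := norm_add_sq_le_weighted (θ n) (hθ n) (χ n x • g x) ((2 * f x) • ∇ (χ n) x)
      have h4 : ‖χ n x • g x‖ ^ 2 ≤ ‖g x‖ ^ 2 := by
        rw [norm_smul, Real.norm_of_nonneg hc.le]
        gcongr
        exact mul_le_of_le_one_left (norm_nonneg _) (hχ1 n x)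
      have h5 : ‖(2 * f x) • ∇ (χ n) x‖ ^ 2 ≤ 4 * (B * θ n) ^ 2 * f x * f x := by
        rw [norm_smul, Real.norm_of_nonneg (by positivity)]
        calc (2 * f x * ‖∇ (χ n) x‖) ^ 2 ≤ (2 * f x * (B * θ n)) ^ 2 := by
              gcongr; exact hB n x
          _ = _ := by ring
      have hθ1 : 0 ≤ 1 + θ n := by linarith [hθ n]
      have hθ2 : 0 ≤ 1 + 1 / θ n := by have := hθ n; positivity
      have e3 : ((1 + θ n) * (‖g x‖ ^ 2 / f x)
          + (1 + 1 / θ n) * (4 * (B * θ n) ^ 2) * f x) * f x =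
          (1 + θ n) * ‖g x‖ ^ 2 + (1 + 1 / θ n) * (4 * (B * θ n) ^ 2 * f x * f x) := by
        field_simp
      rw [e3]
      exact h3.trans (add_le_add (mul_le_mul_of_nonneg_left h4 hθ1)
        (mul_le_mul_of_nonneg_left h5 hθ2))
    have hθ1 : 0 ≤ 1 + θ n := by linarith [hθ n]
    have hθ2 : 0 ≤ (1 + 1 / θ n) * (4 * (B * θ n) ^ 2) := by have := hθ n; positivity
    calc _ ≤ ∫⁻ x, (ENNReal.ofReal (1 + θ n) * ENNReal.ofReal (‖g x‖ ^ 2 / f x)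
          + ENNReal.ofReal ((1 + 1 / θ n) * (4 * (B * θ n) ^ 2)) * ENNReal.ofReal (f x))
            ∂gauss d t := by
          refine lintegral_mono fun x => ?_
          rw [← ENNReal.ofReal_mul hθ1, ← ENNReal.ofReal_mul hθ2,
            ← ENNReal.ofReal_add (mul_nonneg hθ1 (div_nonneg (sq_nonneg _) (h0 x)))
              (mul_nonneg hθ2 (h0 x))]
          exact ENNReal.ofReal_le_ofReal (pt x)
      _ = _ := by
          rw [lintegral_add_right _ (by fun_prop), lintegral_const_mul' _ _ ENNReal.ofReal_ne_top,
            lintegral_const_mul' _ _ ENNReal.ofReal_ne_top,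
            ← ofReal_integral_eq_lintegral_ofReal hint (.of_forall h0),
            ← ENNReal.ofReal_mul hθ2]
  have hmean : Tendsto (fun n => ∫ y, (η n y * f y + θ n) ∂gauss d t) atTop (𝓝 I) := by
    have h1 : Tendsto (fun n => ∫ y, η n y * f y ∂gauss d t) atTop (𝓝 I) := by
      refine tendsto_integral_of_dominated_convergence f
        (fun n => ((hηs n).continuous.measurable.mul hf).aestronglyMeasurable) hint
        (fun n => .of_forall fun x => ?_) (.of_forall fun x => ?_)
      · rw [Real.norm_of_nonneg (mul_nonneg (hη0 n x) (h0 x))]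
        exact mul_le_of_le_one_left (h0 x) (hη1 n x)
      · simpa using (hηlim x).mul_const (f x)
    have h2 : ∀ n, ∫ y, (η n y * f y + θ n) ∂gauss d t = (∫ y, η n y * f y ∂gauss d t) + θ n :=
      fun n => by
        rw [integral_add ((hFint n).gauss ht) (integrable_const _)]; simp
    simp_rw [h2]
    simpa using h1.add hθlim
  have hb : Tendsto (fun n => ENNReal.ofReal (t / 2) * (ENNReal.ofReal (1 + θ n) * J
        + ENNReal.ofReal ((1 + 1 / θ n) * (4 * (B * θ n) ^ 2) * I))) atTop
      (𝓝 (ENNReal.ofReal (t / 2) * J)) := by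
    refine ENNReal.Tendsto.const_mul ?_ (.inr ENNReal.ofReal_ne_top)
    have h1 : Tendsto (fun n => ENNReal.ofReal (1 + θ n) * J) atTop (𝓝 J) := by
      have : Tendsto (fun n => ENNReal.ofReal (1 + θ n)) atTop (𝓝 1) := by
        simpa using ENNReal.tendsto_ofReal (hθlim.const_add 1)
      simpa using ENNReal.Tendsto.mul_const this (.inl one_ne_zero)
    have h2 : Tendsto (fun n => ENNReal.ofReal ((1 + 1 / θ n) * (4 * (B * θ n) ^ 2) * I)) atTop
        (𝓝 0) := by
      have e : ∀ n, (1 + 1 / θ n) * (4 * (B * θ n) ^ 2) * I =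
          4 * B ^ 2 * I * (θ n ^ 2 + θ n) := fun n => by
        have := hθ n
        field_simp
      simp_rw [e]
      have := ((hθlim.pow 2).add hθlim).const_mul (4 * B ^ 2 * I)
      simpa using ENNReal.tendsto_ofReal this
    simpa using h1.add h2
  refine lintegral_le_of_tendsto_ae (fun n => ?_) (.of_forall fun x => ?_) hb (fun n => ?_)
    (u := fun n x => ENNReal.ofReal
      (bregman (∫ y, (η n y * f y + θ n) ∂gauss d t) (η n x * f x + θ n)))
  · exact ((continuous_bregman _).measurable.comp
      (((hηs n).continuous.measurable.mul hf).add_const _)).ennreal_ofReal.aemeasurable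
  · refine ENNReal.tendsto_ofReal (tendsto_bregman hmass.ne' hmean ?_)
    simpa using ((hηlim x).mul_const (f x)).add hθlim
  · obtain ⟨R, hR⟩ := (hηc n).isBounded.subset_closedBall 0
    refine (lintegral_bregman_le_of_hasCompactSupport ht (hθ n) (hFint n) (hGint n)
      (fun x => mul_nonneg (hη0 n x) (h0 x)) (hw.hasWeakDeriv_mul (hηs n) (hηc n))
      (fun x hx => ?_) (R := R) fun x hx => ?_).trans (by gcongr; exact fisher n)
    · rcases mul_eq_zero.1 hx with hx | hx
      · have : χ n x = 0 := by simpa [η] using hx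
        simp [hx, hgradη, this]
      · simp [hx, hz x hx]
    · have := hR (subset_tsupport _ (left_ne_zero_of_mul hx))
      simpa using this

end GaussianLSI

/-! ### Holley–Stroock perturbation. -/

section Perturbation

open InformationTheory

variable {d : ℕ}

/-- For a function of mean one, the relative entropy minimizes `c ↦ ∫ bregman c f`. -/
lemma lintegral_klFun_le_bregman {α : Type*} [MeasurableSpace α] {ν : Measure α}
    [IsProbabilityMeasure ν] {f : α → ℝ} (hf : Integrable f ν) (h0 : ∀ x, 0 ≤ f x)
    (h1 : ∫ x, f x ∂ν = 1) {c : ℝ} (hc : 0 < c) :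
    ∫⁻ x, ENNReal.ofReal (klFun (f x)) ∂ν ≤ ∫⁻ x, ENNReal.ofReal (bregman c (f x)) ∂ν := by
  by_cases htop : ∫⁻ x, ENNReal.ofReal (bregman c (f x)) ∂ν = ⊤
  · rw [htop]; exact le_top
  have hb0 : ∀ x, 0 ≤ bregman c (f x) := fun x => bregman_nonneg hc (h0 x)
  have J : Integrable (fun x => bregman c (f x)) ν :=
    (lintegral_ofReal_ne_top_iff_integrable ((continuous_bregman c).comp_aestronglyMeasurable hf.1)
      (.of_forall hb0)).1 htop
  have e : ∀ x, klFun (f x) = bregman c (f x) + f x * Real.log c + (1 - c) := fun x => by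
    rw [klFun_apply, bregman]; ring
  have J1 : Integrable (fun x => bregman c (f x) + f x * Real.log c) ν := J.add (hf.mul_const _)
  have J2 : Integrable (fun x => klFun (f x)) ν := by
    simp_rw [e]
    exact J1.add (integrable_const _)
  rw [← ofReal_integral_eq_lintegral_ofReal J (.of_forall hb0),
    ← ofReal_integral_eq_lintegral_ofReal J2 (.of_forall fun x => klFun_nonneg (h0 x))]
  refine ENNReal.ofReal_le_ofReal ?_
  simp_rw [e]
  rw [integral_add J1 (integrable_const _), integral_add J (hf.mul_const _), integral_mul_const, h1]
  have := Real.log_le_sub_one_of_pos hc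
  simp only [integral_const, probReal_univ, smul_eq_mul, one_mul]
  linarith

lemma lintegral_norm_sq_gauss_lt_top (t : ℝ) : ∫⁻ x, ‖x‖ₑ ^ 2 ∂gauss d t < ⊤ := by
  rw [gauss, lintegral_map (by fun_prop) (by fun_prop)]
  have h := (integrable_norm_pow_stdGaussian (d := d) 2).2
  rw [HasFiniteIntegral] at h
  simp_rw [enorm_smul, mul_pow]
  rw [lintegral_const_mul' _ _ (by finiteness)]
  refine ENNReal.mul_lt_top (by finiteness) (lt_of_le_of_lt (le_of_eq ?_) h)
  refine lintegral_congr fun x => ?_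
  rw [enorm_pow, enorm_norm]

/-- Holley–Stroock perturbation of the Gaussian logarithmic Sobolev inequality. -/
lemma satisfiesLSI_gauss_tilted {t B m : ℝ} (ht : 0 < t) {w : E d → ℝ} (hw : Continuous w)
    (hB : ∀ x, |w x - m| ≤ B) :
    SatisfiesLSI ((gauss d t).tilted w) (1 / t * Real.exp (-(2 * B))) := by
  have hlow : ∀ x, m - B ≤ w x := fun x => by linarith [neg_le_of_abs_le (hB x)]
  have hup : ∀ x, w x ≤ m + B := fun x => by linarith [le_of_abs_le (hB x)]
  have hexp : Integrable (fun x => Real.exp (w x)) (gauss d t) :=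
    .of_bound (C := Real.exp (m + B)) (by fun_prop) (.of_forall fun x => by
      rw [Real.norm_of_nonneg (Real.exp_pos _).le]; exact Real.exp_le_exp.2 (hup x))
  set ν := (gauss d t).tilted w with hν
  have hprob : IsProbabilityMeasure ν := isProbabilityMeasure_tilted hexp
  set N := ∫ x, Real.exp (w x) ∂gauss d t
  have hN : 0 < N := integral_exp_pos hexp
  set up := Real.exp (m + B) / N
  set lo := Real.exp (m - B) / N
  have hup0 : 0 < up := by positivity
  have hlo0 : 0 < lo := by positivity
  -- The density of ν with respect to the Gaussian lies between `lo` and `up`, whose ratio is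
  -- exp(2B); the normalization N cancels in it.
  have le_up : ∀ u : E d → ℝ≥0∞, ∫⁻ x, u x ∂ν ≤ ENNReal.ofReal up * ∫⁻ x, u x ∂gauss d t :=
    fun u => by
      rw [hν, lintegral_tilted, ← lintegral_const_mul' _ _ ENNReal.ofReal_ne_top]
      refine lintegral_mono fun x => ?_
      gcongr
      simp only [up]
      gcongr
      exact hup x
  have lo_le : ∀ u : E d → ℝ≥0∞, ENNReal.ofReal lo * ∫⁻ x, u x ∂gauss d t ≤ ∫⁻ x, u x ∂ν :=
    fun u => by
      rw [hν, lintegral_tilted, ← lintegral_const_mul' _ _ ENNReal.ofReal_ne_top]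
      refine lintegral_mono fun x => ?_
      gcongr
      simp only [lo]
      gcongr
      exact hlow x
  have hνγ : ν ≪ gauss d t := tilted_absolutelyContinuous _ _
  have hγν : gauss d t ≪ ν := absolutelyContinuous_tilted hexp
  have hνvol : ν ≪ volume := hνγ.trans (gauss_absolutelyContinuous ht)
  refine ⟨⟨⟨hprob, (le_up _).trans_lt
    (ENNReal.mul_lt_top ENNReal.ofReal_lt_top (lintegral_norm_sq_gauss_lt_top t))⟩, hνvol⟩,
    by positivity, fun μ hμ hμν => ?_⟩
  have hμp : IsProbabilityMeasure μ := hμ.1.1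
  set ρ := 1 / t * Real.exp (-(2 * B))
  have hρ : 0 < ρ := by positivity
  set f := fun x => (μ.rnDeriv ν x).toReal
  have hfm : Measurable f := (Measure.measurable_rnDeriv μ ν).ennreal_toReal
  have hf0 : ∀ x, 0 ≤ f x := fun x => ENNReal.toReal_nonneg
  have hfν : Integrable f ν := Measure.integrable_toReal_rnDeriv
  have hf1 : ∫ x, f x ∂ν = 1 := by
    rw [Measure.integral_toReal_rnDeriv hμν]; simp
  have hfγ : Integrable f (gauss d t) := by
    refine (lintegral_ofReal_ne_top_iff_integrable hfm.aestronglyMeasurable (.of_forall hf0)).1 ?_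
    intro htop
    have h1 := lo_le fun x => ENNReal.ofReal (f x)
    rw [htop, ENNReal.mul_top (by simpa using hlo0),
      ← ofReal_integral_eq_lintegral_ofReal hfν (.of_forall hf0)] at h1
    simp at h1
  have hmass : 0 < ∫ x, f x ∂gauss d t := by
    refine lt_of_le_of_ne (integral_nonneg hf0) fun h => ?_
    have h2 := (integral_eq_zero_iff_of_nonneg hf0 hfγ).1 h.symm
    rw [integral_eq_zero_of_ae (hνγ.ae_le h2)] at hf1
    exact zero_ne_one hf1
  rw [klDiv_eq_lintegral_klFun_of_ac hμν, relFisher,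
    ENNReal.mul_iInf_of_ne (by simpa using hρ) ENNReal.ofReal_ne_top]
  refine le_iInf fun g => ?_
  rw [ENNReal.mul_iInf_of_ne (by simpa using hρ) ENNReal.ofReal_ne_top]
  refine le_iInf fun hg => ?_
  have hgm : AEMeasurable g ν := (hg.2.1.aestronglyMeasurable.mono_ac hνvol).aemeasurable
  -- Both sides vanish where f = 0 because of the conventions for inverse and division; elsewhere f
  -- · ‖f⁻¹ g‖² = ‖g‖²/f.
  have fisher_eq : ∫⁻ x, ‖(f x)⁻¹ • g x‖ₑ ^ 2 ∂μ =
      ∫⁻ x, ENNReal.ofReal (‖g x‖ ^ 2 / f x) ∂ν := by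
    have hm : AEMeasurable (fun x => ‖(f x)⁻¹ • g x‖ₑ ^ 2) ν := by fun_prop
    have hdec : μ.HaveLebesgueDecomposition ν :=
      Measure.haveLebesgueDecomposition_of_sigmaFinite μ ν
    rw [← lintegral_rnDeriv_mul hμν hm]
    refine lintegral_congr_ae ?_
    filter_upwards [μ.rnDeriv_lt_top ν] with x hx
    rw [← ENNReal.ofReal_toReal hx.ne, ← ofReal_norm,
      ← ENNReal.ofReal_pow (norm_nonneg _), ← ENNReal.ofReal_mul ENNReal.toReal_nonneg]
    congr 1
    change f x * _ = _
    rw [norm_smul, norm_inv, Real.norm_of_nonneg (hf0 x)]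
    rcases (hf0 x).eq_or_lt with h | h
    · simp [← h]
    · field_simp
  change _ ≤ _ * ∫⁻ x, ‖(f x)⁻¹ • g x‖ₑ ^ 2 ∂μ
  rw [fisher_eq]
  set X := ∫⁻ x, ENNReal.ofReal (‖g x‖ ^ 2 / f x) ∂gauss d t
  have const_eq : ENNReal.ofReal up * ENNReal.ofReal (t / 2) =
      ENNReal.ofReal (1 / (2 * ρ)) * ENNReal.ofReal lo := by
    rw [← ENNReal.ofReal_mul hup0.le, ← ENNReal.ofReal_mul (by positivity)]
    congr 1
    have e : Real.exp (m + B) = Real.exp (m - B) * Real.exp (2 * B) := by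
      rw [← Real.exp_add]; ring_nf
    simp only [up, lo, ρ, e, Real.exp_neg]
    field_simp
  -- The relative entropy is first bounded by the Bregman integral referred to the Gaussian mean of
  -- f. Its integrand is pointwise nonnegative and no longer involves ν, so the two measures can be
  -- compared under the integral.
  calc ∫⁻ x, ENNReal.ofReal (klFun (f x)) ∂ν
      ≤ ∫⁻ x, ENNReal.ofReal (bregman (∫ y, f y ∂gauss d t) (f x)) ∂ν :=
        lintegral_klFun_le_bregman hfν hf0 hf1 hmass
    _ ≤ ENNReal.ofReal up *
          ∫⁻ x, ENNReal.ofReal (bregman (∫ y, f y ∂gauss d t) (f x)) ∂gauss d t := le_up _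
    _ ≤ ENNReal.ofReal up * (ENNReal.ofReal (t / 2) * X) := by
        gcongr
        exact lintegral_bregman_le_gauss ht hfm hf0 hfγ hmass hg
    _ = ENNReal.ofReal (1 / (2 * ρ)) * (ENNReal.ofReal lo * X) := by
        rw [← mul_assoc, const_eq, mul_assoc]
    _ ≤ _ := by
        gcongr
        exact lo_le _

/-- A bounded perturbation of a quadratic potential satisfies a logarithmic Sobolev inequality. -/
theorem satisfiesLSI_tilted {lam τ B c : ℝ} (hlam : 0 < lam) (hτ : 0 < τ) {W : E d → ℝ}
    (hW : Continuous W) (hB : ∀ x, |W x| ≤ B) :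
    Integrable (fun x => Real.exp (-(W x + lam / 2 * ‖x‖ ^ 2 + c) / τ)) volume ∧
      SatisfiesLSI (volume.tilted fun x => -(W x + lam / 2 * ‖x‖ ^ 2 + c) / τ)
        (lam / τ * Real.exp (-2 * B / τ)) := by
  -- With variance τ/λ the quadratic part of the potential is exactly Gaussian. The remaining
  -- exponent stays within B/τ of -c/τ, so the additive constant c does not affect the LSI constant.
  have ht : 0 < τ / lam := by positivity
  have hq := integrable_exp_neg_mul_sq_norm (d := d) (b := 1 / (2 * (τ / lam))) (by positivity)
  have e : (fun x => -(W x + lam / 2 * ‖x‖ ^ 2 + c) / τ) =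
      (fun x : E d => -((1 / (2 * (τ / lam))) * ‖x‖ ^ 2)) + fun x => -(W x + c) / τ := by
    ext x
    simp only [Pi.add_apply]
    field_simp
    ring
  have hle : ∀ x, |-(W x + c) / τ - -c / τ| ≤ B / τ := fun x => by
    rw [← sub_div, abs_div, abs_of_pos hτ]
    gcongr
    have : -(W x + c) - -c = -W x := by ring
    rw [this, abs_neg]
    exact hB x
  constructor
  · have h1 : ∀ x, Real.exp (-(W x + lam / 2 * ‖x‖ ^ 2 + c) / τ) =
        Real.exp (-(W x + c) / τ) * Real.exp (-((1 / (2 * (τ / lam))) * ‖x‖ ^ 2)) := fun x => by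
      rw [congrFun e x, Pi.add_apply, Real.exp_add, mul_comm]
    simp_rw [h1]
    refine hq.bdd_mul (c := Real.exp (-c / τ + B / τ))
      (by fun_prop : Continuous fun x => Real.exp (-(W x + c) / τ)).aestronglyMeasurable
      (.of_forall fun x => ?_)
    rw [Real.norm_of_nonneg (Real.exp_pos _).le]
    exact Real.exp_le_exp.2 (by linarith [le_of_abs_le (hle x)])
  · rw [e, ← tilted_tilted hq, ← gauss_eq_tilted ht]
    have := satisfiesLSI_gauss_tilted ht (w := fun x => -(W x + c) / τ) (by fun_prop) hle
    convert this using 2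
    · field_simp
    · ring_nf

end Perturbation

/-! ### The square and logistic losses. -/

section Loss

/-- The properties of a loss `ℓ`, with derivative `ℓ'` in the second variable, used below. -/
structure IsLoss (ℓ ℓ' : ℝ → ℝ → ℝ) : Prop where
  hasDerivAt : ∀ y u, HasDerivAt (ℓ y) (ℓ' y u) u
  bound : ∀ y u, |ℓ' y u| ≤ |y| + |u|
  lip : ∀ y u v, |ℓ' y u - ℓ' y v| ≤ (1 + y ^ 2) * |u - v|
  nonneg : ∀ y u, 0 ≤ ℓ y u
  zero_le : ∀ y, ℓ y 0 ≤ 1 + y ^ 2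
  convex : ∀ y, ConvexOn ℝ Set.univ (ℓ y)
  continuous : Continuous (Function.uncurry ℓ)
  continuous_deriv : Continuous (Function.uncurry ℓ')

lemma isLoss_square : IsLoss squareLoss (fun y u => u - y) where
  hasDerivAt y u := by
    have h : HasDerivAt (fun u : ℝ => 1 / 2 * (y - u) ^ 2) (1 / 2 * (2 * (y - u) ^ 1 * (-1))) u :=
      (((hasDerivAt_id u).const_sub y).pow 2).const_mul (1 / 2)
    have e : squareLoss y = fun u : ℝ => 1 / 2 * (y - u) ^ 2 := by
      ext u; simp [squareLoss]
    rw [e]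
    convert h using 1
    ring
  bound y u := by simpa [add_comm] using abs_sub u y
  lip y u v := by
    rw [sub_sub_sub_cancel_right]
    exact le_mul_of_one_le_left (abs_nonneg _) (by nlinarith [sq_nonneg y])
  nonneg y u := by unfold squareLoss; positivity
  zero_le y := by
    simp only [squareLoss, sub_zero, sq_abs]
    nlinarith [sq_nonneg y]
  convex y := by
    have e : squareLoss y = fun u : ℝ => 1 / 2 * (y - u) ^ 2 := by
      ext u; simp [squareLoss]
    rw [e]
    refine ⟨convex_univ, fun a _ b _ s t hs ht hst => ?_⟩
    simp only [smul_eq_mul]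
    obtain rfl : t = 1 - s := by linarith
    nlinarith [mul_nonneg (mul_nonneg hs ht) (sq_nonneg (a - b))]
  continuous := by
    simp only [Function.uncurry_def, squareLoss]
    fun_prop
  continuous_deriv := by
    simp only [Function.uncurry_def]
    fun_prop

lemma hasDerivAt_logisticLoss (y u : ℝ) :
    HasDerivAt (logisticLoss y) (-y / (1 + Real.exp (y * u))) u := by
  have h1 : HasDerivAt (fun u : ℝ => 1 + Real.exp (-(y * u))) (Real.exp (-(y * u)) * -(y * 1)) u :=
    ((((hasDerivAt_id u).const_mul y).neg).exp).const_add 1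
  have h2 := h1.log (by positivity)
  have e : -y / (1 + Real.exp (y * u)) =
      Real.exp (-(y * u)) * -(y * 1) / (1 + Real.exp (-(y * u))) := by
    rw [Real.exp_neg]
    field_simp
    ring
  rw [e]
  exact h2

lemma abs_logistic_deriv_le (y u : ℝ) : |-y / (1 + Real.exp (y * u))| ≤ |y| := by
  rw [abs_div, abs_neg, abs_of_pos (by positivity : 0 < 1 + Real.exp (y * u))]
  exact div_le_self (abs_nonneg _) (by linarith [Real.exp_pos (y * u)])

lemma hasDerivAt_logistic_deriv (y u : ℝ) : HasDerivAt (fun u => -y / (1 + Real.exp (y * u)))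
    (y ^ 2 * Real.exp (y * u) / (1 + Real.exp (y * u)) ^ 2) u := by
  have h1 : HasDerivAt (fun u : ℝ => 1 + Real.exp (y * u)) (Real.exp (y * u) * (y * 1)) u :=
    (((hasDerivAt_id u).const_mul y).exp).const_add 1
  have h2 := (hasDerivAt_const u (-y)).fun_div h1 (by positivity)
  have e : y ^ 2 * Real.exp (y * u) / (1 + Real.exp (y * u)) ^ 2 =
      (0 * (1 + Real.exp (y * u)) - -y * (Real.exp (y * u) * (y * 1))) /
        (1 + Real.exp (y * u)) ^ 2 := by
    ring
  rw [e]
  exact h2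

lemma isLoss_logistic : IsLoss logisticLoss (fun y u => -y / (1 + Real.exp (y * u))) where
  hasDerivAt := hasDerivAt_logisticLoss
  bound y u := (abs_logistic_deriv_le y u).trans (by linarith [abs_nonneg u])
  lip y u v := by
    refine (convex_univ.norm_image_sub_le_of_norm_hasDerivWithin_le
      (fun x _ => (hasDerivAt_logistic_deriv y x).hasDerivWithinAt) (fun x _ => ?_)
      (Set.mem_univ v) (Set.mem_univ u))
    rw [Real.norm_of_nonneg (by positivity), div_le_iff₀ (by positivity)]
    have := Real.exp_pos (y * x)
    nlinarith [mul_nonneg (sq_nonneg y) this.le, mul_nonneg (sq_nonneg y) (sq_nonneg (Real.exp (y * x))),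
      sq_nonneg y, sq_nonneg (Real.exp (y * x))]
  nonneg y u := Real.log_nonneg (by linarith [Real.exp_pos (-(y * u))])
  zero_le y := by
    have := Real.log_le_sub_one_of_pos (by norm_num : (0 : ℝ) < 1 + 1)
    simp only [logisticLoss, mul_zero, neg_zero, Real.exp_zero]
    nlinarith [sq_nonneg y]
  convex y := by
    refine Monotone.convexOn_univ_of_deriv
      (fun u => (hasDerivAt_logisticLoss y u).differentiableAt) ?_
    have e : deriv (logisticLoss y) = fun u => -y / (1 + Real.exp (y * u)) :=
      funext fun u => (hasDerivAt_logisticLoss y u).deriv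
    rw [e]
    refine monotone_of_deriv_nonneg
      (fun u => (hasDerivAt_logistic_deriv y u).differentiableAt) fun u => ?_
    rw [(hasDerivAt_logistic_deriv y u).deriv]
    positivity
  continuous := by
    simp only [Function.uncurry_def, logisticLoss]
    exact Continuous.log (by fun_prop) fun x => by positivity
  continuous_deriv := by
    simp only [Function.uncurry_def]
    exact Continuous.div (by fun_prop) (by fun_prop) fun x => by positivity

variable {ℓ ℓ' : ℝ → ℝ → ℝ}

lemma IsLoss.abs_sub_le (h : IsLoss ℓ ℓ') {K : ℝ} (y : ℝ) {u v : ℝ} (hu : |u| ≤ K) (hv : |v| ≤ K) :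
    |ℓ y u - ℓ y v| ≤ (|y| + K) * |u - v| := by
  refine (convex_Icc (-K) K).norm_image_sub_le_of_norm_hasDerivWithin_le
    (fun x _ => (h.hasDerivAt y x).hasDerivWithinAt) (fun x hx => ?_)
    (abs_le.1 hv) (abs_le.1 hu)
  exact (h.bound y x).trans (by gcongr; exact abs_le.2 hx)

/-- Subtracting the tangent line leaves a function of s whose derivative ℓ'(y,s) - ℓ'(y,u) is at
most (1 + y²)|v - u| between u and v. The factor 1 + y² is integrable, by the second moment of y. -/
lemma IsLoss.abs_taylor_le (h : IsLoss ℓ ℓ') (y u v : ℝ) :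
    |ℓ y v - ℓ y u - ℓ' y u * (v - u)| ≤ (1 + y ^ 2) * |v - u| ^ 2 := by
  have := (convex_closedBall u |v - u|).norm_image_sub_le_of_norm_hasDerivWithin_le
    (f := fun s => ℓ y s - ℓ' y u * s) (f' := fun s => ℓ' y s - ℓ' y u) (x := u) (y := v)
    (C := (1 + y ^ 2) * |v - u|)
    (fun x _ => by
      have := (h.hasDerivAt y x).sub ((hasDerivAt_id x).const_mul (ℓ' y u))
      rw [mul_one] at this
      exact this.hasDerivWithinAt)
    (fun x hx => (h.lip y x u).trans (by
      rw [Metric.mem_closedBall, Real.dist_eq] at hx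
      gcongr))
    (by simp) (by simp [Real.dist_eq])
  rw [Real.norm_eq_abs, Real.norm_eq_abs] at this
  calc _ = |ℓ y v - ℓ' y u * v - (ℓ y u - ℓ' y u * u)| := by ring_nf
    _ ≤ _ := this
    _ = _ := by ring

lemma IsLoss.le (h : IsLoss ℓ ℓ') {K : ℝ} (y : ℝ) {u : ℝ} (hu : |u| ≤ K) :
    ℓ y u ≤ 1 + y ^ 2 + (|y| + K) * K := by
  have hK : 0 ≤ K := (abs_nonneg _).trans hu
  have h1 := h.abs_sub_le y hu (by simpa using hK : |(0 : ℝ)| ≤ K)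
  have h2 : (|y| + K) * |u - 0| ≤ (|y| + K) * K := by rw [sub_zero]; gcongr
  linarith [le_abs_self (ℓ y u - ℓ y 0), h.zero_le y]

end Loss

/-! ### Convexity and first variation of the risk. -/

section Risk

variable {n d : ℕ}

/-- The standing assumptions on the data distribution and on the network. -/
structure IsNetwork (D : Measure (E n × ℝ)) (Φ : E n → E d → ℝ) (K : ℝ) : Prop where
  memLp : MemLp (fun p : E n × ℝ => p.2) 2 D
  continuous : Continuous (Function.uncurry Φ)
  pos : 0 < K
  bound : ∀ z x, |Φ z x| ≤ K

variable {D : Measure (E n × ℝ)} {Φ : E n → E d → ℝ} {K lam : ℝ} {ℓ ℓ' : ℝ → ℝ → ℝ}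

namespace IsNetwork

lemma integrable_sq [IsProbabilityMeasure D] (h : IsNetwork D Φ K) :
    Integrable (fun p : E n × ℝ => 1 + p.2 ^ 2) D :=
  (integrable_const 1).add h.memLp.integrable_sq

lemma integrable_abs [IsProbabilityMeasure D] (h : IsNetwork D Φ K) :
    Integrable (fun p : E n × ℝ => |p.2| + K) D :=
  ((h.memLp.integrable (by norm_num)).abs).add (integrable_const K)

lemma continuous_left (h : IsNetwork D Φ K) (x : E d) : Continuous fun z => Φ z x :=
  h.continuous.comp (by fun_prop : Continuous fun z : E n => (z, x))

lemma continuous_right (h : IsNetwork D Φ K) (z : E n) : Continuous (Φ z) :=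
  h.continuous.comp (by fun_prop : Continuous fun x : E d => (z, x))

lemma integrable_right (h : IsNetwork D Φ K) (z : E n) (μ : Measure (E d)) [IsFiniteMeasure μ] :
    Integrable (Φ z) μ :=
  .of_bound (C := K) (h.continuous_right z).aestronglyMeasurable (.of_forall (h.bound z))

lemma abs_output_le (h : IsNetwork D Φ K) (μ : Measure (E d)) [IsProbabilityMeasure μ] (z : E n) :
    |networkOutput Φ μ z| ≤ K := by
  simpa [networkOutput] using
    norm_integral_le_of_norm_le_const (μ := μ) (f := Φ z) (.of_forall (h.bound z))

lemma continuous_output (h : IsNetwork D Φ K) (μ : Measure (E d)) [IsProbabilityMeasure μ] :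
    Continuous (networkOutput Φ μ) :=
  continuous_of_dominated (bound := fun _ => K)
    (fun z => (h.continuous_right z).aestronglyMeasurable)
    (fun z => .of_forall (h.bound z)) (integrable_const K) (.of_forall h.continuous_left)

lemma continuous_loss (h : IsNetwork D Φ K) (hℓ : IsLoss ℓ ℓ') (μ : Measure (E d))
    [IsProbabilityMeasure μ] :
    Continuous fun p : E n × ℝ => ℓ p.2 (networkOutput Φ μ p.1) :=
  hℓ.continuous.comp (continuous_snd.prodMk ((h.continuous_output μ).comp continuous_fst))

lemma continuous_loss_deriv (h : IsNetwork D Φ K) (hℓ : IsLoss ℓ ℓ') (μ : Measure (E d))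
    [IsProbabilityMeasure μ] :
    Continuous fun p : E n × ℝ => ℓ' p.2 (networkOutput Φ μ p.1) :=
  hℓ.continuous_deriv.comp (continuous_snd.prodMk ((h.continuous_output μ).comp continuous_fst))

lemma abs_loss_deriv_le (h : IsNetwork D Φ K) (hℓ : IsLoss ℓ ℓ') (μ : Measure (E d))
    [IsProbabilityMeasure μ] (p : E n × ℝ) : |ℓ' p.2 (networkOutput Φ μ p.1)| ≤ |p.2| + K :=
  (hℓ.bound _ _).trans (by gcongr; exact h.abs_output_le μ _)

lemma integrable_loss [IsProbabilityMeasure D] (h : IsNetwork D Φ K) (hℓ : IsLoss ℓ ℓ')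
    (μ : Measure (E d)) [IsProbabilityMeasure μ] :
    Integrable (fun p : E n × ℝ => ℓ p.2 (networkOutput Φ μ p.1)) D := by
  refine (h.integrable_sq.add (h.integrable_abs.mul_const K)).mono'
    (h.continuous_loss hℓ μ).aestronglyMeasurable (.of_forall fun p => ?_)
  rw [Real.norm_of_nonneg (hℓ.nonneg _ _)]
  exact hℓ.le _ (h.abs_output_le μ _)

lemma integrable_loss_deriv [IsProbabilityMeasure D] (h : IsNetwork D Φ K) (hℓ : IsLoss ℓ ℓ')
    (μ : Measure (E d)) [IsProbabilityMeasure μ] :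
    Integrable (fun p : E n × ℝ => ℓ' p.2 (networkOutput Φ μ p.1)) D :=
  h.integrable_abs.mono' (h.continuous_loss_deriv hℓ μ).aestronglyMeasurable
    (.of_forall fun p => h.abs_loss_deriv_le hℓ μ p)

lemma integrable_loss_deriv_mul [IsProbabilityMeasure D] (h : IsNetwork D Φ K) (hℓ : IsLoss ℓ ℓ')
    (μ : Measure (E d)) [IsProbabilityMeasure μ] {ψ : E n → ℝ} (hψ : Continuous ψ) {B : ℝ}
    (hB : ∀ z, |ψ z| ≤ B) :
    Integrable (fun p : E n × ℝ => ℓ' p.2 (networkOutput Φ μ p.1) * ψ p.1) D :=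
  (h.integrable_loss_deriv hℓ μ).mul_bdd (c := B) (hψ.comp continuous_fst).aestronglyMeasurable
    (.of_forall fun _ => hB _)

end IsNetwork

lemma isProbabilityMeasure_mix {α : ℝ} (h0 : 0 ≤ α) (h1 : α ≤ 1) (μ ν : Measure (E d))
    [IsProbabilityMeasure μ] [IsProbabilityMeasure ν] : IsProbabilityMeasure (mix α μ ν) := by
  constructor
  rw [mix, Measure.add_apply, Measure.smul_apply, Measure.smul_apply, measure_univ, measure_univ,
    smul_eq_mul, smul_eq_mul, mul_one, mul_one, ← ENNReal.ofReal_add (by linarith) h0]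
  simp

lemma integral_mix {α : ℝ} (h0 : 0 ≤ α) (h1 : α ≤ 1) {μ ν : Measure (E d)} {u : E d → ℝ}
    (hμ : Integrable u μ) (hν : Integrable u ν) :
    ∫ x, u x ∂mix α μ ν = (1 - α) * ∫ x, u x ∂μ + α * ∫ x, u x ∂ν := by
  rw [mix, integral_add_measure (hμ.smul_measure ENNReal.ofReal_ne_top)
    (hν.smul_measure ENNReal.ofReal_ne_top), integral_smul_measure, integral_smul_measure,
    ENNReal.toReal_ofReal (by linarith), ENNReal.toReal_ofReal h0]
  rfl

lemma IsP2.integrable_norm_sq {μ : Measure (E d)} (h : IsP2 μ) :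
    Integrable (fun x => ‖x‖ ^ 2) μ := by
  refine ⟨by fun_prop, ?_⟩
  rw [HasFiniteIntegral]
  refine lt_of_le_of_lt (le_of_eq (lintegral_congr fun x => ?_)) h.2
  rw [enorm_pow, enorm_norm]

lemma output_mix (h : IsNetwork D Φ K) {α : ℝ} (h0 : 0 ≤ α) (h1 : α ≤ 1) (μ ν : Measure (E d))
    [IsProbabilityMeasure μ] [IsProbabilityMeasure ν] (z : E n) :
    networkOutput Φ (mix α μ ν) z =
      (1 - α) * networkOutput Φ μ z + α * networkOutput Φ ν z :=
  integral_mix h0 h1 (h.integrable_right z μ) (h.integrable_right z ν)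

/-- The output and the second moment are affine along mixtures, and ℓ is convex in its second
argument. -/
lemma isConvex_risk [IsProbabilityMeasure D] (h : IsNetwork D Φ K) (hℓ : IsLoss ℓ ℓ') :
    IsConvex (risk ℓ D Φ lam) := by
  intro μ ν hμ hν α h0 h1
  have := hμ.1
  have := hν.1
  have := isProbabilityMeasure_mix h0 h1 μ ν
  have i1 := h.integrable_loss hℓ μ
  have i2 := h.integrable_loss hℓ ν
  have : ∫ p, ℓ p.2 (networkOutput Φ (mix α μ ν) p.1) ∂D ≤
      (1 - α) * ∫ p, ℓ p.2 (networkOutput Φ μ p.1) ∂D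
        + α * ∫ p, ℓ p.2 (networkOutput Φ ν p.1) ∂D := by
    rw [← integral_const_mul, ← integral_const_mul,
      ← integral_add (i1.const_mul _) (i2.const_mul _)]
    refine integral_mono (h.integrable_loss hℓ _) ((i1.const_mul _).add (i2.const_mul _))
      fun p => ?_
    simp only [output_mix h h0 h1]
    exact (hℓ.convex p.2).2 (Set.mem_univ _) (Set.mem_univ _) (by linarith) h0 (by ring)
  rw [risk, risk, risk, integral_mix h0 h1 hμ.integrable_norm_sq hν.integrable_norm_sq]
  linarith

/-- The bounded part of the first variation of the risk. -/
def lossVariation (ℓ' : ℝ → ℝ → ℝ) (D : Measure (E n × ℝ)) (Φ : E n → E d → ℝ) (μ : Measure (E d))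
    (x : E d) : ℝ :=
  ∫ p, ℓ' p.2 (networkOutput Φ μ p.1) * Φ p.1 x ∂D

lemma riskVariation_eq (hℓ : IsLoss ℓ ℓ') (μ : Measure (E d)) (x : E d) :
    riskVariation ℓ D Φ lam μ x = lossVariation ℓ' D Φ μ x + lam / 2 * ‖x‖ ^ 2 := by
  simp only [riskVariation, lossVariation, (hℓ.hasDerivAt _ _).deriv]

lemma continuous_lossVariation [IsProbabilityMeasure D] (h : IsNetwork D Φ K) (hℓ : IsLoss ℓ ℓ')
    (μ : Measure (E d)) [IsProbabilityMeasure μ] : Continuous (lossVariation ℓ' D Φ μ) := by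
  refine continuous_of_dominated (bound := fun p => (|p.2| + K) * K)
    (fun x => ((h.continuous_loss_deriv hℓ μ).mul
      ((h.continuous_left x).comp continuous_fst)).aestronglyMeasurable)
    (fun x => .of_forall fun p => ?_) (h.integrable_abs.mul_const K)
    (.of_forall fun p => continuous_const.mul (h.continuous_right p.1))
  rw [norm_mul]
  exact mul_le_mul (h.abs_loss_deriv_le hℓ μ p) (h.bound _ _) (norm_nonneg _)
    (by have := h.pos; positivity)

lemma abs_lossVariation_le [IsProbabilityMeasure D] (h : IsNetwork D Φ K) (hℓ : IsLoss ℓ ℓ')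
    (μ : Measure (E d)) [IsProbabilityMeasure μ] (x : E d) :
    |lossVariation ℓ' D Φ μ x| ≤ ∫ p, (|p.2| + K) * K ∂D := by
  rw [lossVariation, ← Real.norm_eq_abs]
  refine norm_integral_le_of_norm_le (h.integrable_abs.mul_const K) (.of_forall fun p => ?_)
  rw [norm_mul]
  exact mul_le_mul (h.abs_loss_deriv_le hℓ μ p) (h.bound _ _) (norm_nonneg _)
    (by have := h.pos; positivity)

lemma integrable_lossVariation [IsProbabilityMeasure D] (h : IsNetwork D Φ K) (hℓ : IsLoss ℓ ℓ')
    (μ ν : Measure (E d)) [IsProbabilityMeasure μ] [IsProbabilityMeasure ν] :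
    Integrable (lossVariation ℓ' D Φ μ) ν :=
  .of_bound (C := ∫ p, (|p.2| + K) * K ∂D)
    (continuous_lossVariation h hℓ μ).aestronglyMeasurable (.of_forall (abs_lossVariation_le h hℓ μ))

/-- Fubini. It rewrites the pairing of the first variation with ν in terms of outputs, the form in
which it meets the Taylor expansion of the loss. -/
lemma integral_lossVariation [IsProbabilityMeasure D] (h : IsNetwork D Φ K) (hℓ : IsLoss ℓ ℓ')
    (μ ν : Measure (E d)) [IsProbabilityMeasure μ] [IsProbabilityMeasure ν] :
    ∫ x, lossVariation ℓ' D Φ μ x ∂ν =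
      ∫ p, ℓ' p.2 (networkOutput Φ μ p.1) * networkOutput Φ ν p.1 ∂D := by
  simp only [lossVariation]
  rw [integral_integral_swap]
  · simp_rw [integral_const_mul]
    rfl
  · have hc : Continuous fun q : E d × E n × ℝ => ℓ' q.2.2 (networkOutput Φ μ q.2.1) * Φ q.2.1 q.1 :=
      ((h.continuous_loss_deriv hℓ μ).comp continuous_snd).mul
        (h.continuous.comp (by fun_prop : Continuous fun q : E d × E n × ℝ => (q.2.1, q.1)))
    have hi : Integrable (fun q : E d × E n × ℝ => (|q.2.2| + K) * K) (ν.prod D) :=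
      (h.integrable_abs.mul_const K).comp_snd ν
    refine hi.mono' hc.aestronglyMeasurable (.of_forall fun q => ?_)
    rw [Function.uncurry_def, norm_mul]
    exact mul_le_mul (h.abs_loss_deriv_le hℓ μ q.2) (h.bound _ _) (norm_nonneg _)
      (by have := h.pos; positivity)

/-- Along a mixture the output moves by ε(w - u), where |w - u| ≤ 2K. The second-order Taylor bound
thus leaves an error ε (2K)² 𝔼(1 + y²) in the difference quotient. The second moment is affine along
the mixture and contributes no error. -/
lemma isFirstVariation_risk [IsProbabilityMeasure D] (h : IsNetwork D Φ K) (hℓ : IsLoss ℓ ℓ')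
    {μ : Measure (E d)} (hμ : IsP2 μ) :
    IsFirstVariation (risk ℓ D Φ lam) μ (riskVariation ℓ D Φ lam μ) := by
  have hV : riskVariation ℓ D Φ lam μ = fun x => lossVariation ℓ' D Φ μ x + lam / 2 * ‖x‖ ^ 2 :=
    funext (riskVariation_eq hℓ μ)
  have := hμ.1
  have hint : ∀ ν, IsP2 ν → Integrable (riskVariation ℓ D Φ lam μ) ν := fun ν hν => by
    have := hν.1
    rw [hV]
    exact (integrable_lossVariation h hℓ μ ν).add (hν.integrable_norm_sq.const_mul _)
  refine ⟨?_, hint μ hμ, fun ν hν => ⟨hint ν hν, ?_⟩⟩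
  · rw [hV]
    exact (continuous_lossVariation h hℓ μ).add (by fun_prop)
  have := hν.1
  have hVint : ∀ ν, IsP2 ν → ∫ x, riskVariation ℓ D Φ lam μ x ∂ν =
      (∫ p, ℓ' p.2 (networkOutput Φ μ p.1) * networkOutput Φ ν p.1 ∂D)
        + lam / 2 * ∫ x, ‖x‖ ^ 2 ∂ν := fun ν hν => by
    have := hν.1
    rw [hV, integral_add (integrable_lossVariation h hℓ μ ν) (hν.integrable_norm_sq.const_mul _),
      integral_lossVariation h hℓ, integral_const_mul]
  rw [hVint ν hν, hVint μ hμ]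
  set u := networkOutput Φ μ with hu
  set w := networkOutput Φ ν with hw
  have iw := h.integrable_loss_deriv_mul hℓ μ (h.continuous_output ν) (h.abs_output_le ν)
  have iu := h.integrable_loss_deriv_mul hℓ μ (h.continuous_output μ) (h.abs_output_le μ)
  have hbound : ∀ ε : ℝ, 0 < ε → ε < 1 →
      ‖(1 / ε) * (risk ℓ D Φ lam (mix ε μ ν) - risk ℓ D Φ lam μ) -
        ((∫ p, ℓ' p.2 (u p.1) * w p.1 ∂D) + lam / 2 * ∫ x, ‖x‖ ^ 2 ∂ν
        - ((∫ p, ℓ' p.2 (u p.1) * u p.1 ∂D) + lam / 2 * ∫ x, ‖x‖ ^ 2 ∂μ))‖ ≤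
      ε * ((2 * K) ^ 2 * ∫ p, (1 + p.2 ^ 2) ∂D) := fun ε h0 h1 => by
    have := isProbabilityMeasure_mix h0.le h1.le μ ν
    have i1 := h.integrable_loss hℓ (mix ε μ ν)
    have i2 := h.integrable_loss hℓ μ
    have e : (1 / ε) * (risk ℓ D Φ lam (mix ε μ ν) - risk ℓ D Φ lam μ) -
        ((∫ p, ℓ' p.2 (u p.1) * w p.1 ∂D) + lam / 2 * ∫ x, ‖x‖ ^ 2 ∂ν
        - ((∫ p, ℓ' p.2 (u p.1) * u p.1 ∂D) + lam / 2 * ∫ x, ‖x‖ ^ 2 ∂μ)) =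
        (1 / ε) * ∫ p, (ℓ p.2 (networkOutput Φ (mix ε μ ν) p.1) - ℓ p.2 (u p.1)
          - ε * (ℓ' p.2 (u p.1) * w p.1 - ℓ' p.2 (u p.1) * u p.1)) ∂D := by
      have i3 : Integrable (fun p : E n × ℝ => ε * (ℓ' p.2 (u p.1) * w p.1
          - ℓ' p.2 (u p.1) * u p.1)) D := (iw.sub iu).const_mul ε
      rw [integral_sub (by exact i1.sub i2) i3, integral_sub i1 i2, integral_const_mul,
        integral_sub iw iu, risk, risk,
        integral_mix h0.le h1.le hμ.integrable_norm_sq hν.integrable_norm_sq]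
      field_simp
      ring
    rw [e, norm_mul, Real.norm_of_nonneg (by positivity), one_div, inv_mul_le_iff₀ h0,
      ← integral_const_mul, ← integral_const_mul, ← integral_const_mul]
    refine norm_integral_le_of_norm_le (((h.integrable_sq.const_mul _).const_mul _).const_mul _)
      (.of_forall fun p => ?_)
    have hmix : networkOutput Φ (mix ε μ ν) p.1 - u p.1 = ε * (w p.1 - u p.1) := by
      rw [output_mix h h0.le h1.le]; ring
    have := hℓ.abs_taylor_le p.2 (u p.1) (networkOutput Φ (mix ε μ ν) p.1)
    rw [hmix] at this
    have e2 : ℓ' p.2 (u p.1) * (ε * (w p.1 - u p.1)) =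
        ε * (ℓ' p.2 (u p.1) * w p.1 - ℓ' p.2 (u p.1) * u p.1) := by ring
    rw [e2] at this
    refine this.trans ?_
    have h3 : |w p.1 - u p.1| ≤ 2 * K := by
      linarith [abs_sub (w p.1) (u p.1), h.abs_output_le μ p.1, h.abs_output_le ν p.1]
    rw [abs_mul, abs_of_pos h0]
    calc (1 + p.2 ^ 2) * (ε * |w p.1 - u p.1|) ^ 2 ≤ (1 + p.2 ^ 2) * (ε * (2 * K)) ^ 2 := by gcongr
      _ = _ := by ring
  rw [tendsto_iff_norm_sub_tendsto_zero]
  refine squeeze_zero' (.of_forall fun ε => norm_nonneg _) ?_ (g := fun ε =>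
    ε * ((2 * K) ^ 2 * ∫ p, (1 + p.2 ^ 2) ∂D)) ?_
  · filter_upwards [Ioo_mem_nhdsGT one_pos] with ε hε using hbound ε hε.1 hε.2
  · have : Continuous fun ε : ℝ => ε * ((2 * K) ^ 2 * ∫ p, (1 + p.2 ^ 2) ∂D) := by fun_prop
    have := (this.tendsto 0).mono_left (nhdsWithin_le_nhds (s := Set.Ioi 0))
    simpa using this

end Risk

/-! ### Lipschitz test functions and the Wasserstein distance. -/

section Wasserstein

variable {d : ℕ}

lemma IsP2.prod_mem_plans {μ ν : Measure (E d)} (hμ : IsP2 μ) (hν : IsP2 ν) :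
    μ.prod ν ∈ plans μ ν := by
  have := hμ.1
  have := hν.1
  exact ⟨by simp [Measure.map_fst_prod], by simp [Measure.map_snd_prod]⟩

lemma enorm_sub_sq_le (x y : E d) : ‖y - x‖ₑ ^ 2 ≤ 2 * ‖x‖ₑ ^ 2 + 2 * ‖y‖ₑ ^ 2 := by
  have h : ‖y - x‖ ^ 2 ≤ 2 * ‖x‖ ^ 2 + 2 * ‖y‖ ^ 2 := by
    have : ‖y - x‖ ^ 2 ≤ (‖y‖ + ‖x‖) ^ 2 := by gcongr; exact norm_sub_le _ _
    nlinarith [sq_nonneg (‖y‖ - ‖x‖)]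
  have := ENNReal.ofReal_le_ofReal h
  rw [ENNReal.ofReal_add (by positivity) (by positivity), ENNReal.ofReal_mul two_pos.le,
    ENNReal.ofReal_mul two_pos.le] at this
  simpa [ENNReal.ofReal_pow, ofReal_norm] using this

lemma cost_prod_lt_top {μ ν : Measure (E d)} (hμ : IsP2 μ) (hν : IsP2 ν) :
    ∫⁻ p, ‖p.2 - p.1‖ₑ ^ 2 ∂(μ.prod ν) < ⊤ := by
  have := hμ.1
  have := hν.1
  calc ∫⁻ p, ‖p.2 - p.1‖ₑ ^ 2 ∂(μ.prod ν)
      ≤ ∫⁻ p, (2 * ‖p.1‖ₑ ^ 2 + 2 * ‖p.2‖ₑ ^ 2) ∂(μ.prod ν) :=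
        lintegral_mono fun p => enorm_sub_sq_le _ _
    _ = 2 * ∫⁻ x, ‖x‖ₑ ^ 2 ∂μ + 2 * ∫⁻ y, ‖y‖ₑ ^ 2 ∂ν := by
        rw [lintegral_add_left (by fun_prop), lintegral_const_mul _ (by fun_prop),
          lintegral_const_mul _ (by fun_prop)]
        congr 2
        · rw [lintegral_prod _ (by fun_prop)]; simp
        · rw [lintegral_prod _ (by fun_prop)]; simp
    _ < ⊤ := ENNReal.add_lt_top.2 ⟨ENNReal.mul_lt_top (by simp) hμ.2,
        ENNReal.mul_lt_top (by simp) hν.2⟩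

/-- Integrals of a Lipschitz function are controlled by the Wasserstein distance. -/
lemma abs_integral_sub_le_W2 {μ ν : Measure (E d)} (hμ : IsP2 μ) (hν : IsP2 ν) {u : E d → ℝ}
    {M : ℝ} (hM : 0 ≤ M) (hu : Continuous u) (hlip : ∀ x y, |u x - u y| ≤ M * ‖y - x‖)
    (iμ : Integrable u μ) (iν : Integrable u ν) :
    |∫ x, u x ∂μ - ∫ x, u x ∂ν| ≤ M * W2 μ ν := by
  have hμp := hμ.1
  set Δ := |∫ x, u x ∂μ - ∫ x, u x ∂ν|
  -- For each plan, |∫u dμ - ∫u dν| is at most the mean of |u(x) - u(y)|, whose square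
  -- Cauchy–Schwarz bounds by M² times the cost. An infinite cost with M = 0 is separate, as 0 · ∞ =
  -- 0.
  have key : ∀ γ ∈ plans μ ν, ENNReal.ofReal (Δ ^ 2) ≤
      ENNReal.ofReal (M ^ 2) * ∫⁻ p, ‖p.2 - p.1‖ₑ ^ 2 ∂γ := by
    rintro γ ⟨h1, h2⟩
    have hγ : IsProbabilityMeasure γ := by
      have : IsProbabilityMeasure (γ.map Prod.fst) := h1 ▸ hμp
      exact Measure.isProbabilityMeasure_of_map Prod.fst
    have i1 : Integrable (fun p => u p.1) γ := by
      rw [← h1] at iμ; exact iμ.comp_measurable measurable_fst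
    have i2 : Integrable (fun p => u p.2) γ := by
      rw [← h2] at iν; exact iν.comp_measurable measurable_snd
    have e1 : ∫ x, u x ∂μ = ∫ p, u p.1 ∂γ := by
      rw [← h1, integral_map (by fun_prop) hu.aestronglyMeasurable]
    have e2 : ∫ x, u x ∂ν = ∫ p, u p.2 ∂γ := by
      rw [← h2, integral_map (by fun_prop) hu.aestronglyMeasurable]
    have hΔ : Δ ≤ ∫ p, |u p.1 - u p.2| ∂γ := by
      simp only [Δ]
      rw [e1, e2, ← integral_sub i1 i2]
      exact abs_integral_le_integral_abs
    by_cases htop : ∫⁻ p, ‖p.2 - p.1‖ₑ ^ 2 ∂γ = ⊤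
    · rcases hM.eq_or_lt with rfl | hM
      · have h0 : ∀ p : E d × E d, |u p.1 - u p.2| = 0 := fun p =>
          le_antisymm (by simpa using hlip p.1 p.2) (abs_nonneg _)
        simp only [h0, integral_zero] at hΔ
        have : Δ = 0 := le_antisymm hΔ (abs_nonneg _)
        simp [this]
      · rw [htop, ENNReal.mul_top (by simpa using hM.ne')]
        exact le_top
    have hcost : ∀ p : E d × E d, ‖p.2 - p.1‖ₑ ^ 2 = ENNReal.ofReal (‖p.2 - p.1‖ ^ 2) := fun p => by
      rw [ENNReal.ofReal_pow (norm_nonneg _), ofReal_norm]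
    simp_rw [hcost] at htop ⊢
    have isq : Integrable (fun p : E d × E d => ‖p.2 - p.1‖ ^ 2) γ :=
      (lintegral_ofReal_ne_top_iff_integrable (by fun_prop)
        (.of_forall fun p => sq_nonneg _)).1 htop
    rw [← ofReal_integral_eq_lintegral_ofReal isq (.of_forall fun p => sq_nonneg _),
      ← ENNReal.ofReal_mul (sq_nonneg M), ← integral_const_mul]
    refine ENNReal.ofReal_le_ofReal ?_
    set h := fun p : E d × E d => |u p.1 - u p.2|
    have ih : Integrable h γ := (i1.sub i2).abs
    set m := ∫ p, h p ∂γ with hm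
    have iq : Integrable (fun p : E d × E d => M ^ 2 * ‖p.2 - p.1‖ ^ 2) γ := isq.const_mul _
    -- Jensen for the square: h² ≥ 2mh - m², with m the mean of h.
    have hle : ∫ p, (2 * m * h p - m ^ 2) ∂γ ≤ ∫ p, M ^ 2 * ‖p.2 - p.1‖ ^ 2 ∂γ := by
      refine integral_mono ((ih.const_mul _).sub (integrable_const _)) iq fun p => ?_
      have h3 : h p ^ 2 ≤ (M * ‖p.2 - p.1‖) ^ 2 := by
        have : 0 ≤ h p := abs_nonneg _
        gcongr
        exact hlip p.1 p.2
      simp only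
      nlinarith [sq_nonneg (h p - m)]
    rw [integral_sub (ih.const_mul _) (integrable_const _), integral_const_mul, ← hm] at hle
    simp only [integral_const, probReal_univ, smul_eq_mul, one_mul] at hle
    have hΔ0 : 0 ≤ Δ := abs_nonneg _
    nlinarith
  have hsq : Δ ^ 2 ≤ M ^ 2 * (⨅ γ ∈ plans μ ν, ∫⁻ p, ‖p.2 - p.1‖ₑ ^ 2 ∂γ).toReal := by
    have hfin : (⨅ γ ∈ plans μ ν, ∫⁻ p, ‖p.2 - p.1‖ₑ ^ 2 ∂γ) ≠ ⊤ :=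
      ((iInf₂_le _ (hμ.prod_mem_plans hν)).trans_lt (cost_prod_lt_top hμ hν)).ne
    rcases hM.eq_or_lt with hM0 | hM0
    · have := key _ (hμ.prod_mem_plans hν)
      rw [← hM0] at this ⊢
      have h0 : Δ ^ 2 ≤ 0 := by simpa using this
      simpa using h0
    · have h1 : ENNReal.ofReal (Δ ^ 2) ≤
          ENNReal.ofReal (M ^ 2) * ⨅ γ ∈ plans μ ν, ∫⁻ p, ‖p.2 - p.1‖ₑ ^ 2 ∂γ := by
        rw [ENNReal.mul_iInf_of_ne (by simpa using hM0.ne') ENNReal.ofReal_ne_top]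
        refine le_iInf fun γ => ?_
        rw [ENNReal.mul_iInf_of_ne (by simpa using hM0.ne') ENNReal.ofReal_ne_top]
        exact le_iInf fun hγ => key γ hγ
      have h2 := ENNReal.toReal_mono (ENNReal.mul_ne_top ENNReal.ofReal_ne_top hfin) h1
      rwa [ENNReal.toReal_mul, ENNReal.toReal_ofReal (sq_nonneg _),
        ENNReal.toReal_ofReal (sq_nonneg _)] at h2
  rw [W2]
  have := Real.abs_le_sqrt hsq
  rw [Real.sqrt_mul (sq_nonneg M), Real.sqrt_sq hM] at this
  exact (le_abs_self _).trans this

end Wasserstein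

/-! ### Differentiability and Lipschitz gradient of the first variation. -/

section Smooth

variable {n d : ℕ} {D : Measure (E n × ℝ)} {Φ : E n → E d → ℝ} {K lam : ℝ} {ℓ ℓ' : ℝ → ℝ → ℝ}

/-- In a unit direction v, Taylor's formula bounds |f'(x)v| by |f(x+v)| + |f(x)| + C. This makes the
network uniformly Lipschitz in x, which is not assumed separately. -/
lemma norm_fderiv_le_of_bounded {f : E d → ℝ} {K : ℝ} {C : ℝ≥0} (hf : Differentiable ℝ f)
    (hK : ∀ x, |f x| ≤ K) (hC : ∀ x y, ‖fderiv ℝ f x - fderiv ℝ f y‖ ≤ C * ‖x - y‖) (x : E d) :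
    ‖fderiv ℝ f x‖ ≤ 2 * K + C := by
  have hK0 : 0 ≤ K := (abs_nonneg _).trans (hK 0)
  refine ContinuousLinearMap.opNorm_le_of_unit_norm (by positivity) fun v hv => ?_
  have h1 := abs_taylor_le_of_lipschitz_fderiv hf (L := (C : ℝ)) C.coe_nonneg hC x v
  rw [hv, one_pow, mul_one] at h1
  have h2 := hK (x + v)
  have h3 := hK x
  rw [Real.norm_eq_abs]
  rw [abs_le] at *
  constructor <;> linarith [h1.1, h1.2, h2.1, h2.2, h3.1, h3.2]

/-- Smoothness of the network in its parameter. -/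
structure IsSmoothNetwork (Φ : E n → E d → ℝ) (C : ℝ≥0) : Prop where
  differentiable : ∀ z, Differentiable ℝ (Φ z)
  lip : ∀ z, LipschitzWith C (∇ (Φ z))

lemma IsSmoothNetwork.fderiv_sub_le {C : ℝ≥0} (h : IsSmoothNetwork Φ C) (z : E n) (x y : E d) :
    ‖fderiv ℝ (Φ z) x - fderiv ℝ (Φ z) y‖ ≤ C * ‖x - y‖ := by
  have := (h.lip z).dist_le_mul x y
  rw [dist_eq_norm, dist_eq_norm, gradient, gradient, ← map_sub,
    LinearIsometryEquiv.norm_map] at this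
  exact this

lemma IsSmoothNetwork.norm_fderiv_le {C : ℝ≥0} (h : IsSmoothNetwork Φ C) (hN : IsNetwork D Φ K)
    (z : E n) (x : E d) : ‖fderiv ℝ (Φ z) x‖ ≤ 2 * K + C :=
  norm_fderiv_le_of_bounded (h.differentiable z) (hN.bound z) (h.fderiv_sub_le z) x

/-- The derivative of `lossVariation`. -/
def lossVariationDeriv (ℓ' : ℝ → ℝ → ℝ) (D : Measure (E n × ℝ)) (Φ : E n → E d → ℝ)
    (μ : Measure (E d)) (x : E d) : E d →L[ℝ] ℝ :=
  ∫ p, ℓ' p.2 (networkOutput Φ μ p.1) • fderiv ℝ (Φ p.1) x ∂D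

lemma integrable_loss_deriv_smul_fderiv [IsProbabilityMeasure D] (h : IsNetwork D Φ K)
    (hℓ : IsLoss ℓ ℓ') {C : ℝ≥0} (hs : IsSmoothNetwork Φ C) (μ : Measure (E d))
    [IsProbabilityMeasure μ] (x : E d) :
    Integrable (fun p : E n × ℝ => ℓ' p.2 (networkOutput Φ μ p.1) • fderiv ℝ (Φ p.1) x) D := by
  -- No regularity of the x-derivative in z is assumed; its measurability follows from joint
  -- continuity of Φ.
  have hm : Measurable fun p : E n × ℝ => fderiv ℝ (Φ p.1) x :=
    (measurable_fderiv_with_param ℝ h.continuous).comp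
      (by fun_prop : Measurable fun p : E n × ℝ => (p.1, x))
  exact (h.integrable_loss_deriv hℓ μ).smul_bdd (2 * K + C) hm.aestronglyMeasurable
    (.of_forall fun p => hs.norm_fderiv_le h p.1 x)

lemma hasFDerivAt_lossVariation [IsProbabilityMeasure D] (h : IsNetwork D Φ K)
    (hℓ : IsLoss ℓ ℓ') {C : ℝ≥0} (hs : IsSmoothNetwork Φ C) (μ : Measure (E d))
    [IsProbabilityMeasure μ] (x : E d) :
    HasFDerivAt (lossVariation ℓ' D Φ μ) (lossVariationDeriv ℓ' D Φ μ x) x := by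
  have hmeas : ∀ x, AEStronglyMeasurable
      (fun p : E n × ℝ => ℓ' p.2 (networkOutput Φ μ p.1) * Φ p.1 x) D := fun x =>
    ((h.continuous_loss_deriv hℓ μ).mul
      ((h.continuous_left x).comp continuous_fst)).aestronglyMeasurable
  refine hasFDerivAt_integral_of_dominated_of_fderiv_le (s := Set.univ)
    (bound := fun p => (|p.2| + K) * (2 * K + C)) univ_mem (.of_forall hmeas)
    (h.integrable_loss_deriv_mul hℓ μ (h.continuous_left x) fun z => h.bound z x)
    (integrable_loss_deriv_smul_fderiv h hℓ hs μ x).1 (.of_forall fun p y _ => ?_)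
    (h.integrable_abs.mul_const _)
    (.of_forall fun p y _ => ((hs.differentiable p.1 y).hasFDerivAt.const_mul _))
  rw [norm_smul]
  exact mul_le_mul (h.abs_loss_deriv_le hℓ μ p) (hs.norm_fderiv_le h _ _) (norm_nonneg _)
    (by have := h.pos; positivity)

/-- Write a·A - b·B as a·(A - B) + (a - b)·B. The first term uses the Lipschitz gradient of Φ, the
second the Lipschitz bound on ℓ' and the bounded gradient of Φ. -/
lemma norm_lossVariationDeriv_sub_le [IsProbabilityMeasure D] (h : IsNetwork D Φ K)
    (hℓ : IsLoss ℓ ℓ') {C : ℝ≥0} (hs : IsSmoothNetwork Φ C) (μ ν : Measure (E d))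
    [IsProbabilityMeasure μ] [IsProbabilityMeasure ν] {δ : ℝ}
    (hδ : ∀ z, |networkOutput Φ μ z - networkOutput Φ ν z| ≤ δ) (x y : E d) :
    ‖lossVariationDeriv ℓ' D Φ μ x - lossVariationDeriv ℓ' D Φ ν y‖ ≤
      (∫ p, (|p.2| + K) ∂D) * C * ‖x - y‖ + (∫ p, (1 + p.2 ^ 2) ∂D) * (2 * K + C) * δ := by
  have hK := h.pos
  rw [lossVariationDeriv, lossVariationDeriv,
    ← integral_sub (integrable_loss_deriv_smul_fderiv h hℓ hs μ x)
      (integrable_loss_deriv_smul_fderiv h hℓ hs ν y), mul_assoc, mul_assoc,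
    ← integral_mul_const, ← integral_mul_const,
    ← integral_add (h.integrable_abs.mul_const _) (h.integrable_sq.mul_const _)]
  refine norm_integral_le_of_norm_le ((h.integrable_abs.mul_const _).add
    (h.integrable_sq.mul_const _)) (.of_forall fun p => ?_)
  have e : ℓ' p.2 (networkOutput Φ μ p.1) • fderiv ℝ (Φ p.1) x
      - ℓ' p.2 (networkOutput Φ ν p.1) • fderiv ℝ (Φ p.1) y =
      ℓ' p.2 (networkOutput Φ μ p.1) • (fderiv ℝ (Φ p.1) x - fderiv ℝ (Φ p.1) y)
      + (ℓ' p.2 (networkOutput Φ μ p.1) - ℓ' p.2 (networkOutput Φ ν p.1)) •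
        fderiv ℝ (Φ p.1) y := by
    rw [smul_sub, sub_smul]; abel
  rw [e]
  refine (norm_add_le _ _).trans (add_le_add ?_ ?_)
  · rw [norm_smul]
    exact mul_le_mul (h.abs_loss_deriv_le hℓ μ p) (hs.fderiv_sub_le _ _ _) (norm_nonneg _)
      (by positivity)
  · rw [norm_smul]
    calc _ ≤ ((1 + p.2 ^ 2) * δ) * (2 * K + C) := by
          refine mul_le_mul ((hℓ.lip _ _ _).trans (by gcongr; exact hδ _))
            (hs.norm_fderiv_le h _ _) (norm_nonneg _) ?_
          have := (abs_nonneg _).trans (hδ 0)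
          positivity
      _ = _ := by ring

lemma hasFDerivAt_riskVariation [IsProbabilityMeasure D] (h : IsNetwork D Φ K)
    (hℓ : IsLoss ℓ ℓ') {C : ℝ≥0} (hs : IsSmoothNetwork Φ C) (μ : Measure (E d))
    [IsProbabilityMeasure μ] (x : E d) :
    HasFDerivAt (riskVariation ℓ D Φ lam μ)
      (lossVariationDeriv ℓ' D Φ μ x + lam • innerSL ℝ x) x := by
  have e : riskVariation ℓ D Φ lam μ = fun x => lossVariation ℓ' D Φ μ x + lam / 2 * ‖x‖ ^ 2 :=
    funext (riskVariation_eq hℓ μ)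
  rw [e]
  refine (hasFDerivAt_lossVariation h hℓ hs μ x).add ?_
  have := (hasStrictFDerivAt_norm_sq x).hasFDerivAt.const_mul (lam / 2)
  convert! this using 1
  ext v
  simp
  ring

lemma isSmooth_risk [IsProbabilityMeasure D] (h : IsNetwork D Φ K) (hℓ : IsLoss ℓ ℓ') {C : ℝ≥0}
    (hs : IsSmoothNetwork Φ C) (hlam : 0 < lam) : IsSmooth (risk ℓ D Φ lam) := by
  have hK := h.pos
  set A := ∫ p, (|p.2| + K) ∂D
  set B := ∫ p, (1 + p.2 ^ 2) ∂D
  have hA : 0 ≤ A := integral_nonneg fun p => by positivity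
  have hB : 0 ≤ B := integral_nonneg fun p => by positivity
  have hfd : ∀ μ : Measure (E d), IsP2 μ → ∀ x, fderiv ℝ (riskVariation ℓ D Φ lam μ) x =
      lossVariationDeriv ℓ' D Φ μ x + lam • innerSL ℝ x := fun μ hμ x => by
    have := hμ.1
    exact (hasFDerivAt_riskVariation h hℓ hs μ x).fderiv
  have hsub : ∀ μ ν : Measure (E d), IsP2 μ → IsP2 ν → ∀ δ,
      (∀ z, |networkOutput Φ μ z - networkOutput Φ ν z| ≤ δ) → ∀ x y,
      ‖fderiv ℝ (riskVariation ℓ D Φ lam μ) x - fderiv ℝ (riskVariation ℓ D Φ lam ν) y‖ ≤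
        (A * C + lam) * ‖x - y‖ + B * (2 * K + C) * δ := by
    intro μ ν hμ hν δ hδ x y
    have := hμ.1
    have := hν.1
    rw [hfd μ hμ, hfd ν hν]
    have e : lossVariationDeriv ℓ' D Φ μ x + lam • innerSL ℝ x
        - (lossVariationDeriv ℓ' D Φ ν y + lam • innerSL ℝ y) =
        (lossVariationDeriv ℓ' D Φ μ x - lossVariationDeriv ℓ' D Φ ν y)
        + lam • innerSL ℝ (x - y) := by
      rw [map_sub, smul_sub]; abel
    rw [e]
    refine (norm_add_le _ _).trans ?_
    have h1 := norm_lossVariationDeriv_sub_le h hℓ hs μ ν hδ x y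
    have h2 : ‖lam • innerSL ℝ (x - y)‖ = lam * ‖x - y‖ := by
      rw [norm_smul, innerSL_apply_norm, Real.norm_of_nonneg hlam.le]
    rw [h2]
    linarith
  -- L is the sum of the coefficients of ‖x - y‖ and of W₂. One factor 2K + C bounds the gradient of
  -- Φ, the other turns a difference of outputs into W₂.
  refine ⟨riskVariation ℓ D Φ lam, fun μ hμ => ⟨isFirstVariation_risk h hℓ hμ, ?_⟩,
    A * C + lam + B * (2 * K + C) * (2 * K + C), by positivity, fun μ ν hμ hν x y => ?_⟩
  · have := hμ.1
    rw [contDiff_one_iff_fderiv]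
    refine ⟨fun x => (hasFDerivAt_riskVariation h hℓ hs μ x).differentiableAt,
      continuous_of_norm_sub_le (M := A * C + lam) fun x y => ?_⟩
    simpa using hsub μ μ hμ hμ 0 (by simp) x y
  · have := hμ.1
    have := hν.1
    rw [gradient, gradient, ← map_sub, LinearIsometryEquiv.norm_map]
    have hM : 0 ≤ 2 * K + C := by positivity
    have hout : ∀ z, |networkOutput Φ μ z - networkOutput Φ ν z| ≤ (2 * K + C) * W2 μ ν := fun z =>
      abs_integral_sub_le_W2 hμ hν hM (h.continuous_right z) (fun a b => by
        rw [norm_sub_rev]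
        exact convex_univ.norm_image_sub_le_of_norm_hasFDerivWithin_le
          (fun c _ => (hs.differentiable z c).hasFDerivAt.hasFDerivWithinAt)
          (fun c _ => hs.norm_fderiv_le h z c) (Set.mem_univ b) (Set.mem_univ a))
        (h.integrable_right z μ) (h.integrable_right z ν)
    refine (hsub μ ν hμ hν _ hout x y).trans ?_
    have hW : 0 ≤ W2 μ ν := Real.sqrt_nonneg _
    have h1 : 0 ≤ B * (2 * K + C) * (2 * K + C) := by positivity
    have h2 : 0 ≤ A * C + lam := by positivity
    nlinarith [mul_nonneg h1 (norm_nonneg (x - y)), mul_nonneg h2 hW]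

end Smooth

/-! ### Uniform log-Sobolev constants for the two losses. -/

section Uniform

variable {n d : ℕ} {D : Measure (E n × ℝ)} {Φ : E n → E d → ℝ} {K lam : ℝ} {ℓ ℓ' : ℝ → ℝ → ℝ}

lemma isP2_dirac (x : E d) : IsP2 (Measure.dirac x) :=
  ⟨inferInstance, by simp [lintegral_dirac]⟩

lemma IsFirstVariation.eq_add_const {G : Measure (E d) → ℝ} {μ : Measure (E d)} {V V' : E d → ℝ}
    (h : IsFirstVariation G μ V) (h' : IsFirstVariation G μ V') :
    ∃ c, ∀ x, V' x = V x + c := by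
  refine ⟨∫ x, V' x ∂μ - ∫ x, V x ∂μ, fun x => ?_⟩
  have := tendsto_nhds_unique (h.2.2 _ (isP2_dirac x)).2 (h'.2.2 _ (isP2_dirac x)).2
  rw [integral_dirac, integral_dirac] at this
  linarith

/-- Every first variation is a continuous function bounded by `B`, plus (λ/2)‖x‖² and a constant, so
`satisfiesLSI_tilted` applies with a constant independent of μ. -/
lemma uniformLSI_risk [IsProbabilityMeasure D] (h : IsNetwork D Φ K) (hℓ : IsLoss ℓ ℓ')
    (hlam : 0 < lam) {τ B : ℝ} (hτ : 0 < τ)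
    (hB : ∀ μ : Measure (E d), IsP2 μ → ∀ x, |lossVariation ℓ' D Φ μ x| ≤ B) :
    UniformLSI (risk ℓ D Φ lam) τ (lam / τ * Real.exp (-2 * B / τ)) := by
  intro μ hμ
  have := hμ.1
  have hV := isFirstVariation_risk (lam := lam) h hℓ hμ
  refine ⟨⟨_, hV⟩, fun V hV' => ?_⟩
  obtain ⟨c, hc⟩ := hV.eq_add_const hV'
  have e : ∀ x, -V x / τ = -(lossVariation ℓ' D Φ μ x + lam / 2 * ‖x‖ ^ 2 + c) / τ := fun x => by
    rw [hc, riskVariation_eq hℓ]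
  simp_rw [e]
  exact satisfiesLSI_tilted hlam hτ (continuous_lossVariation h hℓ μ) (hB μ hμ)

lemma uniformLSI_logistic [IsProbabilityMeasure D] (h : IsNetwork D Φ K) (hlam : 0 < lam)
    (hy : ∀ᵐ p ∂D, |p.2| ≤ 1) {τ : ℝ} (hτ : 0 < τ) :
    UniformLSI (risk logisticLoss D Φ lam) τ (lam / τ * Real.exp (-2 * K / τ)) := by
  refine uniformLSI_risk h isLoss_logistic hlam hτ fun μ _ x => ?_
  have := norm_integral_le_of_norm_le_const (μ := D) (C := K)
    (f := fun p : E n × ℝ => -p.2 / (1 + Real.exp (p.2 * networkOutput Φ μ p.1)) * Φ p.1 x) (by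
      filter_upwards [hy] with p hp
      rw [norm_mul, ← one_mul K]
      exact mul_le_mul ((abs_logistic_deriv_le _ _).trans hp) (h.bound _ _) (norm_nonneg _)
        zero_le_one)
  simpa [lossVariation] using this

lemma integral_condExp_mul {Ω : Type*} {m m0 : MeasurableSpace Ω} {D : Measure Ω}
    [IsFiniteMeasure D] (hm : m ≤ m0) {Y ψ : Ω → ℝ} (hY : Integrable Y D)
    (hψ : StronglyMeasurable[m] ψ) (hYψ : Integrable (fun q => Y q * ψ q) D) :
    ∫ q, (D[Y | m]) q * ψ q ∂D = ∫ q, Y q * ψ q ∂D := by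
  rw [← integral_condExp hm (f := fun q => Y q * ψ q)]
  exact integral_congr_ae (condExp_mul_of_stronglyMeasurable_right hψ hYψ hY).symm

/-- The derivative u - y is affine in y and is multiplied by a function of z only, so y may be
replaced by its conditional mean. The integrand is then at most K(K + K'), although y itself may be
unbounded. -/
lemma uniformLSI_square [IsProbabilityMeasure D] (h : IsNetwork D Φ K) (hlam : 0 < lam) {K' : ℝ}
    (hy : ∀ᵐ p ∂D, |(D[fun q : E n × ℝ => q.2 |
      MeasurableSpace.comap Prod.fst inferInstance]) p| ≤ K') {τ : ℝ} (hτ : 0 < τ) :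
    UniformLSI (risk squareLoss D Φ lam) τ (lam / τ * Real.exp (-2 * K * (K + K') / τ)) := by
  rw [mul_assoc (-2) K]
  refine uniformLSI_risk h isLoss_square hlam hτ fun μ hμ x => ?_
  have := hμ.1
  have hK := h.pos
  set Y := D[fun q : E n × ℝ => q.2 | MeasurableSpace.comap Prod.fst inferInstance]
  have iy : Integrable (fun q : E n × ℝ => q.2) D := h.memLp.integrable (by norm_num)
  have cΦ : Continuous fun p : E n × ℝ => Φ p.1 x := (h.continuous_left x).comp continuous_fst
  have bΦ : ∀ p : E n × ℝ, ‖Φ p.1 x‖ ≤ K := fun p => h.bound _ _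
  have iyΦ : Integrable (fun q : E n × ℝ => q.2 * Φ q.1 x) D :=
    iy.mul_bdd (c := K) cΦ.aestronglyMeasurable (.of_forall bΦ)
  have iYΦ : Integrable (fun q : E n × ℝ => Y q * Φ q.1 x) D :=
    integrable_condExp.mul_bdd (c := K) cΦ.aestronglyMeasurable (.of_forall bΦ)
  have pull : ∫ q, Y q * Φ q.1 x ∂D = ∫ q, q.2 * Φ q.1 x ∂D :=
    integral_condExp_mul measurable_fst.comap_le iy
      ((h.continuous_left x).measurable.comp (comap_measurable Prod.fst)).stronglyMeasurable iyΦ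
  have iu : Integrable (fun p : E n × ℝ => networkOutput Φ μ p.1 * Φ p.1 x) D :=
    .of_bound (C := K * K)
      (((h.continuous_output μ).comp continuous_fst).mul cΦ).aestronglyMeasurable
      (.of_forall fun p => by
        rw [norm_mul]
        exact mul_le_mul (h.abs_output_le μ _) (bΦ p) (norm_nonneg _) hK.le)
  have e : lossVariation (fun y u => u - y) D Φ μ x =
      ∫ p, (networkOutput Φ μ p.1 * Φ p.1 x - Y p * Φ p.1 x) ∂D := by
    rw [integral_sub iu iYΦ, pull, ← integral_sub iu iyΦ, lossVariation]
    simp_rw [sub_mul]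
  rw [e, ← Real.norm_eq_abs]
  have := norm_integral_le_of_norm_le_const (μ := D) (C := K * (K + K'))
    (f := fun p : E n × ℝ => networkOutput Φ μ p.1 * Φ p.1 x - Y p * Φ p.1 x) (by
      filter_upwards [hy] with p hp
      rw [← sub_mul, norm_mul, mul_comm]
      refine mul_le_mul (bΦ p) ?_ (norm_nonneg _) hK.le
      exact (abs_sub _ _).trans (add_le_add (h.abs_output_le μ _) hp))
  simpa using this

end Uniform

/-! ### Uniform convexity of the entropy for the Hellinger distance. -/

open InformationTheory

/-- Apply log r ≤ r - 1 to r = √c/√s and multiply by 2s. -/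
lemma sqrt_sub_sq_le_bregman {c s : ℝ} (hc : 0 < c) (hs : 0 ≤ s) : (√s - √c) ^ 2 ≤ bregman c s := by
  rcases hs.eq_or_lt with rfl | hs
  · simp [bregman, Real.sq_sqrt hc.le]
  have ha := Real.sqrt_pos.2 hs
  have hb := Real.sqrt_pos.2 hc
  have e1 : Real.log s = 2 * Real.log √s := by rw [Real.log_sqrt hs.le]; ring
  have e2 : Real.log c = 2 * Real.log √c := by rw [Real.log_sqrt hc.le]; ring
  have h1 : Real.log √c - Real.log √s ≤ √c / √s - 1 := by
    rw [← Real.log_div hb.ne' ha.ne']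
    exact Real.log_le_sub_one_of_pos (by positivity)
  have h2 := mul_le_mul_of_nonneg_left h1 (by positivity : (0 : ℝ) ≤ 2 * √s ^ 2)
  have h3 : 2 * √s ^ 2 * (√c / √s - 1) = 2 * √s * √c - 2 * √s ^ 2 := by field_simp
  have h4 := Real.sq_sqrt hs.le
  have h5 := Real.sq_sqrt hc.le
  rw [h3] at h2
  unfold bregman
  rw [e1, e2]
  nlinarith

/-- Quantitative midpoint convexity of `s ↦ s log s`. -/
lemma sqrt_sub_sq_le_klFun {p q : ℝ} (hp : 0 ≤ p) (hq : 0 ≤ q) :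
    1 / 4 * (√p - √q) ^ 2 ≤ 1 / 2 * klFun p + 1 / 2 * klFun q - klFun (1 / 2 * p + 1 / 2 * q) := by
  rcases (by positivity : 0 ≤ 1 / 2 * p + 1 / 2 * q).eq_or_lt with h | hm
  · obtain rfl : p = 0 := by linarith
    obtain rfl : q = 0 := by linarith
    norm_num [klFun_zero]
  -- With m the midpoint, the Jensen gap is the average of the Bregman divergences of p and q from
  -- m, and (√p - √m)² + (√q - √m)² ≥ (√p - √q)²/2.
  have h1 := sqrt_sub_sq_le_bregman hm hp
  have h2 := sqrt_sub_sq_le_bregman hm hq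
  unfold bregman at h1 h2
  simp only [klFun]
  nlinarith [sq_nonneg (√p + √q - 2 * √(1 / 2 * p + 1 / 2 * q))]

/-- Young's inequality applied to |√p - √q|(√p + √q). Integrated over densities, it bounds the L¹
distance by the squared Hellinger distance over 2η, plus 2η. -/
lemma abs_sub_le_sqrt_sub_sq {p q η : ℝ} (hp : 0 ≤ p) (hq : 0 ≤ q) (hη : 0 < η) :
    |p - q| ≤ 1 / (2 * η) * (√p - √q) ^ 2 + η * (p + q) := by
  have e : p - q = (√p - √q) * (√p + √q) := by
    nlinarith [Real.sq_sqrt hp, Real.sq_sqrt hq]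
  have h1 : |p - q| = |√p - √q| * (√p + √q) := by
    rw [e, abs_mul, abs_of_nonneg (add_nonneg (Real.sqrt_nonneg p) (Real.sqrt_nonneg q))]
  have h2 : (√p + √q) ^ 2 ≤ 2 * (p + q) := by
    nlinarith [Real.sq_sqrt hp, Real.sq_sqrt hq, sq_nonneg (√p - √q)]
  have h3 : |√p - √q| * (√p + √q) ≤ 1 / (2 * η) * (√p - √q) ^ 2 + η / 2 * (√p + √q) ^ 2 := by
    have : 0 ≤ 1 / (2 * η) * (|√p - √q| - η * (√p + √q)) ^ 2 := by positivity
    have e2 : 1 / (2 * η) * (|√p - √q| - η * (√p + √q)) ^ 2 =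
      1 / (2 * η) * (√p - √q) ^ 2 + η / 2 * (√p + √q) ^ 2 - |√p - √q| * (√p + √q) := by
      rw [← sq_abs (√p - √q)]; field_simp; ring
    linarith
  nlinarith

/-! ### The direct method on probability densities. -/

section Densities

variable {Ω : Type*} [MeasurableSpace Ω] {γ : Measure Ω}

/-- `p` is a probability density with respect to `γ`. -/
structure IsDensity (γ : Measure Ω) (p : Ω → ℝ) : Prop where
  measurable : Measurable p
  nonneg : ∀ x, 0 ≤ p x
  integrable : Integrable p γ
  integral_eq : ∫ x, p x ∂γ = 1

lemma IsDensity.midpoint {p q : Ω → ℝ} (hp : IsDensity γ p) (hq : IsDensity γ q) :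
    IsDensity γ (fun x => 1 / 2 * p x + 1 / 2 * q x) where
  measurable := (hp.measurable.const_mul _).add (hq.measurable.const_mul _)
  nonneg x := by have := hp.nonneg x; have := hq.nonneg x; positivity
  integrable := (hp.integrable.const_mul _).add (hq.integrable.const_mul _)
  integral_eq := by
    rw [integral_add (hp.integrable.const_mul _) (hq.integrable.const_mul _), integral_const_mul,
      integral_const_mul, hp.integral_eq, hq.integral_eq]
    norm_num

lemma IsDensity.integrable_sqrt_sub_sq {p q : Ω → ℝ} (hp : IsDensity γ p) (hq : IsDensity γ q) :
    Integrable (fun x => (√(p x) - √(q x)) ^ 2) γ := by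
  refine (hp.integrable.add hq.integrable).mono'
    ((hp.measurable.sqrt.sub hq.measurable.sqrt).pow_const 2).aestronglyMeasurable
    (ae_of_all _ fun x => ?_)
  rw [Real.norm_of_nonneg (sq_nonneg _)]
  have h1 := Real.sq_sqrt (hp.nonneg x)
  have h2 := Real.sq_sqrt (hq.nonneg x)
  have h3 := mul_nonneg (Real.sqrt_nonneg (p x)) (Real.sqrt_nonneg (q x))
  show _ ≤ p x + q x
  nlinarith

lemma IsDensity.integrable_klFun_midpoint [IsProbabilityMeasure γ] {p q : Ω → ℝ}
    (hp : IsDensity γ p) (hq : IsDensity γ q)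
    (hp' : Integrable (fun x => klFun (p x)) γ) (hq' : Integrable (fun x => klFun (q x)) γ) :
    Integrable (fun x => klFun (1 / 2 * p x + 1 / 2 * q x)) γ := by
  refine ((hp'.const_mul (1 / 2)).add (hq'.const_mul (1 / 2))).mono'
    (measurable_klFun.comp (hp.midpoint hq).measurable).aestronglyMeasurable
    (ae_of_all _ fun x => ?_)
  rw [Real.norm_of_nonneg (klFun_nonneg ((hp.midpoint hq).nonneg x))]
  have := sqrt_sub_sq_le_klFun (hp.nonneg x) (hq.nonneg x)
  show _ ≤ 1 / 2 * klFun (p x) + 1 / 2 * klFun (q x)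
  nlinarith [sq_nonneg (√(p x) - √(q x))]

lemma IsDensity.integral_sqrt_sub_sq_le [IsProbabilityMeasure γ] {p q : Ω → ℝ}
    (hp : IsDensity γ p) (hq : IsDensity γ q)
    (hp' : Integrable (fun x => klFun (p x)) γ) (hq' : Integrable (fun x => klFun (q x)) γ) :
    1 / 4 * ∫ x, (√(p x) - √(q x)) ^ 2 ∂γ ≤ 1 / 2 * ∫ x, klFun (p x) ∂γ
      + 1 / 2 * ∫ x, klFun (q x) ∂γ - ∫ x, klFun (1 / 2 * p x + 1 / 2 * q x) ∂γ := by
  rw [← integral_const_mul, ← integral_const_mul, ← integral_const_mul,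
    ← integral_add (hp'.const_mul _) (hq'.const_mul _),
    ← integral_sub (by exact (hp'.const_mul _).add (hq'.const_mul _))
      (hp.integrable_klFun_midpoint hq hp' hq')]
  refine integral_mono ((hp.integrable_sqrt_sub_sq hq).const_mul _)
    (((hp'.const_mul _).add (hq'.const_mul _)).sub (hp.integrable_klFun_midpoint hq hp' hq'))
    fun x => ?_
  exact sqrt_sub_sq_le_klFun (hp.nonneg x) (hq.nonneg x)

lemma IsDensity.integral_abs_sub_le {p q : Ω → ℝ} (hp : IsDensity γ p) (hq : IsDensity γ q)
    {η : ℝ} (hη : 0 < η) :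
    ∫ x, |p x - q x| ∂γ ≤ 1 / (2 * η) * ∫ x, (√(p x) - √(q x)) ^ 2 ∂γ + 2 * η := by
  have hi := hp.integrable_sqrt_sub_sq hq
  calc ∫ x, |p x - q x| ∂γ
      ≤ ∫ x, (1 / (2 * η) * (√(p x) - √(q x)) ^ 2 + η * (p x + q x)) ∂γ :=
        integral_mono (hp.integrable.sub hq.integrable).abs
          ((hi.const_mul _).add ((hp.integrable.add hq.integrable).const_mul η))
          fun x => abs_sub_le_sqrt_sub_sq (hp.nonneg x) (hq.nonneg x) hη
    _ = _ := by
        rw [integral_add (hi.const_mul _) (by exact (hp.integrable.add hq.integrable).const_mul η),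
          integral_const_mul, integral_const_mul, integral_add hp.integrable hq.integrable,
          hp.integral_eq, hq.integral_eq]
        ring

/-- A sequence of probability densities that is Cauchy for the Hellinger distance has a subsequence
converging almost everywhere and in `L¹` to a probability density. -/
lemma IsDensity.exists_tendsto {p : ℕ → Ω → ℝ} (hp : ∀ k, IsDensity γ (p k))
    (hc : ∀ ε > 0, ∃ N, ∀ j ≥ N, ∀ k ≥ N, ∫ x, (√(p j x) - √(p k x)) ^ 2 ∂γ ≤ ε) :
    ∃ (q : Ω → ℝ) (ns : ℕ → ℕ), IsDensity γ q ∧ StrictMono ns ∧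
      (∀ᵐ x ∂γ, Tendsto (fun k => p (ns k) x) atTop (𝓝 (q x))) ∧
      Tendsto (fun k => ∫ x, |p (ns k) x - q x| ∂γ) atTop (𝓝 0) := by
  let P : ℕ → Lp ℝ 1 γ := fun k => (hp k).integrable.toL1 (p k)
  have hP : ∀ k, P k =ᵐ[γ] p k := fun k => (hp k).integrable.coeFn_toL1
  have hdist : ∀ j k, dist (P j) (P k) = ∫ x, |p j x - p k x| ∂γ := fun j k => by
    rw [dist_eq_norm, ← Integrable.toL1_sub, L1.norm_of_fun_eq_integral_norm]
    rfl
  have hcauchy : CauchySeq P := by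
    refine Metric.cauchySeq_iff.2 fun ε hε => ?_
    -- With η = ε/4 the L¹ distance is at most ε/8 + ε/2 < ε.
    obtain ⟨N, hN⟩ := hc (ε ^ 2 / 16) (by positivity)
    refine ⟨N, fun j hj k hk => ?_⟩
    rw [hdist]
    have h1 := (hp j).integral_abs_sub_le (hp k) (η := ε / 4) (by positivity)
    have h2 := mul_le_mul_of_nonneg_left (hN j hj k hk) (by positivity : 0 ≤ 1 / (2 * (ε / 4)))
    have h3 : 1 / (2 * (ε / 4)) * (ε ^ 2 / 16) = ε / 8 := by field_simp; norm_num
    linarith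
  obtain ⟨f, hf⟩ := cauchySeq_tendsto_of_complete hcauchy
  obtain ⟨ns, hns, hae⟩ := (tendstoInMeasure_of_tendsto_Lp hf).exists_seq_tendsto_ae
  have hae' : ∀ᵐ x ∂γ, Tendsto (fun k => p (ns k) x) atTop (𝓝 (f x)) := by
    filter_upwards [hae, ae_all_iff.2 hP] with x hx hx'
    simpa only [hx'] using hx
  have hfm : Measurable f := (Lp.stronglyMeasurable f).measurable
  have hfi : Integrable f γ := L1.integrable_coeFn f
  -- The L¹ limit is nonnegative only almost everywhere, whereas a density must be so everywhere;
  -- hence the positive part.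
  have hfq : (fun x => max (f x) 0) =ᵐ[γ] f := by
    filter_upwards [hae'] with x hx
    exact max_eq_left (ge_of_tendsto' hx fun k => (hp _).nonneg x)
  have hqi : Integrable (fun x => max (f x) 0) γ := hfi.congr hfq.symm
  have hL1 : Tendsto (fun k => ∫ x, |p (ns k) x - max (f x) 0| ∂γ) atTop (𝓝 0) := by
    have h0 := (tendsto_iff_dist_tendsto_zero.1 (hf.comp hns.tendsto_atTop))
    refine h0.congr fun k => ?_
    rw [dist_eq_norm, L1.norm_eq_integral_norm]
    refine integral_congr_ae ?_
    filter_upwards [hfq, hP (ns k), Lp.coeFn_sub (P (ns k)) f] with x h1 h2 h3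
    rw [h1]
    show ‖(P (ns k) - f) x‖ = _
    rw [h3, Pi.sub_apply, h2]
    rfl
  refine ⟨fun x => max (f x) 0, ns, ⟨hfm.max measurable_const, fun x => le_max_right _ _, hqi, ?_⟩,
    hns, ?_, hL1⟩
  · have h1 : ∀ k, |1 - ∫ x, max (f x) 0 ∂γ| ≤ ∫ x, |p (ns k) x - max (f x) 0| ∂γ := fun k => by
      rw [← (hp (ns k)).integral_eq, ← integral_sub (hp _).integrable hqi]
      exact abs_integral_le_integral_abs
    have h2 := ge_of_tendsto' hL1 h1
    have h3 := abs_nonpos_iff.1 h2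
    linarith
  · filter_upwards [hae', hfq] with x h1 h2
    rwa [h2]

/-- The direct method: a nonnegative, midpoint convex, `L¹`-Lipschitz perturbation of the relative
entropy attains its infimum over probability densities. -/
theorem exists_isDensity_minimizer [IsProbabilityMeasure γ] {Λ : (Ω → ℝ) → ℝ} {τ M : ℝ}
    (hτ : 0 < τ) (h0 : ∀ p, IsDensity γ p → 0 ≤ Λ p)
    (hconv : ∀ p q, IsDensity γ p → IsDensity γ q →
      Λ (fun x => 1 / 2 * p x + 1 / 2 * q x) ≤ 1 / 2 * Λ p + 1 / 2 * Λ q)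
    (hlip : ∀ p q, IsDensity γ p → IsDensity γ q → |Λ p - Λ q| ≤ M * ∫ x, |p x - q x| ∂γ) :
    ∃ p, IsDensity γ p ∧ Integrable (fun x => klFun (p x)) γ ∧
      ∀ q, IsDensity γ q → Integrable (fun x => klFun (q x)) γ →
        Λ p + τ * ∫ x, klFun (p x) ∂γ ≤ Λ q + τ * ∫ x, klFun (q x) ∂γ := by
  let Ψ : (Ω → ℝ) → ℝ := fun p => Λ p + τ * ∫ x, klFun (p x) ∂γ
  let S : Set (Ω → ℝ) := {p | IsDensity γ p ∧ Integrable (fun x => klFun (p x)) γ}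
  have hkl0 : ∀ p ∈ S, 0 ≤ ∫ x, klFun (p x) ∂γ := fun p hp =>
    integral_nonneg fun x => klFun_nonneg (hp.1.nonneg x)
  have hΨ0 : ∀ p ∈ S, 0 ≤ Ψ p := fun p hp =>
    add_nonneg (h0 p hp.1) (mul_nonneg hτ.le (hkl0 p hp))
  have hone : (fun _ => 1 : Ω → ℝ) ∈ S :=
    ⟨⟨measurable_const, fun _ => zero_le_one, integrable_const _, by simp⟩, by simp⟩
  have hne : (Ψ '' S).Nonempty := ⟨_, _, hone, rfl⟩
  have hbdd : BddBelow (Ψ '' S) := ⟨0, by rintro _ ⟨p, hp, rfl⟩; exact hΨ0 p hp⟩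
  set I := sInf (Ψ '' S) with hI
  have hIle : ∀ p ∈ S, I ≤ Ψ p := fun p hp => csInf_le hbdd ⟨p, hp, rfl⟩
  have hex : ∀ k : ℕ, ∃ p ∈ S, Ψ p < I + 1 / ((k : ℝ) + 1) := fun k => by
    obtain ⟨_, ⟨p, hp, rfl⟩, h⟩ := exists_lt_of_csInf_lt hne
      (lt_add_of_pos_right I (by positivity : 0 < 1 / ((k : ℝ) + 1)))
    exact ⟨p, hp, h⟩
  choose p hpS hpI using hex
  -- The midpoint of p_j and p_k has value at least I, and each of p_j, p_k less than I + 1/(N+1).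
  -- So the Jensen gap of τ times the entropy is at most 1/(N+1), while it dominates τ/4 times the
  -- squared Hellinger distance.
  have hH : ∀ N j k, N ≤ j → N ≤ k →
      ∫ x, (√(p j x) - √(p k x)) ^ 2 ∂γ ≤ 4 / τ * (1 / ((N : ℝ) + 1)) := fun N j k hj hk => by
    have h1 := (hpS j).1.integral_sqrt_sub_sq_le (hpS k).1 (hpS j).2 (hpS k).2
    have h2 := hIle _ ⟨(hpS j).1.midpoint (hpS k).1,
      (hpS j).1.integrable_klFun_midpoint (hpS k).1 (hpS j).2 (hpS k).2⟩
    have h3 := hconv _ _ (hpS j).1 (hpS k).1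
    have h4 := hpI j
    have h5 := hpI k
    have h6 : 1 / ((j : ℝ) + 1) ≤ 1 / ((N : ℝ) + 1) :=
      one_div_le_one_div_of_le (by positivity) (by gcongr)
    have h7 : 1 / ((k : ℝ) + 1) ≤ 1 / ((N : ℝ) + 1) :=
      one_div_le_one_div_of_le (by positivity) (by gcongr)
    have h8 := mul_le_mul_of_nonneg_left h1 hτ.le
    simp only [Ψ] at h2 h4 h5
    rw [div_mul_eq_mul_div, le_div_iff₀ hτ]
    nlinarith
  obtain ⟨q, ns, hq, hns, hae, hL1⟩ := IsDensity.exists_tendsto (fun k => (hpS k).1) fun ε hε => by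
    have := (tendsto_one_div_add_atTop_nhds_zero_nat (𝕜 := ℝ)).const_mul (4 / τ)
    rw [mul_zero] at this
    obtain ⟨N, hN⟩ := (this.eventually_le_const hε).exists
    exact ⟨N, fun j hj k hk => (hH N j k hj hk).trans hN⟩
  have hΛ : Tendsto (fun k => Λ (p (ns k))) atTop (𝓝 (Λ q)) := by
    rw [tendsto_iff_dist_tendsto_zero]
    have h1 := hL1.const_mul M
    rw [mul_zero] at h1
    exact squeeze_zero (fun _ => dist_nonneg) (fun k => hlip _ _ (hpS _).1 hq) h1
  have hb : Tendsto (fun k => (I + 1 / ((ns k : ℝ) + 1) - Λ (p (ns k))) / τ) atTop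
      (𝓝 ((I + 0 - Λ q) / τ)) :=
    ((((tendsto_one_div_add_atTop_nhds_zero_nat (𝕜 := ℝ)).comp hns.tendsto_atTop).const_add I).sub
      hΛ).div_const τ
  have hkb : ∀ k, ∫ x, klFun (p (ns k) x) ∂γ ≤ (I + 1 / ((ns k : ℝ) + 1) - Λ (p (ns k))) / τ :=
    fun k => by
      have := hpI (ns k)
      simp only [Ψ] at this
      rw [le_div_iff₀ hτ]
      linarith
  -- Nonnegativity is needed to recover the real inequality from its `ENNReal.ofReal` form after
  -- Fatou's lemma.
  have hpos : 0 ≤ (I + 0 - Λ q) / τ := ge_of_tendsto' hb fun k => (hkl0 _ (hpS _)).trans (hkb k)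
  have hfatou : ∫⁻ x, ENNReal.ofReal (klFun (q x)) ∂γ ≤ ENNReal.ofReal ((I + 0 - Λ q) / τ) := by
    refine lintegral_le_of_tendsto_ae
      (u := fun k x => ENNReal.ofReal (klFun (p (ns k) x)))
      (b := fun k => ENNReal.ofReal ((I + 1 / ((ns k : ℝ) + 1) - Λ (p (ns k))) / τ))
      (fun k => (measurable_klFun.comp (hpS _).1.measurable).ennreal_ofReal.aemeasurable) ?_
      (ENNReal.tendsto_ofReal hb) fun k => ?_
    · filter_upwards [hae] with x hx
      exact ENNReal.tendsto_ofReal ((continuous_klFun.tendsto _).comp hx)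
    · rw [← ofReal_integral_eq_lintegral_ofReal (hpS _).2
        (ae_of_all _ fun x => klFun_nonneg ((hpS _).1.nonneg x))]
      exact ENNReal.ofReal_le_ofReal (hkb k)
  have hkm : AEStronglyMeasurable (fun x => klFun (q x)) γ :=
    (measurable_klFun.comp hq.measurable).aestronglyMeasurable
  have hnn : 0 ≤ᵐ[γ] fun x => klFun (q x) := ae_of_all _ fun x => klFun_nonneg (hq.nonneg x)
  have hqi : Integrable (fun x => klFun (q x)) γ :=
    ⟨hkm, (hasFiniteIntegral_iff_ofReal hnn).2 (hfatou.trans_lt ENNReal.ofReal_lt_top)⟩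
  refine ⟨q, hq, hqi, fun r hr hr' => le_trans ?_ (hIle r ⟨hr, hr'⟩)⟩
  rw [← ofReal_integral_eq_lintegral_ofReal hqi hnn, ENNReal.ofReal_le_ofReal_iff hpos,
    le_div_iff₀ hτ] at hfatou
  linarith

end Densities

/-! ### Densities and the measures they define. -/

section Density

variable {Ω : Type*} [MeasurableSpace Ω] {γ : Measure Ω}

lemma IsDensity.isProbabilityMeasure {p : Ω → ℝ} (hp : IsDensity γ p) :
    IsProbabilityMeasure (γ.withDensity fun x => ENNReal.ofReal (p x)) := by
  refine ⟨?_⟩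
  rw [withDensity_apply _ .univ, Measure.restrict_univ,
    ← ofReal_integral_eq_lintegral_ofReal hp.integrable (ae_of_all _ hp.nonneg), hp.integral_eq,
    ENNReal.ofReal_one]

lemma IsDensity.integral_withDensity {p : Ω → ℝ} (hp : IsDensity γ p) (u : Ω → ℝ) :
    ∫ x, u x ∂(γ.withDensity fun x => ENNReal.ofReal (p x)) = ∫ x, p x * u x ∂γ := by
  rw [integral_withDensity_eq_integral_toReal_smul hp.measurable.ennreal_ofReal
    (ae_of_all _ fun _ => ENNReal.ofReal_lt_top)]
  simp only [ENNReal.toReal_ofReal (hp.nonneg _), smul_eq_mul]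

lemma IsDensity.integrable_withDensity_iff {p : Ω → ℝ} (hp : IsDensity γ p) {u : Ω → ℝ} :
    Integrable u (γ.withDensity fun x => ENNReal.ofReal (p x)) ↔
      Integrable (fun x => p x * u x) γ := by
  rw [integrable_withDensity_iff_integrable_smul' hp.measurable.ennreal_ofReal
    (ae_of_all _ fun _ => ENNReal.ofReal_lt_top)]
  simp only [ENNReal.toReal_ofReal (hp.nonneg _), smul_eq_mul]

lemma IsDensity.toReal_rnDeriv [SigmaFinite γ] {p : Ω → ℝ} (hp : IsDensity γ p) :
    (fun x => ((γ.withDensity fun x => ENNReal.ofReal (p x)).rnDeriv γ x).toReal) =ᵐ[γ] p := by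
  filter_upwards [Measure.rnDeriv_withDensity γ hp.measurable.ennreal_ofReal] with x hx
  rw [hx, ENNReal.toReal_ofReal (hp.nonneg x)]

lemma isDensity_rnDeriv {μ : Measure Ω} [IsProbabilityMeasure μ] [IsProbabilityMeasure γ]
    (h : μ ≪ γ) : IsDensity γ (fun x => (μ.rnDeriv γ x).toReal) where
  measurable := (Measure.measurable_rnDeriv μ γ).ennreal_toReal
  nonneg _ := ENNReal.toReal_nonneg
  integrable := Measure.integrable_toReal_rnDeriv
  integral_eq := by rw [Measure.integral_toReal_rnDeriv h, probReal_univ]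

lemma withDensity_toReal_rnDeriv {μ : Measure Ω} [IsProbabilityMeasure μ] [IsProbabilityMeasure γ]
    (h : μ ≪ γ) : γ.withDensity (fun x => ENNReal.ofReal (μ.rnDeriv γ x).toReal) = μ := by
  conv_rhs => rw [← Measure.withDensity_rnDeriv_eq μ γ h]
  refine withDensity_congr_ae ?_
  filter_upwards [Measure.rnDeriv_lt_top μ γ] with x hx
  exact ENNReal.ofReal_toReal hx.ne

end Density

/-! ### Existence of a minimizer of the free energy. -/

section Minimizer

variable {n d : ℕ} {D : Measure (E n × ℝ)} {Φ : E n → E d → ℝ} {K lam τ : ℝ} {ℓ ℓ' : ℝ → ℝ → ℝ}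
  {γ : Measure (E d)}

/-- The expected loss of the network with parameter distribution `p γ`. -/
def densityLoss (ℓ : ℝ → ℝ → ℝ) (D : Measure (E n × ℝ)) (Φ : E n → E d → ℝ) (γ : Measure (E d))
    (p : E d → ℝ) : ℝ :=
  ∫ q, ℓ q.2 (networkOutput Φ (γ.withDensity fun x => ENNReal.ofReal (p x)) q.1) ∂D

lemma IsNetwork.integrable_mul (h : IsNetwork D Φ K) {p : E d → ℝ} (hp : Integrable p γ) (z : E n) :
    Integrable (fun x => p x * Φ z x) γ :=
  hp.mul_bdd (h.continuous_right z).aestronglyMeasurable (ae_of_all _ (h.bound z))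

lemma densityLoss_midpoint_le [IsProbabilityMeasure D] (h : IsNetwork D Φ K) (hℓ : IsLoss ℓ ℓ')
    {p q : E d → ℝ} (hp : IsDensity γ p) (hq : IsDensity γ q) :
    densityLoss ℓ D Φ γ (fun x => 1 / 2 * p x + 1 / 2 * q x) ≤
      1 / 2 * densityLoss ℓ D Φ γ p + 1 / 2 * densityLoss ℓ D Φ γ q := by
  have := hp.isProbabilityMeasure
  have := hq.isProbabilityMeasure
  have := (hp.midpoint hq).isProbabilityMeasure
  have i1 := h.integrable_loss hℓ (γ.withDensity fun x => ENNReal.ofReal (p x))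
  have i2 := h.integrable_loss hℓ (γ.withDensity fun x => ENNReal.ofReal (q x))
  unfold densityLoss
  rw [← integral_const_mul, ← integral_const_mul,
    ← integral_add (i1.const_mul _) (i2.const_mul _)]
  refine integral_mono (h.integrable_loss hℓ _) ((i1.const_mul _).add (i2.const_mul _))
    fun r => ?_
  have e : networkOutput Φ (γ.withDensity fun x => ENNReal.ofReal (1 / 2 * p x + 1 / 2 * q x)) r.1 =
      1 / 2 * networkOutput Φ (γ.withDensity fun x => ENNReal.ofReal (p x)) r.1 +
        1 / 2 * networkOutput Φ (γ.withDensity fun x => ENNReal.ofReal (q x)) r.1 := by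
    unfold networkOutput
    rw [hp.integral_withDensity, hq.integral_withDensity, (hp.midpoint hq).integral_withDensity,
      ← integral_const_mul, ← integral_const_mul,
      ← integral_add ((h.integrable_mul hp.integrable _).const_mul _)
        ((h.integrable_mul hq.integrable _).const_mul _)]
    congr 1 with x
    ring
  simp only [e]
  exact (hℓ.convex r.2).2 (Set.mem_univ _) (Set.mem_univ _) (by norm_num) (by norm_num)
    (by norm_num)

/-- Outputs differ by at most K times the L¹ distance, and on [-K, K] the loss is Lipschitz with
constant |y| + K, which is integrable. -/
lemma abs_densityLoss_sub_le [IsProbabilityMeasure D] (h : IsNetwork D Φ K) (hℓ : IsLoss ℓ ℓ')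
    {p q : E d → ℝ} (hp : IsDensity γ p) (hq : IsDensity γ q) :
    |densityLoss ℓ D Φ γ p - densityLoss ℓ D Φ γ q| ≤
      ((∫ r, (|r.2| + K) ∂D) * K) * ∫ x, |p x - q x| ∂γ := by
  have := hp.isProbabilityMeasure
  have := hq.isProbabilityMeasure
  have i1 := h.integrable_loss hℓ (γ.withDensity fun x => ENNReal.ofReal (p x))
  have i2 := h.integrable_loss hℓ (γ.withDensity fun x => ENNReal.ofReal (q x))
  have hout : ∀ z, |networkOutput Φ (γ.withDensity fun x => ENNReal.ofReal (p x)) z -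
      networkOutput Φ (γ.withDensity fun x => ENNReal.ofReal (q x)) z| ≤
        K * ∫ x, |p x - q x| ∂γ := fun z => by
    unfold networkOutput
    rw [hp.integral_withDensity, hq.integral_withDensity,
      ← integral_sub (h.integrable_mul hp.integrable _) (h.integrable_mul hq.integrable _),
      ← integral_const_mul]
    refine abs_integral_le_integral_abs.trans (integral_mono
      ((h.integrable_mul hp.integrable _).sub (h.integrable_mul hq.integrable _)).abs
      ((hp.integrable.sub hq.integrable).abs.const_mul _) fun x => ?_)
    show |p x * Φ z x - q x * Φ z x| ≤ K * |p x - q x|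
    rw [← sub_mul, abs_mul, mul_comm]
    exact mul_le_mul_of_nonneg_right (h.bound z x) (abs_nonneg _)
  unfold densityLoss
  rw [← integral_sub i1 i2, mul_assoc, ← integral_mul_const]
  refine abs_integral_le_integral_abs.trans (integral_mono (i1.sub i2).abs
    (h.integrable_abs.mul_const _) fun r => ?_)
  refine (hℓ.abs_sub_le r.2 (h.abs_output_le _ r.1) (h.abs_output_le _ r.1)).trans ?_
  exact mul_le_mul_of_nonneg_left (hout r.1) (add_nonneg (abs_nonneg _) h.pos.le)

lemma exp_mul_norm_sq_integrable_gauss {t : ℝ} (ht : 0 < t) :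
    Integrable (fun x : E d => Real.exp (1 / (4 * t) * ‖x‖ ^ 2)) (gauss d t) := by
  rw [integrable_gauss_iff ht]
  refine (integrable_exp_neg_mul_sq_norm (d := d) (b := 1 / (4 * t)) (by positivity)).congr
    (ae_of_all _ fun x => ?_)
  simp only [smul_eq_mul]
  rw [← Real.exp_add]
  congr 1
  field_simp
  ring

/-- A density of finite entropy with respect to a Gaussian has finite second moment. -/
lemma IsDensity.isP2a_gauss {t : ℝ} (ht : 0 < t) {p : E d → ℝ} (hp : IsDensity (gauss d t) p)
    (hk : Integrable (fun x => klFun (p x)) (gauss d t)) :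
    IsP2a ((gauss d t).withDensity fun x => ENNReal.ofReal (p x)) := by
  refine ⟨⟨hp.isProbabilityMeasure, ?_⟩,
    (withDensity_absolutelyContinuous _ _).trans (gauss_absolutelyContinuous ht)⟩
  have h1 : Integrable (fun x => p x * ‖x‖ ^ 2) (gauss d t) := by
    refine ((hk.add (exp_mul_norm_sq_integrable_gauss ht)).const_mul (4 * t)).mono'
      (hp.measurable.mul (by fun_prop)).aestronglyMeasurable (ae_of_all _ fun x => ?_)
    rw [Real.norm_of_nonneg (mul_nonneg (hp.nonneg x) (sq_nonneg _))]
    -- Legendre duality for the entropy: s·a ≤ klFun(s) + e^a - 1, with a = ‖x‖²/(4t). The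
    -- coefficient is half of 1/(2t) in the Gaussian exponent, so e^a is Gaussian-integrable.
    have h2 := bregman_nonneg (Real.exp_pos (1 / (4 * t) * ‖x‖ ^ 2)) (hp.nonneg x)
    rw [bregman, Real.log_exp] at h2
    have h3 : p x * (1 / (4 * t) * ‖x‖ ^ 2) ≤
        klFun (p x) + Real.exp (1 / (4 * t) * ‖x‖ ^ 2) := by rw [klFun]; linarith
    calc p x * ‖x‖ ^ 2 = 4 * t * (p x * (1 / (4 * t) * ‖x‖ ^ 2)) := by field_simp
      _ ≤ _ := mul_le_mul_of_nonneg_left h3 (by positivity)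
  have h2 := (hp.integrable_withDensity_iff.2 h1).2
  rw [HasFiniteIntegral] at h2
  refine lt_of_le_of_lt (le_of_eq (lintegral_congr fun x => ?_)) h2
  rw [enorm_pow, enorm_norm]

lemma absolutelyContinuous_gauss {t : ℝ} (ht : 0 < t) : (volume : Measure (E d)) ≪ gauss d t := by
  rw [gauss_eq_tilted ht]
  exact absolutelyContinuous_tilted (integrable_exp_neg_mul_sq_norm (by positivity))

/-- The two log-likelihood ratios differ by a quadratic function and a constant, both μ-integrable
because the second moment is finite. -/
lemma integrable_llr_gauss_iff {t : ℝ} (ht : 0 < t) {μ : Measure (E d)} (hμ : IsP2a μ) :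
    Integrable (llr μ (gauss d t)) μ ↔ Integrable (llr μ volume) μ := by
  have := hμ.1.1
  have hf : Integrable (fun x : E d => -((1 / (2 * t)) * ‖x‖ ^ 2)) μ :=
    (hμ.1.integrable_norm_sq.const_mul _).neg
  have he := integrable_exp_neg_mul_sq_norm (d := d) (b := 1 / (2 * t)) (by positivity)
  rw [gauss_eq_tilted ht, integrable_congr (llr_tilted_right hμ.2 he)]
  exact integrable_add_iff_integrable_right' (hf.neg.add (integrable_const _))

lemma integral_klFun_gauss {t : ℝ} (ht : 0 < t) {μ : Measure (E d)} (hμ : IsP2a μ)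
    (hint : Integrable (llr μ volume) μ) :
    ∫ x, klFun (μ.rnDeriv (gauss d t) x).toReal ∂gauss d t = ∫ x, llr μ volume x ∂μ
      + 1 / (2 * t) * ∫ x, ‖x‖ ^ 2 ∂μ
      + Real.log (∫ x : E d, Real.exp (-((1 / (2 * t)) * ‖x‖ ^ 2))) := by
  have := hμ.1.1
  have hf : Integrable (fun x : E d => -((1 / (2 * t)) * ‖x‖ ^ 2)) μ :=
    (hμ.1.integrable_norm_sq.const_mul _).neg
  have he := integrable_exp_neg_mul_sq_norm (d := d) (b := 1 / (2 * t)) (by positivity)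
  rw [integral_klFun_rnDeriv (hμ.2.trans (absolutelyContinuous_gauss ht))
    ((integrable_llr_gauss_iff ht hμ).2 hint), probReal_univ, probReal_univ, gauss_eq_tilted ht,
    integral_llr_tilted_right hμ.2 hf he hint, integral_neg, integral_const_mul]
  ring

/-- The free energy, in terms of the density with respect to a Gaussian. -/
lemma freeEnergy_risk_eq (hlam : 0 < lam) (hτ : 0 < τ) {μ : Measure (E d)} (hμ : IsP2a μ)
    (hint : Integrable (llr μ volume) μ) :
    freeEnergy (risk ℓ D Φ lam) τ μ =
      ((densityLoss ℓ D Φ (gauss d (τ / lam)) (fun x => (μ.rnDeriv (gauss d (τ / lam)) x).toReal)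
        + τ * ∫ x, klFun (μ.rnDeriv (gauss d (τ / lam)) x).toReal ∂gauss d (τ / lam)
        - τ * Real.log (∫ x : E d, Real.exp (-((1 / (2 * (τ / lam))) * ‖x‖ ^ 2))) : ℝ) : EReal) := by
  have := hμ.1.1
  have ht : 0 < τ / lam := by positivity
  have he : entropy μ = ((∫ x, llr μ volume x ∂μ : ℝ) : EReal) := if_pos ⟨hμ.2, hint⟩
  rw [freeEnergy, he, ← EReal.coe_mul, ← EReal.coe_add, integral_klFun_gauss ht hμ hint, densityLoss,
    withDensity_toReal_rnDeriv (hμ.2.trans (absolutelyContinuous_gauss ht)), risk]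
  congr 1
  -- The variance τ/λ is the one for which the quadratic term of τ times the relative entropy is
  -- exactly the penalty (λ/2)∫‖x‖².
  have : τ * (1 / (2 * (τ / lam))) = lam / 2 := by field_simp
  linear_combination (-∫ x, ‖x‖ ^ 2 ∂μ) * this

/-- The regularized risk has an absolutely continuous minimizer. -/
theorem hasMinimizer_risk [IsProbabilityMeasure D] (h : IsNetwork D Φ K) (hℓ : IsLoss ℓ ℓ')
    (hlam : 0 < lam) (hτ : 0 < τ) : HasMinimizer (risk ℓ D Φ lam) τ := by
  have ht : 0 < τ / lam := by positivity
  obtain ⟨p, hp, hk, hmin⟩ := exists_isDensity_minimizer (γ := gauss d (τ / lam))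
    (Λ := densityLoss ℓ D Φ (gauss d (τ / lam))) hτ
    (fun p _ => integral_nonneg fun r => hℓ.nonneg _ _)
    (fun p q hp hq => densityLoss_midpoint_le h hℓ hp hq)
    (fun p q hp hq => abs_densityLoss_sub_le h hℓ hp hq)
  have hP := hp.isP2a_gauss ht hk
  have := hP.1.1
  have hac := hP.2.trans (absolutelyContinuous_gauss ht)
  have hint := (integrable_llr_gauss_iff ht hP).1
    ((integrable_klFun_rnDeriv_iff hac).1 (hk.congr
      (hp.toReal_rnDeriv.mono fun x hx => by simp only at hx ⊢; rw [hx])))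
  refine ⟨_, hP, fun μ hμ => ?_⟩
  by_cases hμ' : μ ≪ volume ∧ Integrable (llr μ volume) μ
  · have := hμ.1
    have hac' := hμ'.1.trans (absolutelyContinuous_gauss ht)
    have hle := hmin _ (isDensity_rnDeriv hac') ((integrable_klFun_rnDeriv_iff hac').2
      ((integrable_llr_gauss_iff ht ⟨hμ, hμ'.1⟩).2 hμ'.2))
    rw [freeEnergy_risk_eq hlam hτ hP hint, freeEnergy_risk_eq hlam hτ ⟨hμ, hμ'.1⟩ hμ'.2,
      EReal.coe_le_coe_iff]
    have e1 : densityLoss ℓ D Φ (gauss d (τ / lam)) (fun x => (Measure.rnDeriv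
        ((gauss d (τ / lam)).withDensity fun x => ENNReal.ofReal (p x))
          (gauss d (τ / lam)) x).toReal) = densityLoss ℓ D Φ (gauss d (τ / lam)) p := by
      rw [densityLoss, withDensity_toReal_rnDeriv hac, densityLoss]
    have e2 : ∫ x, klFun (Measure.rnDeriv
        ((gauss d (τ / lam)).withDensity fun x => ENNReal.ofReal (p x))
          (gauss d (τ / lam)) x).toReal ∂gauss d (τ / lam) =
        ∫ x, klFun (p x) ∂gauss d (τ / lam) :=
      integral_congr_ae (hp.toReal_rnDeriv.mono fun x hx => by simp only at hx ⊢; rw [hx])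
    rw [e1, e2]
    linarith
  -- A competitor with no density, or with non-integrable log-density, has infinite free energy.
  · have he : entropy μ = ⊤ := if_neg hμ'
    rw [freeEnergy, freeEnergy, he, EReal.coe_mul_top_of_pos hτ, EReal.coe_add_top]
    exact le_top

end Minimizer

end MeanFieldLangevin

end

/-! ### The proposition. -/

theorem mainTheorem5 {n d : ℕ}
    (D : Measure (MeanFieldLangevin.E n × ℝ)) [IsProbabilityMeasure D]
    (hy : MemLp (fun p : MeanFieldLangevin.E n × ℝ => p.2) 2 D)
    (ℓ : ℝ → ℝ → ℝ)
    (hℓ : ℓ = MeanFieldLangevin.squareLoss ∨ ℓ = MeanFieldLangevin.logisticLoss)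
    (Φ : MeanFieldLangevin.E n → MeanFieldLangevin.E d → ℝ)
    (hΦ : Continuous (Function.uncurry Φ))
    (K : ℝ) (hK : 0 < K) (hΦK : ∀ z x, |Φ z x| ≤ K)
    (hΦs : ∃ C : ℝ≥0, ∀ z, Differentiable ℝ (Φ z) ∧ LipschitzWith C (∇ (Φ z)))
    (lam : ℝ) (hlam : 0 < lam) :
    -- the expectations defining the risk and its first variation converge
    (∀ μ, MeanFieldLangevin.IsP2 μ →
      Integrable (fun p => ℓ p.2 (MeanFieldLangevin.networkOutput Φ μ p.1)) D ∧
      ∀ x, Integrable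
        (fun p => deriv (ℓ p.2) (MeanFieldLangevin.networkOutput Φ μ p.1) * Φ p.1 x) D) ∧
    MeanFieldLangevin.IsSmooth (MeanFieldLangevin.risk ℓ D Φ lam) ∧
    MeanFieldLangevin.IsConvex (MeanFieldLangevin.risk ℓ D Φ lam) ∧
    (∀ τ : ℝ, 0 < τ → MeanFieldLangevin.HasMinimizer (MeanFieldLangevin.risk ℓ D Φ lam) τ) ∧
    (∀ μ, MeanFieldLangevin.IsP2 μ →
      MeanFieldLangevin.IsFirstVariation (MeanFieldLangevin.risk ℓ D Φ lam) μ
        (MeanFieldLangevin.riskVariation ℓ D Φ lam μ)) ∧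
    (ℓ = MeanFieldLangevin.logisticLoss → (∀ᵐ p ∂D, |p.2| ≤ 1) →
      ∀ τ : ℝ, 0 < τ →
        MeanFieldLangevin.UniformLSI (MeanFieldLangevin.risk ℓ D Φ lam) τ
          (lam / τ * Real.exp (-2 * K / τ))) ∧
    (ℓ = MeanFieldLangevin.squareLoss →
      ∀ K' : ℝ,
        (∀ᵐ p ∂D, |(D[fun q : MeanFieldLangevin.E n × ℝ => q.2 |
          MeasurableSpace.comap Prod.fst inferInstance]) p| ≤ K') →
        ∀ τ : ℝ, 0 < τ →
          MeanFieldLangevin.UniformLSI (MeanFieldLangevin.risk ℓ D Φ lam) τ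
            (lam / τ * Real.exp (-2 * K * (K + K') / τ))) := by
  obtain ⟨C, hC⟩ := hΦs
  have hN : MeanFieldLangevin.IsNetwork D Φ K := ⟨hy, hΦ, hK, hΦK⟩
  have hs : MeanFieldLangevin.IsSmoothNetwork Φ C := ⟨fun z => (hC z).1, fun z => (hC z).2⟩
  obtain ⟨ℓ', h⟩ : ∃ ℓ', MeanFieldLangevin.IsLoss ℓ ℓ' := by
    rcases hℓ with rfl | rfl
    exacts [⟨_, MeanFieldLangevin.isLoss_square⟩, ⟨_, MeanFieldLangevin.isLoss_logistic⟩]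
  refine ⟨fun μ hμ => ?_, MeanFieldLangevin.isSmooth_risk hN h hs hlam,
    MeanFieldLangevin.isConvex_risk hN h,
    fun τ hτ => MeanFieldLangevin.hasMinimizer_risk hN h hlam hτ,
    fun μ hμ => MeanFieldLangevin.isFirstVariation_risk hN h hμ, ?_, ?_⟩
  · have := hμ.1
    refine ⟨hN.integrable_loss h μ, fun x => ?_⟩
    simp only [(h.hasDerivAt _ _).deriv]
    exact hN.integrable_loss_deriv_mul h μ (hN.continuous_left x) fun z => hΦK z x
  · rintro rfl hD τ hτ
    exact MeanFieldLangevin.uniformLSI_logistic hN hlam hD hτ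
  · rintro rfl K' hD τ hτ
    exact MeanFieldLangevin.uniformLSI_square hN hlam hD hτ
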